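/- Let $P\subset\mathbb R^d$ be a parallelohedron of dimension $d$, i.e. a $d$-dimensional convex polytope some family of whose translates forms a face-to-face tiling of $\mathbb R^d$. The belt of $P$ determined by a $(d-2)$-dimensional face $G$ is the set of all facets of $P$ parallel to $G$. Two facets are antipodal if they are exchanged by the central symmetry of $P$. Let $v(G_P)$ be the set of unordered pairs $\{F,F'\}$ of antipodal facets of $P$ (the vertices of the Venkov graph); two distinct pairs $\{F_1,F_1'\}$, $\{F_2,F_2'\}$ are joined by a red edge if $F_1,F_1',F_2,F_2'$ all belong to one belt consisting of exactly six facets. The facet vector of a facet $F$ is the vector $\mathbf t(F)$ such that $P+\mathbf t(F)$ is the translate of $P$ adjacent to $P$ along $F$, i.e. $P\cap(P+\mathbf t(F))=F$. For $A\subset v(G_P)$ let $\Lambda(A)$ be the additive group generated by the facet vectors of all facets occurring in the pairs that belong to $A$. Suppose that $v(G_P)=A_1\sqcup A_2$ and that no red edge joins an element of $A_1$ to an element of $A_2$. Then: 1. The set $P+\Lambda(A_1)$ is convex. 2. The linear subspaces $\operatorname{aff}\Lambda(A_1)$ and $\operatorname{aff}\Lambda(A_2)$ are complementary in $\mathbb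 R^d$, and, with $\pi$ denoting the projection of $\mathbb R^d$ onto $\operatorname{aff}\Lambda(A_2)$ along $\operatorname{aff}\Lambda(A_1)$, the set $P_2=\pi(P)\subset\operatorname{aff}\Lambda(A_2)$ is a parallelohedron whose affine hull is $\operatorname{aff}\Lambda(A_2)$ (that is, a convex polytope some family of whose translates forms a face-to-face tiling of $\operatorname{aff}\Lambda(A_2)$; a single point if $A_2=\varnothing$), and there is a direct Minkowski sum decomposition $$P+\Lambda(A_1)=\operatorname{aff}\Lambda(A_1)\oplus P_2,$$ meaning that the left-hand side is the Minkowski sum of the two summands and that the linear spaces parallel to the affine hulls of the summands intersect only in $\mathbf 0$. -/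

import Mathlib

open scoped Pointwise

section Parallelohedra

variable {E : Type*} [NormedAddCommGroup E] [NormedSpace ℝ E]

/-- A (nonempty, convex) polytope: the convex hull of a nonempty finite set of points. -/
def IsPolytope (P : Set E) : Prop :=
  ∃ s : Set E, s.Finite ∧ s.Nonempty ∧ P = convexHull ℝ s

/-- The translates `t +ᵥ P`, `t ∈ T`, form a face-to-face tiling of the set `X`: they cover exactly
`X`, distinct ones have disjoint (relative) interiors, and any two of them meet in a common face
(possibly empty, possibly the whole tile). `IsExposed ℝ A B` says that `B` is empty or is the set of
maximizers on `A` of some linear functional, which for polytopes is the notion of a face. -/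
structure IsFaceToFaceTiling (X P T : Set E) : Prop where
  cover : ⋃ t ∈ T, (t +ᵥ P) = X
  disjoint : ∀ s ∈ T, ∀ t ∈ T, s ≠ t →
    Disjoint (intrinsicInterior ℝ (s +ᵥ P)) (intrinsicInterior ℝ (t +ᵥ P))
  faceToFace : ∀ s ∈ T, ∀ t ∈ T, IsExposed ℝ (s +ᵥ P) ((s +ᵥ P) ∩ (t +ᵥ P))

/-- A parallelohedron (in its affine hull): a convex polytope such that some family of its
translates is a face-to-face tiling of its affine hull. The parallelohedra of dimension `d` in
`ℝ ^ d` are those whose affine hull is the whole space. -/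
def IsParallelohedron (P : Set E) : Prop :=
  IsPolytope P ∧ ∃ T : Set E, IsFaceToFaceTiling (affineSpan ℝ P : Set E) P T

/-- `F` is a nonempty face of `P` of codimension `k` in `P`. -/
def IsFaceOfCodim (P : Set E) (k : ℕ) (F : Set E) : Prop :=
  IsExposed ℝ P F ∧ F.Nonempty ∧
    Module.finrank ℝ (vectorSpan ℝ F) + k = Module.finrank ℝ (vectorSpan ℝ P)

/-- A facet: a face of dimension `d - 1`. -/
def IsFacet (P F : Set E) : Prop := IsFaceOfCodim P 1 F

/-- A ridge: a face of dimension `d - 2`. -/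
def IsRidge (P G : Set E) : Prop := IsFaceOfCodim P 2 G

/-- The belt of `P` given by the ridge `G`: all facets of `P` parallel to `G`. -/
def belt (P G : Set E) : Set (Set E) :=
  {F | IsFacet P F ∧ vectorSpan ℝ G ≤ vectorSpan ℝ F}

/-- `F` and `F'` are antipodal facets of `P`: they are exchanged by the central symmetry of `P`. -/
def IsAntipodal (P F F' : Set E) : Prop :=
  IsFacet P F ∧ IsFacet P F' ∧
    ∃ c : E, Equiv.pointReflection c '' P = P ∧ Equiv.pointReflection c '' F = F'

/-- The vertices of the Venkov graph of `P`: unordered pairs of antipodal facets. -/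
def VenkovVertex (P : Set E) : Type _ :=
  {v : Sym2 (Set E) // ∃ F F' : Set E, IsAntipodal P F F' ∧ v = s(F, F')}

/-- The red Venkov graph of `P`: two distinct pairs of antipodal facets are adjacent iff the facets
of both pairs belong to one and the same belt consisting of six facets. -/
def redVenkovGraph (P : Set E) : SimpleGraph (VenkovVertex P) where
  Adj v w := v ≠ w ∧ ∃ G : Set E, IsRidge P G ∧ (belt P G).ncard = 6 ∧
    (∀ F ∈ v.1, F ∈ belt P G) ∧ (∀ F ∈ w.1, F ∈ belt P G)
  symm := ⟨fun _ _ ⟨hne, G, hG, hcard, hv, hw⟩ => ⟨hne.symm, G, hG, hcard, hw, hv⟩⟩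
  loopless := ⟨fun _ h => h.1 rfl⟩

/-- `t` is the facet vector of the facet `F` of `P`: the translate `t +ᵥ P` is adjacent to `P`
along `F`. -/
def IsFacetVector (P F : Set E) (t : E) : Prop :=
  IsFacet P F ∧ P ∩ (t +ᵥ P) = F

/-- `Λ(A)`: the additive group generated by the facet vectors of the facets occurring in the pairs
that belong to `A`. -/
def facetLattice (P : Set E) (A : Set (VenkovVertex P)) : AddSubgroup E :=
  AddSubgroup.closure {t | ∃ v ∈ A, ∃ F ∈ v.1, IsFacetVector P F t}

/-- `aff Λ(A)`. -/
def affLattice (P : Set E) (A : Set (VenkovVertex P)) : AffineSubspace ℝ E :=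
  affineSpan ℝ (facetLattice P A : Set E)

/-- `K = X ⊕ Y`, a direct Minkowski sum: `K` is the Minkowski sum of `X` and `Y`, and the linear
spaces parallel to the affine hulls of `X` and `Y` intersect only in `0`. -/
def IsDirectMinkowskiSum (K X Y : Set E) : Prop :=
  K = X + Y ∧ Disjoint (vectorSpan ℝ X) (vectorSpan ℝ Y)

end Parallelohedra

/-! Translate the centre of P to the origin and write P as the set where finitely many facet normals
satisfy n x ≤ 1, with no normal superfluous. Let t n be the facet vector of the facet with normal n,
and let C₁, C₂ be the normals of the facets in A₁, A₂. Everything rests on one orthogonality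
relation (`apply_facetVector_eq_zero`): n (t k) = 0 whenever n and k belong to different classes.

To prove it, put u = t k and look at the tiling along lines parallel to u. Suppose some facet with
normal in the other class C is transversal to u, and consider the shadow along u of all such facets.
The shadow is closed. Near the relative interior of a facet it contains a neighbourhood. It still
does near the relative interior of a ridge, because every belt has four or six facets
(`ridge_dichotomy`). In a belt of four, the facet is continued by a parallel facet of the adjacent
tile. In a belt of six, the three facets meeting at the ridge all have normals in C, since no red
edge leaves C, and every nearby line crosses one of them. Ridge points suffice along a generic
segment, so the shadow can be followed from a facet in C to the line ℝu itself. But that line meets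
the tile boundaries only in centres of facets of type k, so it hits no facet in C: a contradiction.

Granted the relation, the normals of C₂ vanish on the span of Λ(A₁) and conversely. Boundedness of
the tile and covering by the lattice make the two spans complementary. The inequalities of C₂ alone
describe P + Λ(A₁), which is therefore convex and invariant under the span of Λ(A₁). The projection
of P is, up to translation, a slice of P, so it inherits a face-to-face tiling by Λ(A₂) from the
tiling by P (`IsSplitting`).

The definition of a parallelohedron gives neither central symmetry nor a lattice, so both are
proved. The facet vectors of one tile serve for every tile, hence they generate a group whose
translates of P tile. By Minkowski's argument the halved difference body of P also packs along this
group, so its volume does not exceed that of P. The equality case of the Brunn–Minkowski inequality,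
obtained by one-dimensional transport of section volumes, then makes P centrally symmetric. -/

section FacetNormals

/-! ### Irredundant facet normals; belts have four or six facets. -/

open Topology Filter

variable {E : Type*} [NormedAddCommGroup E] [NormedSpace ℝ E]

/-- The convex set cut out by the inequalities `n x ≤ 1`, `n ∈ N`. -/
def cutBody (N : Set (E →L[ℝ] ℝ)) : Set E := {x | ∀ n ∈ N, n x ≤ 1}

/-- A finite irredundant system of inequalities `n x ≤ 1`. -/
structure IsIrredundant (N : Set (E →L[ℝ] ℝ)) : Prop where
  finite : N.Finite
  witness : ∀ n ∈ N, ∃ p, n p = 1 ∧ ∀ m ∈ N, m ≠ n → m p < 1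

/-- The data of a lattice tiling by a convex body `cutBody N` symmetric about the origin, where
`t n` is the facet vector of the facet with normal `n`. -/
structure IsSymmTiling (N : Set (E →L[ℝ] ℝ)) (t : (E →L[ℝ] ℝ) → E) (L : AddSubgroup E) : Prop
    extends IsIrredundant N where
  neg_mem : ∀ n ∈ N, -n ∈ N
  apply_t : ∀ n ∈ N, n (t n) = 2
  reflect : ∀ n ∈ N, ∀ x ∈ cutBody N, n x = 1 → t n - x ∈ cutBody N
  t_neg : ∀ n ∈ N, t (-n) = -t n
  t_mem : ∀ n ∈ N, t n ∈ L
  disjoint : ∀ v ∈ L, v ≠ 0 → ∀ x, (∀ n ∈ N, n x < 1) → ¬ ∀ n ∈ N, n (x - v) < 1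
  bounded : Bornology.IsBounded (cutBody N)

/-- `y` lies in the relative interior of the ridge of `cutBody N` cut out by `n₁` and `n₂`. -/
structure IsRidgePoint (N : Set (E →L[ℝ] ℝ)) (n₁ n₂ : E →L[ℝ] ℝ) (y : E) : Prop where
  mem₁ : n₁ ∈ N
  mem₂ : n₂ ∈ N
  ne : n₁ ≠ n₂
  eq₁ : n₁ y = 1
  eq₂ : n₂ y = 1
  lt : ∀ m ∈ N, m ≠ n₁ → m ≠ n₂ → m y < 1

variable {N : Set (E →L[ℝ] ℝ)} {t : (E →L[ℝ] ℝ) → E} {L : AddSubgroup E}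

theorem convex_cutBody : Convex ℝ (cutBody N) := by
  intro x hx y hy a b ha hb hab n hn
  have h1 := hx n hn
  have h2 := hy n hn
  simp only [map_add, map_smul, smul_eq_mul]
  nlinarith

theorem isClosed_cutBody : IsClosed (cutBody N) := by
  have : cutBody N = ⋂ n ∈ N, {x | n x ≤ 1} := by
    ext x; simp [cutBody]
  rw [this]
  exact isClosed_biInter fun n _ => isClosed_le n.continuous continuous_const

theorem IsRidgePoint.symm {n₁ n₂ : E →L[ℝ] ℝ} {y : E} (h : IsRidgePoint N n₁ n₂ y) :
    IsRidgePoint N n₂ n₁ y :=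
  ⟨h.mem₂, h.mem₁, h.ne.symm, h.eq₂, h.eq₁, fun m hm h1 h2 => h.lt m hm h2 h1⟩

theorem IsRidgePoint.mem_cutBody {n₁ n₂ : E →L[ℝ] ℝ} {y : E} (h : IsRidgePoint N n₁ n₂ y) :
    y ∈ cutBody N := by
  intro m hm
  by_cases h1 : m = n₁
  · rw [h1, h.eq₁]
  by_cases h2 : m = n₂
  · rw [h2, h.eq₂]
  exact (h.lt m hm h1 h2).le

namespace IsIrredundant

/-- At a witness point of m the other normals are below 1, so a combination of them with nonnegative
weights of total at most 1 cannot reach the value 1. -/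
theorem eq_of_combination (hN : IsIrredundant N) {n₁ n₂ m : E →L[ℝ] ℝ} (h₁ : n₁ ∈ N) (h₂ : n₂ ∈ N)
    (hm : m ∈ N) {x y : ℝ} (hx : 0 ≤ x) (hy : 0 ≤ y) (hxy : x + y ≤ 1)
    (h : m = x • n₁ + y • n₂) : m = n₁ ∨ m = n₂ := by
  by_contra! hne
  obtain ⟨p, hp, hlt⟩ := hN.witness m hm
  have a1 := hlt n₁ h₁ hne.1.symm
  have a2 := hlt n₂ h₂ hne.2.symm
  have : x * n₁ p + y * n₂ p = 1 := by rw [← hp, h]; simp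
  have b1 : 0 ≤ x * (1 - n₁ p) := mul_nonneg hx (by linarith)
  have b2 : 0 ≤ y * (1 - n₂ p) := mul_nonneg hy (by linarith)
  have c1 : x = 0 := (mul_eq_zero.1 (by linarith : x * (1 - n₁ p) = 0)).resolve_right (by linarith)
  have c2 : y = 0 := (mul_eq_zero.1 (by linarith : y * (1 - n₂ p) = 0)).resolve_right (by linarith)
  rw [c1, c2] at this
  linarith

/-- Of three normals on an affine line, one lies between the other two and is a convex combination
of them; the three ranges of x say which one. -/
theorem not_collinear (hN : IsIrredundant N) {n₁ n₂ m : E →L[ℝ] ℝ} (h₁ : n₁ ∈ N) (h₂ : n₂ ∈ N)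
    (hm : m ∈ N) {x : ℝ} (h : m = x • n₁ + (1 - x) • n₂) (h12 : n₁ ≠ n₂) : m = n₁ ∨ m = n₂ := by
  by_contra! hne
  rcases lt_or_ge x 0 with hx | hx
  · have hx1 : (1 - x) ≠ 0 := by linarith
    have : n₂ = (1 - x)⁻¹ • m + (-x * (1 - x)⁻¹) • n₁ := by
      rw [h, smul_add, smul_smul, smul_smul, inv_mul_cancel₀ hx1]; module
    rcases hN.eq_of_combination hm h₁ h₂ (by have : 0 < 1 - x := by linarith
                                             positivity)
      (by have : 0 < 1 - x := by linarith
          have : 0 < -x := by linarith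
          positivity) (by rw [← one_add_mul, ← sub_eq_add_neg, mul_inv_cancel₀ hx1]) this with h | h
    · exact hne.2 h.symm
    · exact h12 h.symm
  rcases le_or_gt x 1 with hx1 | hx1
  · rcases hN.eq_of_combination h₁ h₂ hm hx (by linarith) (by linarith) h with h | h
    · exact hne.1 h
    · exact hne.2 h
  · have hx0 : x ≠ 0 := by linarith
    have : n₁ = x⁻¹ • m + ((x - 1) * x⁻¹) • n₂ := by
      rw [h, smul_add, smul_smul, smul_smul, inv_mul_cancel₀ hx0]; module
    rcases hN.eq_of_combination hm h₂ h₁ (by positivity)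
      (by have : 0 < x - 1 := by linarith
          positivity) (by field_simp; linarith) this with h | h
    · exact hne.1 h.symm
    · exact h12 h

theorem eq_of_smul (hN : IsIrredundant N) {n m : E →L[ℝ] ℝ} (hn : n ∈ N) (hm : m ∈ N) {x : ℝ}
    (hx : 0 < x) (h : m = x • n) : m = n := by
  rcases le_or_gt x 1 with hx1 | hx1
  · rcases hN.eq_of_combination hn hn hm hx.le le_rfl (by linarith) (by simpa using h) with h | h <;>
    exact h
  · have : n = x⁻¹ • m + (0 : ℝ) • m := by rw [h, smul_smul, inv_mul_cancel₀ hx.ne']; simp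
    rcases hN.eq_of_combination hm hm hn (by positivity) le_rfl
      (by simpa using inv_le_one_of_one_le₀ hx1.le) this with h | h <;>
    exact h.symm

/-- Inequalities that are strict at `y` are strict near `y`. -/
theorem eventually_lt (hN : IsIrredundant N) (y : E) :
    ∀ᶠ z in 𝓝 y, ∀ m ∈ N, m y < 1 → m z < 1 := by
  rw [eventually_all_finite hN.finite]
  intro m _
  by_cases h : m y < 1
  · filter_upwards [m.continuous.continuousAt.eventually_lt continuousAt_const h] with z hz _
    exact hz
  · exact Eventually.of_forall fun z h' => absurd h' h

end IsIrredundant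

theorem exists_dual_pair {n₁ n₂ : E →L[ℝ] ℝ} {y : E} (h : n₁ ≠ n₂) (h₁ : n₁ y = 1)
    (h₂ : n₂ y = 1) : ∃ e, n₁ e = 1 ∧ n₂ e = 0 := by
  obtain ⟨v, hv⟩ : ∃ v, n₁ v ≠ n₂ v := by
    by_contra! hc
    exact h (ContinuousLinearMap.ext hc)
  have : n₁ v - n₂ v ≠ 0 := sub_ne_zero.2 hv
  refine ⟨(n₁ v - n₂ v)⁻¹ • (v - n₂ v • y), ?_, ?_⟩
  · simp [h₁, this]
  · simp [h₂]

theorem eq_combination_of_ker {n₁ n₂ m : E →L[ℝ] ℝ} {e₁ e₂ : E} (h11 : n₁ e₁ = 1) (h12 : n₂ e₁ = 0)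
    (h21 : n₁ e₂ = 0) (h22 : n₂ e₂ = 1) (hm : ∀ v, n₁ v = 0 → n₂ v = 0 → m v = 0) :
    m = m e₁ • n₁ + m e₂ • n₂ := by
  ext x
  have := hm (x - n₁ x • e₁ - n₂ x • e₂) (by simp [h11, h21]) (by simp [h12, h22])
  simp only [map_sub, map_smul, smul_eq_mul] at this
  simp only [add_apply, smul_apply, smul_eq_mul]
  linarith

/-- A small displacement of a point keeps the inequalities that are strict there. -/
theorem IsIrredundant.exists_pos_small (hN : IsIrredundant N) (y v : E) :
    ∃ ε > (0 : ℝ), ∀ m ∈ N, m y < 1 → m (y + ε • v) < 1 ∧ m (y - ε • v) < 1 := by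
  have h1 : Tendsto (fun ε : ℝ => y + ε • v) (𝓝[>] 0) (𝓝 y) := by
    have : Tendsto (fun ε : ℝ => y + ε • v) (𝓝 0) (𝓝 (y + (0 : ℝ) • v)) :=
      Continuous.tendsto (by fun_prop) 0
    simpa using this.mono_left nhdsWithin_le_nhds
  have h2 : Tendsto (fun ε : ℝ => y - ε • v) (𝓝[>] 0) (𝓝 y) := by
    have : Tendsto (fun ε : ℝ => y - ε • v) (𝓝 0) (𝓝 (y - (0 : ℝ) • v)) :=
      Continuous.tendsto (by fun_prop) 0
    simpa using this.mono_left nhdsWithin_le_nhds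
  obtain ⟨ε, ⟨ha, hb⟩, hε⟩ := (((h1.eventually (hN.eventually_lt y)).and
    (h2.eventually (hN.eventually_lt y))).and self_mem_nhdsWithin).exists
  exact ⟨ε, hε, fun m hm hlt => ⟨ha m hm hlt, hb m hm hlt⟩⟩

namespace IsSymmTiling

theorem neg_le (h : IsSymmTiling N t L) {n : E →L[ℝ] ℝ} (hn : n ∈ N) {x : E} (hx : x ∈ cutBody N) :
    -1 ≤ n x := by
  have := hx _ (h.neg_mem n hn)
  simp at this
  linarith

theorem neg_mem_cutBody (h : IsSymmTiling N t L) {x : E} (hx : x ∈ cutBody N) :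
    -x ∈ cutBody N := fun n hn => by
  have := h.neg_le hn hx
  simp only [map_neg]; linarith

/-- The facet adjacent to `n₂` on the side opposite to a given ridge of it. -/
theorem exists_opposite (h : IsSymmTiling N t L) {n₁ n₂ : E →L[ℝ] ℝ} {y : E}
    (hy : IsRidgePoint N n₁ n₂ y) :
    ∃ (m : E →L[ℝ] ℝ) (γ δ : ℝ), IsRidgePoint N n₂ m (t n₂ - y) ∧ m = γ • n₁ + δ • n₂ ∧ γ < 0 ∧
      0 ≤ δ := by
  have hN := h.toIsIrredundant
  obtain ⟨e₁, h11, h12⟩ := exists_dual_pair hy.ne hy.eq₁ hy.eq₂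
  obtain ⟨e₂, h22, h21⟩ := exists_dual_pair hy.ne.symm hy.eq₂ hy.eq₁
  have hyb := hy.mem_cutBody
  have hqb : t n₂ - y ∈ cutBody N := h.reflect n₂ hy.mem₂ y hyb hy.eq₂
  have hq2 : n₂ (t n₂ - y) = 1 := by rw [map_sub, h.apply_t n₂ hy.mem₂, hy.eq₂]; norm_num
  -- active normals at the reflected point
  have key : ∀ m ∈ N, m ≠ n₂ → m (t n₂ - y) = 1 →
      ∃ γ δ : ℝ, m = γ • n₁ + δ • n₂ ∧ γ < 0 := by
    intro m hm hne hm1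
    have hcomb : m = m e₁ • n₁ + m e₂ • n₂ := by
      -- A direction v of the ridge can be followed both ways from y without leaving the facet of
      -- n₂. Reflection keeps both points in the body, and since m is maximal at the reflected
      -- point, m v = 0.
      refine eq_combination_of_ker h11 h12 h21 h22 fun v hv1 hv2 => ?_
      obtain ⟨ε, hε, hlt⟩ := hN.exists_pos_small y v
      have hin : ∀ s : ℝ, (s = ε ∨ s = -ε) → t n₂ - (y + s • v) ∈ cutBody N := by
        intro s hs
        apply h.reflect n₂ hy.mem₂
        · intro k hk
          by_cases hk1 : k = n₁
          · simp [hk1, hv1, hy.eq₁]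
          by_cases hk2 : k = n₂
          · simp [hk2, hv2, hy.eq₂]
          have := hlt k hk (hy.lt k hk hk1 hk2)
          rcases hs with rfl | rfl
          · exact this.1.le
          · rw [neg_smul, ← sub_eq_add_neg]; exact this.2.le
        · simp [hv2, hy.eq₂]
      have a := hin ε (Or.inl rfl) m hm
      have b := hin (-ε) (Or.inr rfl) m hm
      simp only [map_sub, map_add, map_smul, smul_eq_mul] at a b hm1
      have a' : 0 ≤ ε * m v := by linarith
      have b' : ε * m v ≤ 0 := by linarith
      have := le_antisymm b' a'
      rcases mul_eq_zero.1 this with h0 | h0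
      · exact absurd h0 hε.ne'
      · exact h0
    refine ⟨_, _, hcomb, ?_⟩
    have hle : m e₁ ≤ 0 := by
      obtain ⟨ε, hε, hlt⟩ := hN.exists_pos_small y e₁
      have hin : t n₂ - (y - ε • e₁) ∈ cutBody N := by
        apply h.reflect n₂ hy.mem₂
        · intro k hk
          by_cases hk1 : k = n₁
          · simp [hk1, h11, hy.eq₁, hε.le]
          by_cases hk2 : k = n₂
          · simp [hk2, h12, hy.eq₂]
          exact (hlt k hk (hy.lt k hk hk1 hk2)).2.le
        · simp [h12, hy.eq₂]
      have a := hin m hm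
      simp only [map_sub, map_smul, smul_eq_mul] at a hm1
      have : ε * m e₁ ≤ 0 := by linarith
      exact nonpos_of_mul_nonpos_right this hε
    refine hle.lt_of_ne fun h0 => hne ?_
    rw [h0, zero_smul, zero_add] at hcomb
    have : m e₂ = 1 := by
      have := congrArg (fun f => f (t n₂ - y)) hcomb
      simp only [smul_apply, hm1, hq2, smul_eq_mul] at this
      linarith
    rw [hcomb, this, one_smul]
  -- existence of an active normal
  have hex : ∃ m ∈ N, m ≠ n₂ ∧ m (t n₂ - y) = 1 := by
    by_contra! hc
    obtain ⟨ε, hε, hlt⟩ := hN.exists_pos_small (t n₂ - y) e₁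
    have hin : t n₂ - ((t n₂ - y) - ε • e₁) ∈ cutBody N := by
      apply h.reflect n₂ hy.mem₂
      · intro k hk
        by_cases hk2 : k = n₂
        · rw [hk2, map_sub, hq2]; simp [h12]
        exact (hlt k hk (lt_of_le_of_ne (hqb k hk) (hc k hk hk2))).2.le
      · rw [map_sub, hq2]; simp [h12]
    have a := hin n₁ hy.mem₁
    have e : t n₂ - (t n₂ - y - ε • e₁) = y + ε • e₁ := by abel
    rw [e, map_add, hy.eq₁, map_smul, h11, smul_eq_mul] at a
    linarith
  obtain ⟨m, hm, hne, hm1⟩ := hex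
  obtain ⟨γ, δ, hcomb, hγ⟩ := key m hm hne hm1
  refine ⟨m, γ, δ, ⟨hy.mem₂, hm, hne.symm, hq2, hm1, fun k hk hk2 hkm => ?_⟩, hcomb, hγ, ?_⟩
  · refine lt_of_le_of_ne (hqb k hk) fun hk1 => ?_
    obtain ⟨γ', δ', hcomb', hγ'⟩ := key k hk hk2 hk1
    have e1 : γ * n₁ (t n₂ - y) + δ = 1 := by
      have := congrArg (fun f => f (t n₂ - y)) hcomb
      simp only [add_apply, smul_apply, hm1, hq2,
        smul_eq_mul] at this
      linarith
    have e2 : γ' * n₁ (t n₂ - y) + δ' = 1 := by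
      have := congrArg (fun f => f (t n₂ - y)) hcomb'
      simp only [add_apply, smul_apply, hk1, hq2,
        smul_eq_mul] at this
      linarith
    rcases hN.not_collinear hm hy.mem₂ hk (x := γ' / γ) (by
      rw [hcomb', hcomb]
      have hγ0 : γ ≠ 0 := hγ.ne
      have : δ' = γ' / γ * δ + (1 - γ' / γ) := by
        field_simp
        have : δ = 1 - γ * n₁ (t n₂ - y) := by linarith
        have h2 : δ' = 1 - γ' * n₁ (t n₂ - y) := by linarith
        rw [this, h2]; ring
      rw [this]
      ext x
      simp only [add_apply, smul_apply, smul_eq_mul]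
      field_simp
      ring) hne with h | h
    · exact hkm h
    · exact hk2 h
  -- The bounds m y ≥ -1 and n₁ (t n₂ - y) ≥ -1 make m (t n₂) and n₁ (t n₂) nonnegative. As γ < 0,
  -- the value γ n₁ (t n₂) + 2δ of m at t n₂ forces δ ≥ 0.
  · have a1 := h.neg_le hm hyb
    have a2 := h.neg_le hy.mem₁ hqb
    have a3 : m (t n₂) = 1 + m y := by rw [map_sub] at hm1; linarith
    have a4 : m (t n₂) = γ * n₁ (t n₂) + δ * 2 := by
      rw [hcomb]; simp [h.apply_t n₂ hy.mem₂]
    rw [map_sub, hy.eq₁] at a2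
    nlinarith

/-- A point of a tile can be moved slightly into the interior of that tile, off a hyperplane. -/
theorem exists_interior_near (hN : IsIrredundant N) {n : E →L[ℝ] ℝ} (hn : n ≠ 0) (c : ℝ)
    {z v : E} (hz : z - v ∈ cutBody N) {U : Set E} (hU : U ∈ 𝓝 z) :
    ∃ w ∈ U, (∀ m ∈ N, m (w - v) < 1) ∧ n w ≠ c := by
  have h1 : Tendsto (fun ε : ℝ => z - ε • (z - v)) (𝓝[>] 0) (𝓝 z) := by
    have : Tendsto (fun ε : ℝ => z - ε • (z - v)) (𝓝 0) (𝓝 (z - (0 : ℝ) • (z - v))) :=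
      Continuous.tendsto (by fun_prop) 0
    simpa using this.mono_left nhdsWithin_le_nhds
  obtain ⟨ε, hε0, hε⟩ := ((h1.eventually (eventually_mem_nhds_iff.2 hU)).and
    (Ioo_mem_nhdsGT (zero_lt_one' ℝ))).exists
  set w := z - ε • (z - v) with hw
  have hwi : ∀ m ∈ N, m (w - v) < 1 := by
    intro m hm
    have : w - v = (1 - ε) • (z - v) := by rw [hw]; module
    rw [this, map_smul, smul_eq_mul]
    have := hz m hm
    nlinarith [hε.1, hε.2]
  by_cases hc : n w = c
  · obtain ⟨e, he⟩ : ∃ e, n e ≠ 0 := by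
      by_contra! hcon
      exact hn (ContinuousLinearMap.ext hcon)
    have h2 : Tendsto (fun ε : ℝ => w + ε • e) (𝓝[>] 0) (𝓝 w) := by
      have : Tendsto (fun ε : ℝ => w + ε • e) (𝓝 0) (𝓝 (w + (0 : ℝ) • e)) :=
        Continuous.tendsto (by fun_prop) 0
      simpa using this.mono_left nhdsWithin_le_nhds
    have h3 : Tendsto (fun ε : ℝ => w + ε • e - v) (𝓝[>] 0) (𝓝 (w - v)) := h2.sub_const v
    obtain ⟨η, ⟨hη1, hη2⟩, hη⟩ := (((h2.eventually hε0).and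
      (h3.eventually (hN.eventually_lt (w - v)))).and self_mem_nhdsWithin).exists
    refine ⟨w + η • e, hη1, fun m hm => hη2 m hm (hwi m hm), ?_⟩
    rw [map_add, hc, map_smul, smul_eq_mul]
    intro h0
    have : η * n e = 0 := by linarith
    rcases mul_eq_zero.1 this with h | h
    · exact (ne_of_gt hη) h
    · exact he h
  · exact ⟨w, mem_of_mem_nhds hε0, hwi, hc⟩

/-- Go around the ridge at y from the tile 0 through t n₁ to the next tile s. If s is t n₂, three
tiles meet there and m₁ = -m₂. Otherwise s must fit without overlap beside the tiles 0 and t n₂;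
this leaves it room only when the facet of t n₂ at y is parallel to that of n₁, which is the case of
four tiles. -/
theorem ridge_dichotomy (h : IsSymmTiling N t L) {n₁ n₂ m₁ m₂ : E →L[ℝ] ℝ} {y : E}
    (hy : IsRidgePoint N n₁ n₂ y) {α β γ δ : ℝ}
    (h1 : IsRidgePoint N n₁ m₁ (t n₁ - y)) (hm1 : m₁ = β • n₂ + α • n₁) (hβ : β < 0)
    (h2 : IsRidgePoint N n₂ m₂ (t n₂ - y)) (hm2 : m₂ = γ • n₁ + δ • n₂) (hγ : γ < 0) (hδ : 0 ≤ δ) :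
    m₁ = -m₂ ∨ m₂ = -n₁ := by
  have hN := h.toIsIrredundant
  by_cases hc : m₁ = -m₂
  · exact Or.inl hc
  right
  set τ := t m₁ with hτ
  have hmτ : m₁ τ = 2 := h.apply_t m₁ h1.mem₂
  -- The facet of the tile t n₁ with normal -m₁ contains y; s is the tile on its other side.
  set s := t n₁ - τ with hs
  have hyb := hy.mem_cutBody
  have hq1 := h1.mem_cutBody
  have hys : y - s = τ - (t n₁ - y) := by rw [hs]; abel
  have hysb : y - s ∈ cutBody N := by
    rw [hys]; exact h.reflect m₁ h1.mem₂ _ hq1 h1.eq₂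
  have hm1ys : m₁ (y - s) = 1 := by
    rw [hys, map_sub, hmτ, h1.eq₂]; norm_num
  have hsL : s ∈ L := L.sub_mem (h.t_mem _ hy.mem₁) (h.t_mem _ h1.mem₂)
  have hs0 : s ≠ 0 := by
    intro h0
    rw [h0, sub_zero] at hm1ys
    have : m₁ = n₂ := by
      by_contra hne
      exact absurd hm1ys (hy.lt m₁ h1.mem₂ h1.ne.symm hne).ne
    obtain ⟨e₂, h22, h21⟩ := exists_dual_pair hy.ne.symm hy.eq₂ hy.eq₁
    have := congrArg (fun f => f e₂) hm1
    rw [‹m₁ = n₂›] at this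
    simp only [add_apply, smul_apply, h22, h21, smul_eq_mul] at this
    linarith
  have hs2 : s ≠ t n₂ := by
    intro h0
    have hneg : (-m₁) (t n₂ - y) = 1 := by
      rw [← h0]
      simp only [neg_apply, map_sub] at hm1ys ⊢
      linarith
    have hmem := h.neg_mem _ h1.mem₂
    by_cases ha : -m₁ = n₂
    · have h3 : m₁ = -n₂ := by rw [← ha, neg_neg]
      have h4 : τ = -t n₂ := by rw [hτ, h3, h.t_neg _ hy.mem₂]
      rw [hs, h4, sub_neg_eq_add, add_eq_right] at h0
      have := h.apply_t _ hy.mem₁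
      rw [h0] at this
      simp at this
    · by_cases hb : -m₁ = m₂
      · exact hc (by rw [← hb, neg_neg])
      · exact absurd hneg (h2.lt _ hmem ha hb).ne
  have hst : s - t n₂ ∈ L := L.sub_mem hsL (h.t_mem _ hy.mem₂)
  have hn2 : n₂ ≠ 0 := by
    intro h0
    have := hy.eq₂
    rw [h0] at this
    simp at this
  -- points on the segment from `y` towards `y - τ` belong to the tile `s`
  have hseg : ∀ ε : ℝ, 0 ≤ ε → ε ≤ 1 → (y - ε • τ) - s ∈ cutBody N := by
    intro ε h0 h1'
    have e : (y - ε • τ) - s = (1 - ε) • (y - s) + ε • (-(t n₁ - y)) := by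
      have : -(t n₁ - y) = (y - s) - τ := by rw [hs]; abel
      rw [this]; module
    rw [e]
    exact convex_cutBody hysb (h.neg_mem_cutBody hq1) (by linarith) h0 (by ring)
  have hA : n₁ τ ≥ 0 := by
    have := h.neg_le hy.mem₁ (x := t n₁ - y - τ) (by
      have := h.neg_mem_cutBody hysb
      rwa [hys, neg_sub] at this)
    rw [map_sub, h1.eq₁] at this
    have h3 := hysb (-n₁) (h.neg_mem _ hy.mem₁)
    rw [hys] at h3
    simp only [neg_apply, map_sub] at h3
    have h4 := h1.eq₁
    rw [map_sub] at h4
    by_contra hneg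
    push Not at hneg
    have h5 := (h.reflect m₁ h1.mem₂ _ hq1 h1.eq₂) (-n₁) (h.neg_mem _ hy.mem₁)
    simp only [neg_apply, map_sub] at h5
    linarith
  have htend : Tendsto (fun ε : ℝ => y - ε • τ) (𝓝[>] 0) (𝓝 y) := by
    have : Tendsto (fun ε : ℝ => y - ε • τ) (𝓝 0) (𝓝 (y - (0 : ℝ) • τ)) :=
      Continuous.tendsto (by fun_prop) 0
    simpa using this.mono_left nhdsWithin_le_nhds
  -- near `y`, the tile `t n₂` is cut out by `-n₂` and `-m₂`
  have hnear2 : ∀ᶠ z in 𝓝 y, 1 < n₂ z → m₂ y < m₂ z → ∀ m ∈ N, m (z - t n₂) < 1 := by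
    have hcont : Tendsto (fun z : E => t n₂ - z) (𝓝 y) (𝓝 (t n₂ - y)) :=
      Continuous.tendsto (by fun_prop) y
    filter_upwards [hcont.eventually (hN.eventually_lt (t n₂ - y))] with z hz hz2 hzm m hm
    have e : m (z - t n₂) = (-m) (t n₂ - z) := by simp
    rw [e]
    by_cases ha : -m = n₂
    · rw [ha, map_sub, h.apply_t _ hy.mem₂]; linarith
    by_cases hb : -m = m₂
    · rw [hb]
      have := h2.eq₂
      rw [map_sub] at this ⊢
      linarith
    exact hz _ (h.neg_mem _ hm) (h2.lt _ (h.neg_mem _ hm) ha hb)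
  have hnear0 : ∀ᶠ z in 𝓝 y, n₁ z < 1 → n₂ z < 1 → ∀ m ∈ N, m z < 1 := by
    filter_upwards [hN.eventually_lt y] with z hz hz1 hz2 m hm
    by_cases ha : m = n₁
    · rwa [ha]
    by_cases hb : m = n₂
    · rwa [hb]
    exact hz m hm (hy.lt m hm ha hb)
  have hm2d : ∀ z, m₂ z - m₂ y = γ * (n₁ z - 1) + δ * (n₂ z - 1) := by
    intro z
    rw [hm2]
    simp [hy.eq₁, hy.eq₂]
    ring
  -- If n₁ τ > 0, the segment from y towards y - τ, which lies in the tile s, enters the half-space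
  -- n₁ < 1. Near y this half-space is filled, up to the hyperplane n₂ = 1, by the tiles 0 and t n₂,
  -- so s would overlap one of them.
  have hA0 : n₁ τ = 0 := by
    by_contra hne
    have hpos : 0 < n₁ τ := lt_of_le_of_ne hA (Ne.symm hne)
    obtain ⟨ε, ⟨hz2, hz0⟩, hε0, hε1⟩ := ((htend.eventually (hnear2.eventually_nhds.and
      hnear0.eventually_nhds)).and (Ioo_mem_nhdsGT (zero_lt_one' ℝ))).exists
    have hlt1 : n₁ (y - ε • τ) < 1 := by
      rw [map_sub, hy.eq₁, map_smul, smul_eq_mul]; nlinarith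
    have hopen : ∀ᶠ z in 𝓝 (y - ε • τ), n₁ z < 1 :=
      n₁.continuous.continuousAt.eventually_lt continuousAt_const hlt1
    obtain ⟨w, ⟨⟨hw2, hw0⟩, hw1⟩, hwi, hwn⟩ := exists_interior_near hN hn2 1
      (hseg ε hε0.le hε1.le) ((hz2.and hz0).and hopen)
    rcases lt_or_gt_of_ne hwn with hlt | hgt
    · exact h.disjoint s hsL hs0 w (hw0 hw1 hlt) hwi
    · have : m₂ y < m₂ w := by
        have := hm2d w
        nlinarith
      refine h.disjoint (s - t n₂) hst (sub_ne_zero.2 hs2) (w - t n₂) (hw2 hgt this) ?_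
      rw [sub_sub_sub_cancel_right]
      exact hwi
  have hb : β * n₂ τ = 2 := by
    have := hmτ
    rw [hm1] at this
    simpa [hA0] using this
  have hbneg : n₂ τ < 0 := by nlinarith
  -- The same segment now runs along n₁ = 1 with n₂ > 1. If δ > 0 it would enter the interior of the
  -- tile t n₂.
  have hδ0 : δ = 0 := by
    by_contra hne
    have hpos : 0 < δ := lt_of_le_of_ne hδ (Ne.symm hne)
    obtain ⟨ε, hz2, hε0, hε1⟩ := ((htend.eventually hnear2.eventually_nhds).and
      (Ioo_mem_nhdsGT (zero_lt_one' ℝ))).exists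
    have e1 : n₁ (y - ε • τ) = 1 := by
      rw [map_sub, hy.eq₁, map_smul, hA0]; simp
    have e2 : 1 < n₂ (y - ε • τ) := by
      rw [map_sub, hy.eq₂, map_smul, smul_eq_mul]; nlinarith
    have e3 : m₂ y < m₂ (y - ε • τ) := by
      have := hm2d (y - ε • τ)
      rw [e1] at this
      nlinarith
    have o2 : ∀ᶠ z in 𝓝 (y - ε • τ), 1 < n₂ z :=
      continuousAt_const.eventually_lt n₂.continuous.continuousAt e2
    have o3 : ∀ᶠ z in 𝓝 (y - ε • τ), m₂ y < m₂ z :=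
      continuousAt_const.eventually_lt m₂.continuous.continuousAt e3
    obtain ⟨w, ⟨⟨hw2, hwa⟩, hwb⟩, hwi, -⟩ := exists_interior_near hN hn2 1
      (hseg ε hε0.le hε1.le) ((hz2.and o2).and o3)
    refine h.disjoint (s - t n₂) hst (sub_ne_zero.2 hs2) (w - t n₂) (hw2 hwa hwb) ?_
    rw [sub_sub_sub_cancel_right]
    exact hwi
  have hneg : m₂ = (-γ) • (-n₁) := by rw [hm2, hδ0]; module
  exact hN.eq_of_smul (h.neg_mem _ hy.mem₁) h2.mem₂ (by linarith) hneg

end IsSymmTiling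

end FacetNormals

/-! ### Belts of six facets, and lines that cross facets of a given class. -/

section FacetNormals

open Topology Filter

variable {E : Type*} [NormedAddCommGroup E] [NormedSpace ℝ E]
variable {N : Set (E →L[ℝ] ℝ)} {t : (E →L[ℝ] ℝ) → E} {L : AddSubgroup E}

/-- `m` completes `n₁, n₂` to a belt of six facets at the ridge point `y`. -/
structure IsHexagon (N : Set (E →L[ℝ] ℝ)) (t : (E →L[ℝ] ℝ) → E) (n₁ n₂ m : E →L[ℝ] ℝ) (y : E) :
    Prop where
  ridge : IsRidgePoint N n₁ n₂ y
  ridge₁ : IsRidgePoint N n₁ (-m) (t n₁ - y)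
  ridge₂ : IsRidgePoint N n₂ m (t n₂ - y)
  comb : ∃ γ δ : ℝ, m = γ • n₁ + δ • n₂ ∧ γ < 0 ∧ 0 < δ

/-- At a common point z of the two facets a combination with weights x, y takes the value x + y,
which is at most 1 as z lies in the body. Hence the cone spanned by two normals sharing a ridge
contains no third normal. -/
theorem IsIrredundant.eq_of_mem_cone (hN : IsIrredundant N) {n₁ n₂ m : E →L[ℝ] ℝ} {z : E}
    (hz : IsRidgePoint N n₁ n₂ z) (hm : m ∈ N) {x y : ℝ} (hx : 0 ≤ x) (hy : 0 ≤ y)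
    (h : m = x • n₁ + y • n₂) : m = n₁ ∨ m = n₂ := by
  refine hN.eq_of_combination hz.mem₁ hz.mem₂ hm hx hy ?_ h
  have := hz.mem_cutBody m hm
  rw [h] at this
  simpa [hz.eq₁, hz.eq₂] using this

namespace IsSymmTiling

theorem neg_ridgePoint (h : IsSymmTiling N t L) {n₁ n₂ : E →L[ℝ] ℝ} {y : E}
    (hy : IsRidgePoint N n₁ n₂ y) : IsRidgePoint N (-n₁) (-n₂) (-y) := by
  refine ⟨h.neg_mem _ hy.mem₁, h.neg_mem _ hy.mem₂, fun e => hy.ne (neg_injective e), by simp [hy.eq₁],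
    by simp [hy.eq₂], fun m hm h1 h2 => ?_⟩
  have := hy.lt (-m) (h.neg_mem _ hm) (fun e => h1 (by rw [← e, neg_neg]))
    (fun e => h2 (by rw [← e, neg_neg]))
  simpa using this

theorem hexagon_or (h : IsSymmTiling N t L) {n₁ n₂ : E →L[ℝ] ℝ} {y : E}
    (hy : IsRidgePoint N n₁ n₂ y) :
    (∃ m, IsHexagon N t n₁ n₂ m y) ∨ IsRidgePoint N n₂ (-n₁) (t n₂ - y) := by
  obtain ⟨m₂, γ, δ, h2, hm2, hγ, hδ⟩ := h.exists_opposite hy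
  obtain ⟨m₁, β, α, h1, hm1, hβ, hα⟩ := h.exists_opposite hy.symm
  rcases h.ridge_dichotomy hy h1 hm1 hβ h2 hm2 hγ hδ with hc | hc
  · left
    refine ⟨m₂, hy, hc ▸ h1, h2, γ, δ, hm2, hγ, ?_⟩
    obtain ⟨e₂, h22, h21⟩ := exists_dual_pair hy.ne.symm hy.eq₂ hy.eq₁
    have e := congrArg (fun f => f e₂) hc
    rw [hm1, hm2] at e
    simp only [add_apply, smul_apply, neg_apply, h22, h21, smul_eq_mul] at e
    linarith
  · right; rw [← hc]; exact h2

/-- Such an n lies in the plane of n₁ and n₂. The rays of ±n₁, ±n₂, ±m cut this plane into six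
cones, each spanned by two normals that share a ridge, so `eq_of_mem_cone` leaves no other normal.
By central symmetry the half-plane q ≥ 0 suffices. -/
theorem eq_of_hexagon (h : IsSymmTiling N t L) {n₁ n₂ m n : E →L[ℝ] ℝ} {y : E}
    (hx : IsHexagon N t n₁ n₂ m y) (hn : n ∈ N) (hker : ∀ v, n₁ v = 0 → n₂ v = 0 → n v = 0) :
    n = n₁ ∨ n = n₂ ∨ n = m ∨ n = -n₁ ∨ n = -n₂ ∨ n = -m := by
  have hy := hx.ridge
  obtain ⟨e₁, h11, h12⟩ := exists_dual_pair hy.ne hy.eq₁ hy.eq₂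
  obtain ⟨e₂, h22, h21⟩ := exists_dual_pair hy.ne.symm hy.eq₂ hy.eq₁
  obtain ⟨γ, δ, hm, hγ, hδ⟩ := hx.comb
  have key : ∀ n ∈ N, ∀ p q : ℝ, n = p • n₁ + q • n₂ → 0 ≤ q →
      n = n₁ ∨ n = n₂ ∨ n = m ∨ n = -n₁ := by
    intro n hn p q hpq hq
    rcases le_or_gt 0 p with hp | hp
    · rcases h.eq_of_mem_cone hy hn hp hq hpq with e | e <;> tauto
    rcases le_or_gt 0 (q - p * δ / γ) with hc | hc
    · have hγ0 := hγ.ne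
      have : n = (q - p * δ / γ) • n₂ + (p / γ) • m := by
        rw [hpq, hm]
        ext v
        simp only [add_apply, smul_apply, smul_eq_mul]
        field_simp
        ring
      rcases h.eq_of_mem_cone hx.ridge₂ hn hc (div_nonneg_of_nonpos hp.le hγ.le) this with e | e <;>
      tauto
    · have hr := h.neg_ridgePoint hx.ridge₁
      rw [neg_neg] at hr
      have : n = (γ * q / δ - p) • (-n₁) + (q / δ) • m := by
        rw [hpq, hm]
        ext v
        simp only [add_apply, smul_apply, neg_apply, smul_eq_mul]
        field_simp
        ring
      have h3 : 0 ≤ γ * q / δ - p := by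
        have : q < p * δ / γ := by linarith
        rw [lt_div_iff_of_neg hγ] at this
        rw [sub_nonneg, le_div_iff₀ hδ]
        linarith
      rcases h.eq_of_mem_cone hr hn h3 (by positivity) this with e | e <;> tauto
  have hcomb := eq_combination_of_ker h11 h12 h21 h22 hker
  rcases le_or_gt 0 (n e₂) with hq | hq
  · rcases key n hn _ _ hcomb hq with e | e | e | e <;> tauto
  · have : -n = (-n e₁) • n₁ + (-n e₂) • n₂ := by
      conv_lhs => rw [hcomb]
      module
    rcases key (-n) (h.neg_mem _ hn) _ _ this (by linarith) with e | e | e | e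
    · exact Or.inr (Or.inr (Or.inr (Or.inl (by rw [← e, neg_neg]))))
    · exact Or.inr (Or.inr (Or.inr (Or.inr (Or.inl (by rw [← e, neg_neg])))))
    · exact Or.inr (Or.inr (Or.inr (Or.inr (Or.inr (by rw [← e, neg_neg])))))
    · exact Or.inl (neg_injective e)

/-- The facet normals of a belt of six facets. -/
theorem ncard_hexagon (h : IsSymmTiling N t L) {n₁ n₂ m : E →L[ℝ] ℝ} {y : E}
    (hx : IsHexagon N t n₁ n₂ m y) :
    {n | n ∈ N ∧ ∀ v, n₁ v = 0 → n₂ v = 0 → n v = 0}.ncard = 6 := by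
  have hy := hx.ridge
  obtain ⟨e₁, h11, h12⟩ := exists_dual_pair hy.ne hy.eq₁ hy.eq₂
  obtain ⟨e₂, h22, h21⟩ := exists_dual_pair hy.ne.symm hy.eq₂ hy.eq₁
  obtain ⟨γ, δ, hm, hγ, hδ⟩ := hx.comb
  have hset : {n | n ∈ N ∧ ∀ v, n₁ v = 0 → n₂ v = 0 → n v = 0} =
      {n₁, n₂, m, -n₁, -n₂, -m} := by
    ext n
    simp only [Set.mem_ofPred_eq, Set.mem_insert_iff, Set.mem_singleton_iff]
    constructor
    · rintro ⟨hn, hk⟩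
      exact h.eq_of_hexagon hx hn hk
    · have := hx.ridge₂.mem₂
      rintro (rfl | rfl | rfl | rfl | rfl | rfl)
      · exact ⟨hy.mem₁, fun v a b => a⟩
      · exact ⟨hy.mem₂, fun v a b => b⟩
      · exact ⟨this, fun v a b => by rw [hm]; simp [a, b]⟩
      · exact ⟨h.neg_mem _ hy.mem₁, fun v a b => by simp [a]⟩
      · exact ⟨h.neg_mem _ hy.mem₂, fun v a b => by simp [b]⟩
      · exact ⟨h.neg_mem _ this, fun v a b => by rw [hm]; simp [a, b]⟩
  have hm1 : m e₁ = γ := by rw [hm]; simp [h11, h12]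
  have hm2 : m e₂ = δ := by rw [hm]; simp [h21, h22]
  have hne : ∀ a b : E →L[ℝ] ℝ, (a e₁ ≠ b e₁ ∨ a e₂ ≠ b e₂) → a ≠ b := by
    rintro a b hab rfl
    simp at hab
  rw [hset, Set.ncard_insert_of_notMem, Set.ncard_insert_of_notMem, Set.ncard_insert_of_notMem,
    Set.ncard_insert_of_notMem, Set.ncard_pair]
  all_goals
    try simp only [Set.mem_insert_iff, Set.mem_singleton_iff, not_or]
    try refine ⟨?_, ?_⟩
    all_goals try refine ⟨?_, ?_⟩
    all_goals try refine ⟨?_, ?_⟩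
    all_goals try refine ⟨?_, ?_⟩
    all_goals
      apply hne
      simp only [neg_apply, h11, h12, h21, h22, hm1, hm2]
      by_contra! hcon
      obtain ⟨hc1, hc2⟩ := hcon
      linarith

end IsSymmTiling

/-- The line through `x` in direction `u` meets, transversally, a facet of the tiling whose normal
belongs to `C`. -/
def HitsAlong (N C : Set (E →L[ℝ] ℝ)) (L : AddSubgroup E) (u x : E) : Prop :=
  ∃ v ∈ L, ∃ n ∈ C, ∃ s : ℝ, n u ≠ 0 ∧ n (x + s • u - v) = 1 ∧ x + s • u - v ∈ cutBody N

theorem HitsAlong.of_add_smul {C : Set (E →L[ℝ] ℝ)} {u x : E} (s : ℝ)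
    (h : HitsAlong N C L u (x + s • u)) : HitsAlong N C L u x := by
  obtain ⟨v, hv, n, hn, r, h1, h2, h3⟩ := h
  have e : x + s • u + r • u - v = x + (s + r) • u - v := by module
  rw [e] at h2 h3
  exact ⟨v, hv, n, hn, s + r, h1, h2, h3⟩

theorem HitsAlong.of_sub_mem {C : Set (E →L[ℝ] ℝ)} {u x w : E} (hw : w ∈ L)
    (h : HitsAlong N C L u (x - w)) : HitsAlong N C L u x := by
  obtain ⟨v, hv, n, hn, r, h1, h2, h3⟩ := h
  have e : x - w + r • u - v = x + r • u - (v + w) := by module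
  rw [e] at h2 h3
  exact ⟨v + w, L.add_mem hv hw, n, hn, r, h1, h2, h3⟩

/-- Lines pass through a facet when they are close to a line through its relative interior. -/
theorem hitsAlong_near_facet (hN : IsIrredundant N) {C : Set (E →L[ℝ] ℝ)} {u y : E}
    {n : E →L[ℝ] ℝ} (hC : n ∈ C) (hu : n u ≠ 0) (hy : n y = 1)
    (hlt : ∀ m ∈ N, m ≠ n → m y < 1) : ∀ᶠ z in 𝓝 y, HitsAlong N C L u z := by
  have ht : Tendsto (fun z => z + ((1 - n z) / n u) • u) (𝓝 y) (𝓝 y) := by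
    have : Tendsto (fun z => z + ((1 - n z) / n u) • u) (𝓝 y) (𝓝 (y + ((1 - n y) / n u) • u)) :=
      Continuous.tendsto (by fun_prop) y
    simpa [hy] using this
  filter_upwards [ht.eventually (hN.eventually_lt y)] with z hz
  have h1 : n (z + ((1 - n z) / n u) • u) = 1 := by
    rw [map_add, map_smul, smul_eq_mul]; field_simp; ring
  refine ⟨0, L.zero_mem, n, hC, (1 - n z) / n u, hu, ?_, ?_⟩
  · rwa [sub_zero]
  · rw [sub_zero]
    intro m hm
    by_cases hmn : m = n
    · rw [hmn, h1]
    · exact (hz m hm (hlt m hm hmn)).le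

/-- Near a ridge, a line that misses the facet of n₁ crosses the hyperplane n₁ = 1 beyond the ridge,
where n₂ > 1. In a belt of four, the facet of t n₂ with the same normal lies there. In a belt of
six, the line meets either the facet of n₂ or the third facet at the ridge, depending on the sign of
n₁ u * n₂ u. Hypothesis `hex` puts both normals in C. -/
theorem hitsAlong_near_ridge (h : IsSymmTiling N t L) {C : Set (E →L[ℝ] ℝ)}
    (hex : ∀ n₁ n₂ m y, IsHexagon N t n₁ n₂ m y → n₁ ∈ C → n₂ ∈ C ∧ -m ∈ C)
    {u y : E} {n₁ n₂ : E →L[ℝ] ℝ} (hy : IsRidgePoint N n₁ n₂ y) (hC : n₁ ∈ C) (hu : n₁ u ≠ 0) :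
    ∀ᶠ z in 𝓝 y, HitsAlong N C L u z := by
  have hN := h.toIsIrredundant
  set g : E → E := fun z => z + ((1 - n₁ z) / n₁ u) • u with hg
  have hgc : Continuous g := by fun_prop
  have hgy : g y = y := by simp [hg, hy.eq₁]
  have hg1 : ∀ z, n₁ (g z) = 1 := by
    intro z
    rw [hg]; simp only
    rw [map_add, map_smul, smul_eq_mul]; field_simp; ring
  have htg : Tendsto g (𝓝 y) (𝓝 y) := by
    have := hgc.tendsto y
    rwa [hgy] at this
  -- points near `y` in the tiles `0` and `t n₂`
  have hb0 : ∀ᶠ w in 𝓝 y, n₁ w ≤ 1 → n₂ w ≤ 1 → w ∈ cutBody N := by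
    filter_upwards [hN.eventually_lt y] with w hw h1 h2 m hm
    by_cases ha : m = n₁
    · rwa [ha]
    by_cases hb : m = n₂
    · rwa [hb]
    exact (hw m hm (hy.lt m hm ha hb)).le
  have hb2 : ∀ m, IsRidgePoint N n₂ m (t n₂ - y) → ∀ᶠ w in 𝓝 y, 1 ≤ n₂ w → m (t n₂ - w) = 1 →
      w - t n₂ ∈ cutBody N := by
    intro m hr
    have hcont : Tendsto (fun z : E => t n₂ - z) (𝓝 y) (𝓝 (t n₂ - y)) :=
      Continuous.tendsto (by fun_prop) y
    filter_upwards [hcont.eventually (hN.eventually_lt (t n₂ - y))] with w hw h1 h2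
    rw [← neg_sub]
    refine h.neg_mem_cutBody fun k hk => ?_
    by_cases ha : k = n₂
    · rw [ha, map_sub, h.apply_t _ hy.mem₂]; linarith
    by_cases hb : k = m
    · rw [hb, h2]
    exact (hw k hk (hr.lt k hk ha hb)).le
  have hit0 : ∀ᶠ z in 𝓝 y, n₂ (g z) ≤ 1 → HitsAlong N C L u z := by
    filter_upwards [htg.eventually hb0] with z hz hle
    refine HitsAlong.of_add_smul ((1 - n₁ z) / n₁ u) ⟨0, L.zero_mem, n₁, hC, 0, hu, ?_, ?_⟩
    · rw [zero_smul, add_zero, sub_zero]; exact hg1 z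
    · rw [zero_smul, add_zero, sub_zero]; exact hz (hg1 z).le hle
  rcases h.hexagon_or hy with ⟨m, hx⟩ | hr
  · obtain ⟨hC2, hC3⟩ := hex _ _ _ _ hx hC
    obtain ⟨γ, δ, hm, hγ, hδ⟩ := hx.comb
    have hmv : ∀ v, m v = γ * n₁ v + δ * n₂ v := fun v => by rw [hm]; simp
    rcases lt_or_ge 0 (n₁ u * n₂ u) with hpq | hpq
    · have hq : n₂ u ≠ 0 := by rintro h0; simp [h0] at hpq
      set g2 : E → E := fun z => g z + ((1 - n₂ (g z)) / n₂ u) • u with hg2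
      have ht2 : Tendsto g2 (𝓝 y) (𝓝 y) := by
        have : Tendsto g2 (𝓝 y) (𝓝 (g2 y)) := Continuous.tendsto (by fun_prop) y
        rwa [show g2 y = y by simp [hg2, hgy, hy.eq₂]] at this
      filter_upwards [hit0, ht2.eventually hb0] with z h0 hz
      rcases le_or_gt (n₂ (g z)) 1 with hle | hgt
      · exact h0 hle
      have e2 : n₂ (g2 z) = 1 := by
        rw [hg2]; simp only
        rw [map_add, map_smul, smul_eq_mul]; field_simp; ring
      have e1 : n₁ (g2 z) ≤ 1 := by
        rw [hg2]; simp only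
        rw [map_add, map_smul, smul_eq_mul, hg1]
        have : (1 - n₂ (g z)) / n₂ u * n₁ u = (1 - n₂ (g z)) * (n₁ u * n₂ u) / (n₂ u) ^ 2 := by
          field_simp
        rw [this]
        have : (1 - n₂ (g z)) * (n₁ u * n₂ u) / (n₂ u) ^ 2 ≤ 0 :=
          div_nonpos_of_nonpos_of_nonneg (by nlinarith) (sq_nonneg _)
        linarith
      refine HitsAlong.of_add_smul ((1 - n₁ z) / n₁ u) (HitsAlong.of_add_smul
        ((1 - n₂ (g z)) / n₂ u) ⟨0, L.zero_mem, n₂, hC2, 0, hq, ?_, ?_⟩)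
      · rw [zero_smul, add_zero, sub_zero]; exact e2
      · rw [zero_smul, add_zero, sub_zero]; exact hz e1 e2.le
    · have hmu : n₁ u * m u < 0 := by
        rw [hmv]
        have : 0 < n₁ u ^ 2 := by positivity
        nlinarith
      have hmu0 : m u ≠ 0 := by rintro h0; simp [h0] at hmu
      -- The point of the line on the hyperplane m = m y, which carries the facet of the tile t n₂
      -- with normal -m.
      set g3 : E → E := fun z => g z + (δ * (1 - n₂ (g z)) / m u) • u with hg3
      have ht3 : Tendsto g3 (𝓝 y) (𝓝 y) := by
        have : Tendsto g3 (𝓝 y) (𝓝 (g3 y)) := Continuous.tendsto (by fun_prop) y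
        rwa [show g3 y = y by simp [hg3, hgy, hy.eq₂]] at this
      filter_upwards [hit0, ht3.eventually (hb2 m hx.ridge₂)] with z h0 hz
      rcases le_or_gt (n₂ (g z)) 1 with hle | hgt
      · exact h0 hle
      have hmy := hx.ridge₂.eq₂
      have e3 : m (g3 z) = m y := by
        have : m (g z) = γ + δ * n₂ (g z) := by rw [hmv, hg1]; ring
        have h5 : m y = γ + δ := by rw [hmv, hy.eq₁, hy.eq₂]; ring
        rw [hg3]; simp only
        rw [map_add, map_smul, smul_eq_mul, this, h5]; field_simp; ring
      have e1 : 1 ≤ n₁ (g3 z) := by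
        rw [hg3]; simp only
        rw [map_add, map_smul, smul_eq_mul, hg1]
        have : δ * (1 - n₂ (g z)) / m u * n₁ u = δ * (1 - n₂ (g z)) * (n₁ u * m u) / (m u) ^ 2 := by
          field_simp
        rw [this]
        have : 0 ≤ δ * (1 - n₂ (g z)) * (n₁ u * m u) / (m u) ^ 2 := by
          refine div_nonneg (mul_nonneg_of_nonpos_of_nonpos ?_ hmu.le) (sq_nonneg _)
          nlinarith
        linarith
      have e2 : 1 ≤ n₂ (g3 z) := by
        have h5 : m y = γ + δ := by rw [hmv, hy.eq₁, hy.eq₂]; ring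
        rw [hmv, h5] at e3
        by_contra! hcon
        nlinarith
      have e4 : m (t n₂ - g3 z) = 1 := by rw [map_sub] at hmy ⊢; rw [e3, hmy]
      refine HitsAlong.of_add_smul ((1 - n₁ z) / n₁ u) (HitsAlong.of_add_smul
        (δ * (1 - n₂ (g z)) / m u) ⟨t n₂, h.t_mem _ hy.mem₂, -m, hC3, 0, by simpa using hmu0, ?_, ?_⟩)
      · rw [zero_smul, add_zero, neg_apply, ← map_neg, neg_sub]; exact e4
      · rw [zero_smul, add_zero]; exact hz e2 e4
  · filter_upwards [hit0, htg.eventually (hb2 _ hr)] with z h0 hz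
    rcases le_or_gt (n₂ (g z)) 1 with hle | hgt
    · exact h0 hle
    have e : n₁ (t n₂) = 0 := by
      have := hr.eq₂
      rw [neg_apply, map_sub, hy.eq₁] at this
      linarith
    refine HitsAlong.of_add_smul ((1 - n₁ z) / n₁ u) ⟨t n₂, h.t_mem _ hy.mem₂, n₁, hC, 0, hu, ?_, ?_⟩
    · rw [zero_smul, add_zero, map_sub, e, sub_zero]; exact hg1 z
    · rw [zero_smul, add_zero]
      refine hz hgt.le ?_
      rw [neg_apply, map_sub, e, hg1]; norm_num

end FacetNormals

/-! ### Generic positions, and the orthogonality of normals to facet vectors of the other class. -/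

section FacetNormals

open Topology Filter

variable {E : Type*} [NormedAddCommGroup E] [NormedSpace ℝ E]

/-- The kernel of a nonzero functional has dense open complement, and the Baire category theorem
handles countably many of them. -/
theorem dense_ne_zero_of_countable [CompleteSpace E] {S : Set (E →L[ℝ] ℝ)} (hS : S.Countable)
    (h0 : ∀ l ∈ S, l ≠ 0) : Dense {x | ∀ l ∈ S, l x ≠ 0} := by
  have : {x | ∀ l ∈ S, l x ≠ 0} = ⋂ l ∈ S, {x : E | l x ≠ 0} := by ext; simp
  rw [this]
  refine dense_biInter_of_isOpen (fun l _ => isOpen_ne_fun l.continuous continuous_const) hS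
    fun l hl => ?_
  intro x
  obtain ⟨v, hv⟩ : ∃ v, l v ≠ 0 := by
    by_contra! hc
    exact h0 l hl (ContinuousLinearMap.ext hc)
  by_cases hx : l x = 0
  · have ht : Tendsto (fun ε : ℝ => x + ε • v) (𝓝[>] 0) (𝓝 x) := by
      have : Tendsto (fun ε : ℝ => x + ε • v) (𝓝 0) (𝓝 (x + (0 : ℝ) • v)) :=
        Continuous.tendsto (by fun_prop) 0
      simpa using this.mono_left nhdsWithin_le_nhds
    refine mem_closure_of_tendsto ht ?_
    filter_upwards [self_mem_nhdsWithin] with ε hε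
    simp [hx, hv, (ne_of_gt (Set.mem_Ioi.1 hε))]
  · exact subset_closure hx

/-- A separated set has only finitely many points in a bounded region. -/
theorem finite_of_separated {X : Type*} [MetricSpace X] [ProperSpace X] {A : Set X} {r : ℝ} (hr : 0 < r)
    (hA : ∀ x ∈ A, ∀ y ∈ A, x ≠ y → r ≤ dist x y) (hb : Bornology.IsBounded A) : A.Finite := by
  by_contra hinf
  obtain ⟨x, -, hx⟩ := Set.Infinite.exists_accPt_of_subset_isCompact hinf
    hb.isCompact_closure subset_closure
  have key : ∀ ε > 0, ∃ y ∈ A, y ≠ x ∧ dist y x < ε := by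
    intro ε hε
    have := (accPt_iff_frequently.1 hx)
    have h2 := this.and_eventually (Metric.ball_mem_nhds x hε)
    obtain ⟨y, ⟨h3, h4⟩, h5⟩ := h2.exists
    exact ⟨y, h4, h3, h5⟩
  obtain ⟨y, hy, hyx, hyd⟩ := key (r / 2) (by positivity)
  obtain ⟨z, hz, hzx, hzd⟩ := key (min (r / 2) (dist y x)) (lt_min (by positivity) (dist_pos.2 hyx))
  have hne : y ≠ z := by
    rintro rfl
    exact absurd hzd (by simp)
  have h1 := hA y hy z hz hne
  have h2 := dist_triangle_right y z x
  have h3 := min_le_left (r / 2) (dist y x)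
  linarith

/-- Three linear conditions on a two-parameter family give a nontrivial linear dependence. -/
theorem exists_common_annihilator (a b : Fin 3 → ℝ) :
    ∃ c : Fin 3 → ℝ, c ≠ 0 ∧ ∑ i, c i * a i = 0 ∧ ∑ i, c i * b i = 0 := by
  let f : (Fin 3 → ℝ) →ₗ[ℝ] (Fin 2 → ℝ) :=
    { toFun := fun c => ![∑ i, c i * a i, ∑ i, c i * b i]
      map_add' := by
        intro x y
        ext i
        fin_cases i <;> simp [Fin.sum_univ_three] <;> ring
      map_smul' := by
        intro r x
        ext i
        fin_cases i <;> simp [Fin.sum_univ_three] <;> ring }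
  have hk : f.ker ≠ ⊥ := LinearMap.ker_ne_bot_of_finrank_lt (by simp)
  obtain ⟨c, hc, hc0⟩ := (Submodule.ne_bot_iff _).1 hk
  have h2 : f c = 0 := hc
  have e0 := congrFun h2 0
  have e1 := congrFun h2 1
  exact ⟨c, hc0, by simpa [f] using e0, by simpa [f] using e1⟩

variable {N : Set (E →L[ℝ] ℝ)} {t : (E →L[ℝ] ℝ) → E} {L : AddSubgroup E}

/-- For generic `x`, the points of the plane spanned by `x` and `u` lie on at most two independent
facet hyperplanes of any tile, except possibly those on the line spanned by `u`. -/
theorem dense_generic [CompleteSpace E] (hN : N.Finite) (hL : (L : Set E).Countable) (u : E) :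
    Dense {x : E | ∀ i ∈ N, ∀ j ∈ N, ∀ k ∈ N, ∀ v ∈ L, ∀ σ τ : ℝ, σ ≠ 0 →
      i (σ • x + τ • u - v) = 1 → j (σ • x + τ • u - v) = 1 → k (σ • x + τ • u - v) = 1 →
      ¬ LinearIndependent ℝ ![i, j, k]} := by
  choose c hc0 hca hcb using exists_common_annihilator
  -- Three active equations read σ (i x) + τ (i u) = 1 + i v, and likewise for j and k. Coefficients
  -- that annihilate both the values at u and the right-hand sides give σ * F q x = 0. If i, j, k
  -- are independent then F q ≠ 0, so x lies in one of countably many hyperplanes.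
  let F : ((E →L[ℝ] ℝ) × (E →L[ℝ] ℝ) × (E →L[ℝ] ℝ)) × E → (E →L[ℝ] ℝ) := fun q =>
    ∑ s, (c ![q.1.1 u, q.1.2.1 u, q.1.2.2 u]
      ![1 + q.1.1 q.2, 1 + q.1.2.1 q.2, 1 + q.1.2.2 q.2]) s • (![q.1.1, q.1.2.1, q.1.2.2] s)
  have hcount : ((N ×ˢ N ×ˢ N) ×ˢ (L : Set E)).Countable :=
    (hN.countable.prod (hN.countable.prod hN.countable)).prod hL
  refine (dense_ne_zero_of_countable (S := F '' ((N ×ˢ N ×ˢ N) ×ˢ (L : Set E)) \ {0})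
    ((hcount.image F).mono Set.sdiff_subset) fun l hl => hl.2).mono ?_
  intro x hx i hi j hj k hk v hv σ τ hσ h1 h2 h3 hli
  set q : ((E →L[ℝ] ℝ) × (E →L[ℝ] ℝ) × (E →L[ℝ] ℝ)) × E := ((i, j, k), v) with hq
  set d := c ![i u, j u, k u] ![1 + i v, 1 + j v, 1 + k v] with hd
  have hF : F q = d 0 • i + d 1 • j + d 2 • k := by
    simp [F, Fin.sum_univ_three, hq, hd]
  have hne : F q ≠ 0 := by
    intro h0
    have := Fintype.linearIndependent_iff.1 hli d (by
      rw [Fin.sum_univ_three]; rw [hF] at h0; simpa using h0)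
    exact hc0 _ _ (funext this)
  have hFx : F q x ≠ 0 := hx (F q) ⟨⟨q, ⟨⟨hi, hj, hk⟩, hv⟩, rfl⟩, hne⟩
  have ea := hca ![i u, j u, k u] ![1 + i v, 1 + j v, 1 + k v]
  have eb := hcb ![i u, j u, k u] ![1 + i v, 1 + j v, 1 + k v]
  rw [← hd, Fin.sum_univ_three] at ea eb
  simp only [Matrix.cons_val_zero, Matrix.cons_val_one, Matrix.cons_val] at ea eb
  apply hFx
  have : σ * F q x = 0 := by
    rw [hF]
    simp only [map_sub, map_add, map_smul, smul_eq_mul, add_apply, smul_apply] at h1 h2 h3 ⊢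
    linear_combination d 0 * h1 + d 1 * h2 + d 2 * h3 - τ * ea + eb
  exact (mul_eq_zero.1 this).resolve_left hσ

namespace IsSymmTiling

theorem strictInterior_nhds_zero (hN : IsIrredundant N) :
    ∃ r > 0, ∀ x : E, ‖x‖ < r → ∀ m ∈ N, m x < 1 := by
  have := hN.eventually_lt 0
  obtain ⟨r, hr, h⟩ := Metric.eventually_nhds_iff.1 this
  exact ⟨r, hr, fun x hx m hm => h (by simpa using hx) m hm (by simp)⟩

theorem finite_of_bounded [ProperSpace E] (h : IsSymmTiling N t L) {B : Set E}
    (hB : Bornology.IsBounded B) : {v ∈ B | v ∈ L}.Finite := by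
  obtain ⟨r, hr, hlt⟩ := strictInterior_nhds_zero h.toIsIrredundant
  refine finite_of_separated hr ?_ (hB.subset (Set.sep_subset _ _))
  rintro x ⟨-, hx⟩ y ⟨-, hy⟩ hne
  by_contra! hd
  rw [dist_eq_norm] at hd
  refine h.disjoint (x - y) (L.sub_mem hx hy) (sub_ne_zero.2 hne) (x - y) (hlt _ hd) ?_
  intro n _
  simp

/-- Half the facet vector is the centre of the facet: the midpoint of a witness p and its reflection
t k - p. Since p is strict for every other normal, so is the midpoint. -/
theorem half_facetVector (h : IsSymmTiling N t L) {k : E →L[ℝ] ℝ} (hk : k ∈ N) :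
    k ((1 / 2 : ℝ) • t k) = 1 ∧ ∀ m ∈ N, m ≠ k → m ((1 / 2 : ℝ) • t k) < 1 := by
  constructor
  · rw [map_smul, h.apply_t _ hk]; norm_num
  · intro m hm hne
    obtain ⟨p, hp, hlt⟩ := h.witness k hk
    have hpb : p ∈ cutBody N := fun m hm => by
      by_cases hmk : m = k
      · rw [hmk, hp]
      · exact (hlt m hm hmk).le
    have h1 := hlt m hm hne
    have h2 := h.reflect k hk p hpb hp m hm
    rw [map_sub] at h2
    rw [map_smul, smul_eq_mul]
    linarith

/-- The line spanned by a facet vector passes through the relative interiors of facets of that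
type only. -/
theorem not_hitsAlong_zero (h : IsSymmTiling N t L) {C : Set (E →L[ℝ] ℝ)} (hCN : C ⊆ N)
    {k : E →L[ℝ] ℝ} (hk : k ∈ N) (hkC : k ∉ C) (hkC' : -k ∉ C) : ¬ HitsAlong N C L (t k) 0 := by
  have hN := h.toIsIrredundant
  have hk0 : k ≠ 0 := by
    rintro rfl
    have := h.apply_t _ hk
    simp at this
  obtain ⟨hh1, hh2⟩ := h.half_facetVector hk
  have hhb : ∀ m ∈ N, m (t k) ≤ 2 := by
    intro m hm
    by_cases hmk : m = k
    · rw [hmk, h.apply_t _ hk]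
    · have := hh2 m hm hmk
      rw [map_smul, smul_eq_mul] at this
      linarith
  -- points close to the center of a tile
  have small : ∀ s : ℝ, |s| < 1 / 2 → ∀ v ∈ L, ∀ n ∈ C, n (s • t k - v) = 1 →
      s • t k - v ∈ cutBody N → False := by
    intro s hs v hv n hn hn1 hb
    have hlt : ∀ m ∈ N, m (s • t k) < 1 := by
      intro m hm
      rw [map_smul, smul_eq_mul]
      have a1 := hhb m hm
      have a2 := hhb _ (h.neg_mem _ hm)
      rw [neg_apply] at a2
      have : |s| * |m (t k)| < 1 := by
        have h2 : |m (t k)| ≤ 2 := abs_le.2 ⟨by linarith, a1⟩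
        nlinarith [abs_nonneg s]
      rw [← abs_mul] at this
      exact (le_abs_self _).trans_lt this
    by_cases hv0 : v = 0
    · rw [hv0, sub_zero] at hn1
      exact absurd hn1 (hlt n (hCN hn)).ne
    · have hU : ∀ᶠ w in 𝓝 (s • t k), ∀ m ∈ N, m w < 1 := by
        filter_upwards [hN.eventually_lt (s • t k)] with w hw m hm
        exact hw m hm (hlt m hm)
      obtain ⟨w, hw, hwi, -⟩ := exists_interior_near hN hk0 1 hb hU
      exact h.disjoint v hv hv0 w hw hwi
  rintro ⟨v, hv, n, hn, s, -, hn1, hb⟩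
  rw [zero_add] at hn1 hb
  have htL := h.t_mem _ hk
  -- reduce the parameter modulo `1`
  have e : s • t k - v = Int.fract s • t k - (v - ⌊s⌋ • t k) := by
    conv_lhs => rw [← Int.fract_add_floor s]
    rw [add_smul, Int.cast_smul_eq_zsmul]
    abel
  have hv' : v - ⌊s⌋ • t k ∈ L := L.sub_mem hv (L.zsmul_mem htL _)
  rw [e] at hn1 hb
  set w := v - ⌊s⌋ • t k with hw
  set r := Int.fract s with hr
  have hr0 : 0 ≤ r := Int.fract_nonneg s
  have hr1 : r < 1 := Int.fract_lt_one s
  have e2 : r • t k - w = (r - 1) • t k - (w - t k) := by module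
  rcases lt_trichotomy r (1 / 2) with hlt | heq | hgt
  · exact small r (by rwa [abs_of_nonneg hr0]) w hv' n hn hn1 hb
  -- At parameter 1/2 the line is at the centre of the facet between the tiles 0 and t k, and these
  -- two fill a neighbourhood. If the tile w is one of them, then n or -n is k, which is excluded;
  -- if not, w overlaps one of them.
  · have hwk : w ≠ 0 := by
      rintro h0
      rw [h0, heq, sub_zero] at hn1
      have : n = k := by
        by_contra hne
        exact absurd hn1 (hh2 n (hCN hn) hne).ne
      exact hkC (this ▸ hn)
    have hwk2 : w - t k ≠ 0 := by
      intro h0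
      rw [e2, h0, heq, sub_zero] at hn1
      have h3 : (-n) ((1 / 2 : ℝ) • t k) = 1 := by
        rw [neg_apply, ← map_neg]
        convert hn1 using 2
        module
      have : -n = k := by
        by_contra hne
        exact absurd h3 (hh2 (-n) (h.neg_mem _ (hCN hn)) hne).ne
      exact hkC' (by rw [← this, neg_neg]; exact hn)
    rw [heq] at hb
    have hU : ∀ᶠ z in 𝓝 ((1 / 2 : ℝ) • t k), ∀ m ∈ N, m ≠ k → m z < 1 := by
      filter_upwards [hN.eventually_lt ((1 / 2 : ℝ) • t k)] with z hz m hm hne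
      exact hz m hm (hh2 m hm hne)
    have hU' : ∀ᶠ z in 𝓝 ((1 / 2 : ℝ) • t k), ∀ m ∈ N, m ≠ k → m (t k - z) < 1 := by
      have : Tendsto (fun z => t k - z) (𝓝 ((1 / 2 : ℝ) • t k)) (𝓝 ((1 / 2 : ℝ) • t k)) := by
        have h4 : Tendsto (fun z => t k - z) (𝓝 ((1 / 2 : ℝ) • t k))
          (𝓝 (t k - (1 / 2 : ℝ) • t k)) := Continuous.tendsto (by fun_prop) _
        rwa [show t k - (1 / 2 : ℝ) • t k = (1 / 2 : ℝ) • t k by module] at h4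
      exact this.eventually hU
    obtain ⟨z, ⟨hz, hz'⟩, hzi, hzk⟩ := exists_interior_near hN hk0 1 hb (hU.and hU')
    rcases lt_or_gt_of_ne hzk with hlt | hgt
    · refine h.disjoint w hv' hwk z (fun m hm => ?_) hzi
      by_cases hmk : m = k
      · rwa [hmk]
      · exact hz m hm hmk
    · refine h.disjoint (w - t k) (L.sub_mem hv' htL) hwk2 (z - t k) (fun m hm => ?_) ?_
      · have e5 : m (z - t k) = (-m) (t k - z) := by simp
        rw [e5]
        by_cases hmk : -m = k
        · rw [hmk, map_sub, h.apply_t _ hk]; linarith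
        · exact hz' _ (h.neg_mem _ hm) hmk
      · rwa [sub_sub_sub_cancel_right]
  · rw [e2] at hn1 hb
    exact small (r - 1) (by rw [abs_of_nonpos] <;> linarith) (w - t k) (L.sub_mem hv' htL) n hn
      hn1 hb

/-- Two distinct normals equal to 1 at y are independent, so a third one active there is dependent
on them; equality of the three values at y places it on their affine line, against `not_collinear`.
Thus y is interior to a facet or to a ridge. -/
theorem hitsAlong_near_generic (h : IsSymmTiling N t L) {C : Set (E →L[ℝ] ℝ)} (hCN : C ⊆ N)
    (hex : ∀ n₁ n₂ m y, IsHexagon N t n₁ n₂ m y → n₁ ∈ C → n₂ ∈ C ∧ -m ∈ C)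
    {u y : E} {n₁ : E →L[ℝ] ℝ} (hC : n₁ ∈ C) (hu : n₁ u ≠ 0) (hy : n₁ y = 1) (hb : y ∈ cutBody N)
    (hgen : ∀ i ∈ N, ∀ j ∈ N, ∀ k ∈ N, i y = 1 → j y = 1 → k y = 1 →
      ¬ LinearIndependent ℝ ![i, j, k]) :
    ∀ᶠ z in 𝓝 y, HitsAlong N C L u z := by
  have hN := h.toIsIrredundant
  by_cases hone : ∀ m ∈ N, m ≠ n₁ → m y < 1
  · exact hitsAlong_near_facet hN hC hu hy hone
  push Not at hone
  obtain ⟨n₂, hn2, hne, hge⟩ := hone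
  have hy2 : n₂ y = 1 := le_antisymm (hb n₂ hn2) hge
  refine hitsAlong_near_ridge h hex (n₂ := n₂) ⟨hCN hC, hn2, hne.symm, hy, hy2, fun m hm h1 h2 => ?_⟩
    hC hu
  refine lt_of_le_of_ne (hb m hm) fun hm1 => ?_
  have hd := hgen n₁ (hCN hC) n₂ hn2 m hm hy hy2 hm1
  rw [Fintype.not_linearIndependent_iff] at hd
  obtain ⟨g, hg, i, hi⟩ := hd
  rw [Fin.sum_univ_three] at hg
  simp only [Matrix.cons_val_zero, Matrix.cons_val_one, Matrix.cons_val] at hg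
  have hs : g 0 + g 1 + g 2 = 0 := by
    have := congrArg (fun f => f y) hg
    simpa [hy, hy2, hm1] using this
  have hg2 : g 2 ≠ 0 := by
    intro h0
    obtain ⟨v, hv1, hv2⟩ := exists_dual_pair hne.symm hy hy2
    have := congrArg (fun f => f v) hg
    simp [hv1, hv2, h0] at this
    have h1' : g 1 = 0 := by linarith
    fin_cases i <;> simp_all
  rcases hN.not_collinear (hCN hC) hn2 hm (x := -(g 0 / g 2)) (by
    have e1 : g 1 = -g 0 - g 2 := by linarith
    rw [e1] at hg
    ext v
    have := congrArg (fun f => f v) hg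
    simp only [add_apply, smul_apply, smul_eq_mul, zero_apply] at this ⊢
    field_simp
    linarith) hne.symm with e | e
  · exact h1 e
  · exact h2 e

/-- A facet vector is parallel to every facet whose normal lies in a family `C` that is closed under
belts of six facets and does not contain the normals of the facet itself. -/
theorem apply_facetVector_eq_zero [FiniteDimensional ℝ E] (h : IsSymmTiling N t L)
    (hL : (L : Set E).Countable)
    {C : Set (E →L[ℝ] ℝ)} (hCN : C ⊆ N)
    (hex : ∀ n₁ n₂ m y, IsHexagon N t n₁ n₂ m y → n₁ ∈ C → n₂ ∈ C ∧ -m ∈ C)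
    {n k : E →L[ℝ] ℝ} (hn : n ∈ C) (hk : k ∈ N) (hkC : k ∉ C) (hkC' : -k ∉ C) : n (t k) = 0 := by
  have : ProperSpace E := FiniteDimensional.proper ℝ E
  have : CompleteSpace E := FiniteDimensional.complete ℝ E
  have hN := h.toIsIrredundant
  by_contra hu
  set u := t k with hu_def
  have huL : u ∈ L := h.t_mem _ hk
  obtain ⟨p, hp, hplt⟩ := h.witness n (hCN hn)
  obtain ⟨O, hO, hOopen, hpO⟩ := eventually_nhds_iff.1
    (hitsAlong_near_facet (L := L) hN hn hu hp hplt)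
  obtain ⟨x, hgen, hxO⟩ := (dense_generic h.finite hL u).exists_mem_open hOopen ⟨p, hpO⟩
  -- The segment from x, which is chosen on a line through the facet of n, to 0, whose line hits no
  -- facet of C. The first parameter at which a hit occurs gives the contradiction.
  set S : Set ℝ := {σ ∈ Set.Icc (0 : ℝ) 1 | HitsAlong N C L u (σ • x)} with hS
  have h1S : (1 : ℝ) ∈ S := ⟨⟨zero_le_one, le_rfl⟩, by rw [one_smul]; exact hO x hxO⟩
  have h0S : (0 : ℝ) ∉ S := fun h0 => by
    have := h0.2
    rw [zero_smul] at this
    exact h.not_hitsAlong_zero hCN hk hkC hkC' this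
  -- `S` is closed
  obtain ⟨R, hR⟩ := h.bounded.exists_norm_le
  have hfin : {v ∈ Metric.closedBall (0 : E) (‖x‖ + ‖u‖ + R) | v ∈ L}.Finite :=
    h.finite_of_bounded Metric.isBounded_closedBall
  set V := {v ∈ Metric.closedBall (0 : E) (‖x‖ + ‖u‖ + R) | v ∈ L} with hV
  -- As u is in L, the position along the line matters only modulo 1. The tiles then range over a
  -- finite set, and S is a finite union of projections of compact sets.
  have hSeq : S = ⋃ v ∈ V, ⋃ m ∈ {m ∈ C | m u ≠ 0}, Prod.fst '' {q : ℝ × ℝ |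
      q ∈ Set.Icc (0 : ℝ) 1 ×ˢ Set.Icc (0 : ℝ) 1 ∧ m (q.1 • x + q.2 • u - v) = 1 ∧
      q.1 • x + q.2 • u - v ∈ cutBody N} := by
    ext σ
    simp only [Set.mem_iUnion, Set.mem_image, exists_prop]
    constructor
    · rintro ⟨hσ, v, hv, m, hm, s, hmu, h1, h2⟩
      have e : σ • x + s • u - v = σ • x + Int.fract s • u - (v - ⌊s⌋ • u) := by
        conv_lhs => rw [← Int.fract_add_floor s]
        rw [add_smul, Int.cast_smul_eq_zsmul]
        abel
      rw [e] at h1 h2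
      have hr0 := Int.fract_nonneg s
      have hr1 := (Int.fract_lt_one s).le
      refine ⟨v - ⌊s⌋ • u, ⟨?_, L.sub_mem hv (L.zsmul_mem huL _)⟩, m, ⟨hm, hmu⟩,
        (σ, Int.fract s), ⟨⟨hσ, hr0, hr1⟩, h1, h2⟩, rfl⟩
      have := hR _ h2
      rw [mem_closedBall_zero_iff]
      have e3 : v - ⌊s⌋ • u = σ • x + Int.fract s • u -
        (σ • x + Int.fract s • u - (v - ⌊s⌋ • u)) := by abel
      rw [e3]
      refine (norm_sub_le _ _).trans (add_le_add ((norm_add_le _ _).trans (add_le_add ?_ ?_)) this)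
      · rw [norm_smul, Real.norm_of_nonneg hσ.1]
        exact mul_le_of_le_one_left (norm_nonneg _) hσ.2
      · rw [norm_smul, Real.norm_of_nonneg hr0]
        exact mul_le_of_le_one_left (norm_nonneg _) hr1
    · rintro ⟨v, hv, m, ⟨hm, hmu⟩, q, ⟨⟨hq1, -⟩, h1, h2⟩, rfl⟩
      exact ⟨hq1, v, hv.2, m, hm, q.2, hmu, h1, h2⟩
  have hclosed : IsClosed S := by
    rw [hSeq]
    refine hfin.isClosed_biUnion fun v _ => (h.finite.subset fun m hm => hCN hm.1).isClosed_biUnion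
      fun m _ => IsCompact.isClosed (IsCompact.image ?_ continuous_fst)
    refine (isCompact_Icc.prod isCompact_Icc).inter_right (IsClosed.inter ?_ ?_)
    · exact isClosed_eq (by fun_prop) continuous_const
    · exact isClosed_cutBody.preimage (f := fun q : ℝ × ℝ => q.1 • x + q.2 • u - v) (by fun_prop)
  have hbdd : BddBelow S := ⟨0, fun σ hσ => hσ.1.1⟩
  have hmin := hclosed.csInf_mem ⟨1, h1S⟩ hbdd
  set σ₀ := sInf S with hσ₀
  -- Positivity of σ₀ is what makes the genericity of x available at the point hit.
  have hpos : 0 < σ₀ := lt_of_le_of_ne hmin.1.1 fun h0 => h0S (h0 ▸ hmin)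
  obtain ⟨v, hv, m, hm, s, hmu, h1, h2⟩ := hmin.2
  have hnear := h.hitsAlong_near_generic hCN hex hm hmu h1 h2
    fun i hi j hj k hk e1 e2 e3 => hgen i hi j hj k hk v hv σ₀ s hpos.ne' e1 e2 e3
  have ht : Tendsto (fun σ : ℝ => σ • x + s • u - v) (𝓝[<] σ₀) (𝓝 (σ₀ • x + s • u - v)) := by
    have : Tendsto (fun σ : ℝ => σ • x + s • u - v) (𝓝 σ₀) (𝓝 (σ₀ • x + s • u - v)) :=
      Continuous.tendsto (by fun_prop) σ₀
    exact this.mono_left nhdsWithin_le_nhds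
  obtain ⟨σ, hσhit, hσ⟩ := ((ht.eventually hnear).and (Ioo_mem_nhdsLT hpos)).exists
  have : σ ∈ S := ⟨⟨hσ.1.le, hσ.2.le.trans hmin.1.2⟩, (HitsAlong.of_sub_mem hv hσhit).of_add_smul s⟩
  exact absurd (csInf_le hbdd this) (not_le.2 hσ.2)

end IsSymmTiling

end FacetNormals

/-! ### One-dimensional Prékopa–Leindler inequality with its equality case. -/

section BrunnMinkowski

open Topology Filter MeasureTheory Set

/-- The quantile function of a positive continuous density on an interval. -/
theorem exists_quantile {f : ℝ → ℝ} {α β : ℝ} (hαβ : α < β) (hf : ContinuousOn f (Ioo α β))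
    (hpos : ∀ x ∈ Ioo α β, 0 < f x) (hint : IntegrableOn f (Ioo α β)) :
    0 < ∫ x in Ioo α β, f x ∧ ∃ q : ℝ → ℝ, StrictMonoOn q (Ioo 0 1) ∧ q '' Ioo 0 1 = Ioo α β ∧
      ∀ r ∈ Ioo (0 : ℝ) 1, HasDerivAt q ((∫ x in Ioo α β, f x) / f (q r)) r := by
  have hint' : IntegrableOn f (Icc α β) := by rwa [integrableOn_Icc_iff_integrableOn_Ioo]
  set F : ℝ → ℝ := fun x => ∫ t in α..x, f t with hF
  have hFc : ContinuousOn F (Icc α β) := by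
    have := intervalIntegral.continuousOn_primitive_interval (μ := volume) (f := f) (a := α) (b := β)
      (by rwa [uIcc_of_le hαβ.le])
    rwa [uIcc_of_le hαβ.le] at this
  have hFd : ∀ x ∈ Ioo α β, HasDerivAt F (f x) x := by
    intro x hx
    refine intervalIntegral.integral_hasDerivAt_right ?_
      (hf.stronglyMeasurableAtFilter isOpen_Ioo x hx) (hf.continuousAt (isOpen_Ioo.mem_nhds hx))
    rw [intervalIntegrable_iff_integrableOn_Icc_of_le hx.1.le]
    exact hint'.mono_set (Icc_subset_Icc_right hx.2.le)
  have hFm : StrictMonoOn F (Icc α β) := by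
    refine strictMonoOn_of_deriv_pos (convex_Icc _ _) hFc fun x hx => ?_
    rw [interior_Icc] at hx
    rw [(hFd x hx).deriv]
    exact hpos x hx
  have hFα : F α = 0 := by simp [hF]
  have hFβ : F β = ∫ x in Ioo α β, f x := by
    rw [hF]; simp only
    rw [intervalIntegral.integral_of_le hαβ.le, integral_Ioc_eq_integral_Ioo]
  set V := ∫ x in Ioo α β, f x with hV
  have hVpos : 0 < V := by
    rw [← hFβ, ← hFα]
    exact hFm (left_mem_Icc.2 hαβ.le) (right_mem_Icc.2 hαβ.le) hαβ
  refine ⟨hVpos, ?_⟩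
  have hsurj : ∀ r ∈ Ioo (0 : ℝ) 1, ∃ x ∈ Ioo α β, F x = r * V := by
    intro r hr
    have : r * V ∈ Ioo (F α) (F β) := by
      rw [hFα, hFβ]
      exact ⟨mul_pos hr.1 hVpos, by nlinarith [hr.2]⟩
    exact intermediate_value_Ioo hαβ.le hFc this
  choose! q hq hFq using hsurj
  have hqm : StrictMonoOn q (Ioo 0 1) := by
    intro r hr s hs hrs
    rw [← hFm.lt_iff_lt (Ioo_subset_Icc_self (hq r hr)) (Ioo_subset_Icc_self (hq s hs)), hFq r hr,
      hFq s hs]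
    exact mul_lt_mul_of_pos_right hrs hVpos
  have hqi : q '' Ioo 0 1 = Ioo α β := by
    apply Subset.antisymm
    · rintro _ ⟨r, hr, rfl⟩
      exact hq r hr
    · intro x hx
      have h1 := hFm (left_mem_Icc.2 hαβ.le) (Ioo_subset_Icc_self hx) hx.1
      have h2 := hFm (Ioo_subset_Icc_self hx) (right_mem_Icc.2 hαβ.le) hx.2
      rw [hFα] at h1
      rw [hFβ] at h2
      have hr : F x / V ∈ Ioo (0 : ℝ) 1 := ⟨div_pos h1 hVpos, (div_lt_one hVpos).2 h2⟩
      refine ⟨F x / V, hr, ?_⟩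
      apply hFm.injOn (Ioo_subset_Icc_self (hq _ hr)) (Ioo_subset_Icc_self hx)
      rw [hFq _ hr, div_mul_cancel₀ _ hVpos.ne']
  refine ⟨q, hqm, hqi, fun r hr => ?_⟩
  have hqc : ContinuousAt q r := by
    refine hqm.continuousAt_of_image_mem_nhds (isOpen_Ioo.mem_nhds hr) ?_
    rw [hqi]
    exact isOpen_Ioo.mem_nhds (hq r hr)
  have hd : HasDerivAt (fun x => F x / V) (f (q r) / V) (q r) := (hFd _ (hq r hr)).div_const V
  have := HasDerivAt.of_local_left_inverse hqc hd (div_pos (hpos _ (hq r hr)) hVpos).ne' (by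
    filter_upwards [isOpen_Ioo.mem_nhds hr] with s hs
    rw [hFq s hs, mul_div_cancel_right₀ _ hVpos.ne'])
  rwa [inv_div] at this

/-- The one-dimensional Prékopa–Leindler inequality for two densities on intervals, together with
the case of equality. -/
theorem sqrt_mul_integral_le {f g h : ℝ → ℝ} {α β γ δ : ℝ} (hαβ : α < β) (hγδ : γ < δ)
    (hf : ContinuousOn f (Ioo α β)) (hfpos : ∀ x ∈ Ioo α β, 0 < f x)
    (hfi : IntegrableOn f (Ioo α β)) (hg : ContinuousOn g (Ioo γ δ))
    (hgpos : ∀ x ∈ Ioo γ δ, 0 < g x) (hgi : IntegrableOn g (Ioo γ δ)) (hh : Integrable h)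
    (h0 : 0 ≤ h)
    (hmid : ∀ x ∈ Ioo α β, ∀ y ∈ Ioo γ δ, √(f x * g y) ≤ h ((x + y) / 2)) :
    √((∫ x in Ioo α β, f x) * ∫ x in Ioo γ δ, g x) ≤ ∫ x, h x ∧
    ((∫ x in Ioo α β, f x) = (∫ x in Ioo γ δ, g x) → ∫ x, h x ≤ ∫ x in Ioo α β, f x →
      ∃ κ, Ioo γ δ = (fun x => x + κ) '' Ioo α β ∧ ∀ x ∈ Ioo α β, f x = g (x + κ)) := by
  obtain ⟨hV, a, ham, hai, had⟩ := exists_quantile hαβ hf hfpos hfi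
  obtain ⟨hW, b, hbm, hbi, hbd⟩ := exists_quantile hγδ hg hgpos hgi
  set V := ∫ x in Ioo α β, f x with hVdef
  set W := ∫ x in Ioo γ δ, g x with hWdef
  have haI : ∀ r ∈ Ioo (0 : ℝ) 1, a r ∈ Ioo α β := fun r hr => hai ▸ mem_image_of_mem a hr
  have hbI : ∀ r ∈ Ioo (0 : ℝ) 1, b r ∈ Ioo γ δ := fun r hr => hbi ▸ mem_image_of_mem b hr
  -- Transport: pair points of equal quantile of f and g, and substitute their midpoint in the
  -- integral of h. By the arithmetic–geometric mean inequality the new integrand is at least √(V *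
  -- W) for every r.
  set m : ℝ → ℝ := fun r => (a r + b r) / 2 with hm
  set m' : ℝ → ℝ := fun r => (V / f (a r) + W / g (b r)) / 2 with hm'
  have hmd : ∀ r ∈ Ioo (0 : ℝ) 1, HasDerivWithinAt m (m' r) (Ioo 0 1) r := fun r hr =>
    (((had r hr).add (hbd r hr)).div_const 2).hasDerivWithinAt
  have hminj : InjOn m (Ioo 0 1) := by
    refine StrictMonoOn.injOn fun r hr s hs hrs => ?_
    have h1 := ham hr hs hrs
    have h2 := hbm hr hs hrs
    simp only [hm]
    linarith
  have hcv := integral_image_eq_integral_abs_deriv_smul measurableSet_Ioo hmd hminj h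
  have hci := (integrableOn_image_iff_integrableOn_abs_deriv_smul measurableSet_Ioo hmd hminj h).1
    hh.integrableOn
  have hle1 : ∫ x in m '' Ioo 0 1, h x ≤ ∫ x, h x :=
    setIntegral_le_integral hh (Eventually.of_forall h0)
  have amgm : ∀ p q : ℝ, 0 < p → 0 < q → √(V * W) ≤ √(p * q) * ((V / p + W / q) / 2) := by
    intro p q hp hq
    rw [Real.sqrt_le_iff]
    refine ⟨by positivity, ?_⟩
    rw [mul_pow, Real.sq_sqrt (by positivity)]
    have : p * q * ((V / p + W / q) / 2) ^ 2 = (V * q + W * p) ^ 2 / (4 * (p * q)) := by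
      field_simp; norm_num
    rw [this, le_div_iff₀ (by positivity)]
    nlinarith [sq_nonneg (V * q - W * p)]
  have hmpos : ∀ r ∈ Ioo (0 : ℝ) 1, 0 < m' r := by
    intro r hr
    have h1 := hfpos _ (haI r hr)
    have h2 := hgpos _ (hbI r hr)
    simp only [hm']
    positivity
  have hptw : ∀ r ∈ Ioo (0 : ℝ) 1, √(f (a r) * g (b r)) * m' r ≤ |m' r| • h (m r) := by
    intro r hr
    rw [abs_of_pos (hmpos r hr), smul_eq_mul, mul_comm]
    exact mul_le_mul_of_nonneg_left (hmid _ (haI r hr) _ (hbI r hr)) (hmpos r hr).le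
  have hptw2 : ∀ r ∈ Ioo (0 : ℝ) 1, √(V * W) ≤ |m' r| • h (m r) := fun r hr =>
    (amgm _ _ (hfpos _ (haI r hr)) (hgpos _ (hbI r hr))).trans (hptw r hr)
  have hconst : ∫ _ in Ioo (0 : ℝ) 1, √(V * W) = √(V * W) := by simp
  have hcint : IntegrableOn (fun _ : ℝ => √(V * W)) (Ioo 0 1) := by simp
  refine ⟨?_, fun hVW hle => ?_⟩
  · refine le_trans ?_ hle1
    rw [hcv, ← hconst]
    exact setIntegral_mono_on hcint hci measurableSet_Ioo hptw2
  · have hsq : √(V * W) = V := by rw [← hVW, Real.sqrt_mul_self hV.le]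
    have hz : ∫ r in Ioo (0 : ℝ) 1, (|m' r| • h (m r) - √(V * W)) = 0 := by
      apply le_antisymm
      · rw [integral_sub hci hcint, hconst, ← hcv, hsq]; linarith
      · exact setIntegral_nonneg measurableSet_Ioo fun r hr => sub_nonneg.2 (hptw2 r hr)
    have hnn : 0 ≤ᵐ[volume.restrict (Ioo (0 : ℝ) 1)] fun r => |m' r| • h (m r) - √(V * W) := by
      filter_upwards [ae_restrict_mem measurableSet_Ioo] with r hr
      exact sub_nonneg.2 (hptw2 r hr)
    have hz := (setIntegral_eq_zero_iff_of_nonneg_ae hnn (hci.sub hcint)).1 hz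
    have hae : (fun r => f (a r)) =ᵐ[volume.restrict (Ioo (0 : ℝ) 1)] fun r => g (b r) := by
      filter_upwards [hz, ae_restrict_mem measurableSet_Ioo] with r hr hrI
      have hp := hfpos _ (haI r hrI)
      have hq := hgpos _ (hbI r hrI)
      simp only [Pi.zero_apply] at hr
      have h1 := amgm _ _ hp hq
      have h2 := hptw r hrI
      have h3 : √(V * W) = √(f (a r) * g (b r)) * m' r := le_antisymm h1 (by linarith)
      rw [hsq] at h3
      have h4 : V ^ 2 = f (a r) * g (b r) * (m' r) ^ 2 := by
        rw [h3, mul_pow, Real.sq_sqrt (by positivity)]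
      have h5 : m' r = V * (f (a r) + g (b r)) / (2 * (f (a r) * g (b r))) := by
        simp only [hm']
        rw [← hVW]
        field_simp
        ring
      rw [h5] at h4
      field_simp at h4
      have h6 : (f (a r) - g (b r)) ^ 2 = 0 := by nlinarith
      linarith [pow_eq_zero_iff (two_ne_zero) |>.1 h6]
    have hac : ContinuousOn a (Ioo 0 1) := fun r hr => (had r hr).continuousAt.continuousWithinAt
    have hbc : ContinuousOn b (Ioo 0 1) := fun r hr => (hbd r hr).continuousAt.continuousWithinAt
    have heq : EqOn (fun r => f (a r)) (fun r => g (b r)) (Ioo 0 1) :=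
      Measure.eqOn_open_of_ae_eq hae isOpen_Ioo (hf.comp hac haI) (hg.comp hbc hbI)
    -- Equality in the mean inequality gives f (a r) = g (b r). As the total masses agree, both
    -- quantile functions have the same derivative and differ by a constant κ.
    have hd : ∀ r ∈ Ioo (0 : ℝ) 1, HasDerivAt (fun r => b r - a r) 0 r := by
      intro r hr
      have h1 := (hbd r hr).sub (had r hr)
      have h2 : f (a r) = g (b r) := heq hr
      rw [← hVW, h2, sub_self] at h1
      exact h1
    obtain ⟨κ, hκ⟩ := isOpen_Ioo.exists_is_const_of_deriv_eq_zero isPreconnected_Ioo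
      (fun r hr => (hd r hr).differentiableAt.differentiableWithinAt) fun r hr => (hd r hr).deriv
    have hbk : ∀ r ∈ Ioo (0 : ℝ) 1, b r = a r + κ := fun r hr => by
      have := hκ r hr
      linarith
    refine ⟨κ, ?_, ?_⟩
    · rw [← hbi, ← hai, image_image]
      exact image_congr hbk
    · intro x hx
      rw [← hai] at hx
      obtain ⟨r, hr, rfl⟩ := hx
      rw [← hbk r hr]
      exact heq hr

end BrunnMinkowski

/-! ### Volumes of sections of convex bodies. -/

section BrunnMinkowski

open Topology Filter MeasureTheory Set

section Sections

variable {V : Type*} [NormedAddCommGroup V] [NormedSpace ℝ V]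

/-- Take an interior point of K in the same slice and prolong the segment from it to v slightly
beyond v, still inside K. Then v is in an open segment from an interior point to a point of K. -/
theorem mem_interior_of_mem_interior_section {K : Set (ℝ × V)} (hK : Convex ℝ K) {z : ℝ}
    (hz : z ∈ Prod.fst '' interior K) {v : V} (hv : v ∈ interior (Prod.mk z ⁻¹' K)) :
    (z, v) ∈ interior K := by
  obtain ⟨⟨z', w⟩, hw, rfl⟩ := hz
  simp only at hv ⊢
  have ht : Tendsto (fun ε : ℝ => v + ε • (v - w)) (𝓝[>] 0) (𝓝 v) := by
    have : Tendsto (fun ε : ℝ => v + ε • (v - w)) (𝓝 0) (𝓝 (v + (0 : ℝ) • (v - w))) :=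
      Continuous.tendsto (by fun_prop) 0
    simpa using this.mono_left nhdsWithin_le_nhds
  obtain ⟨ε, hε, hε0⟩ := ((ht.eventually (mem_interior_iff_mem_nhds.1 hv)).and
    self_mem_nhdsWithin).exists
  have hε0 : 0 < ε := hε0
  refine hK.openSegment_interior_self_subset_interior hw hε ?_
  refine ⟨ε / (1 + ε), 1 / (1 + ε), by positivity, by positivity, by field_simp; ring, ?_⟩
  ext
  · simp only [Prod.fst_add, Prod.smul_fst, smul_eq_mul]
    field_simp
    ring
  · simp only [Prod.snd_add, Prod.smul_snd]
    have h2 : (1 / (1 + ε)) • (v + ε • (v - w)) = v - (ε / (1 + ε)) • w := by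
      rw [smul_add, smul_sub, smul_sub, smul_smul, smul_smul, add_sub, ← add_smul]
      rw [show 1 / (1 + ε) + 1 / (1 + ε) * ε = 1 by field_simp, one_smul]
      congr 2
      field_simp
    rw [h2]; abel

theorem exists_fst_image_eq {K : Set (ℝ × V)} (hK : Convex ℝ K) (hKc : IsCompact K)
    (hne : (interior K).Nonempty) :
    ∃ α β, α < β ∧ Prod.fst '' K = Icc α β ∧ Ioo α β ⊆ Prod.fst '' interior K := by
  have hne' : (Prod.fst '' K).Nonempty := (hne.mono interior_subset).image _
  have hconn : IsConnected (Prod.fst '' K) :=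
    ⟨hne', (hK.isPreconnected).image _ continuous_fst.continuousOn⟩
  have heq := eq_Icc_of_connected_compact hconn (hKc.image continuous_fst)
  set α := sInf (Prod.fst '' K)
  set β := sSup (Prod.fst '' K)
  have hI : OrdConnected (Prod.fst '' interior K) :=
    (hK.interior.isPreconnected.image _ continuous_fst.continuousOn).ordConnected
  have hcl : Icc α β ⊆ closure (Prod.fst '' interior K) := by
    rw [← heq]
    refine (image_mono ?_).trans (image_closure_subset_closure_image continuous_fst)
    rw [hK.closure_interior_eq_closure_of_nonempty_interior hne]
    exact subset_closure
  have hsub : Prod.fst '' interior K ⊆ Icc α β := heq ▸ image_mono interior_subset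
  have hopen : IsOpen (Prod.fst '' interior K) := isOpenMap_fst _ isOpen_interior
  have hlt : α < β := by
    obtain ⟨z, hz⟩ := hne.image (Prod.fst : ℝ × V → ℝ)
    obtain ⟨ε, hε, hb⟩ := Metric.isOpen_iff.1 hopen z hz
    have h1 := hsub (hb (show z + ε / 2 ∈ Metric.ball z ε by
      rw [Metric.mem_ball, Real.dist_eq]; simp; rw [abs_of_pos] <;> linarith))
    have h2 := hsub hz
    linarith [h1.2, h2.1]
  refine ⟨α, β, hlt, heq, fun z hz => ?_⟩
  obtain ⟨p, hp1, hp2⟩ := mem_closure_iff.1 (hcl (left_mem_Icc.2 hlt.le)) (Iio z) isOpen_Iio hz.1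
  obtain ⟨q, hq1, hq2⟩ := mem_closure_iff.1 (hcl (right_mem_Icc.2 hlt.le)) (Ioi z) isOpen_Ioi hz.2
  exact hI.out hp2 hq2 ⟨le_of_lt hp1, le_of_lt hq1⟩

theorem section_interior_nonempty {K : Set (ℝ × V)} {z : ℝ} (hz : z ∈ Prod.fst '' interior K) :
    (interior (Prod.mk z ⁻¹' K)).Nonempty := by
  obtain ⟨⟨z', w⟩, hw, rfl⟩ := hz
  exact ⟨w, preimage_interior_subset_interior_preimage (f := Prod.mk z') (by fun_prop) hw⟩

theorem isCompact_section {K : Set (ℝ × V)} (hKc : IsCompact K) (z : ℝ) :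
    IsCompact (Prod.mk z ⁻¹' K) :=
  (hKc.image continuous_snd).of_isClosed_subset (hKc.isClosed.preimage (by fun_prop))
    fun v hv => ⟨_, hv, rfl⟩

theorem convex_section {K : Set (ℝ × V)} (hK : Convex ℝ K) (z : ℝ) :
    Convex ℝ (Prod.mk z ⁻¹' K) := by
  intro x hx y hy a b ha hb hab
  have := hK hx hy ha hb hab
  simpa [Prod.smul_mk, ← add_mul, hab] using this

variable [MeasurableSpace V] [BorelSpace V] [FiniteDimensional ℝ V] (ν : Measure V)
  [ν.IsAddHaarMeasure]

theorem real_pos_of_interior {W : Type*} [TopologicalSpace W] [MeasurableSpace W] {μ : Measure W}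
    [μ.IsOpenPosMeasure] [IsFiniteMeasureOnCompacts μ] {A : Set W} (hA : IsCompact A)
    (hne : (interior A).Nonempty) : 0 < μ.real A :=
  ENNReal.toReal_pos (Measure.measure_pos_of_nonempty_interior μ hne).ne' hA.measure_lt_top.ne

theorem integrable_sections {K : Set (ℝ × V)} (hKc : IsCompact K) :
    Integrable (fun z => ν.real (Prod.mk z ⁻¹' K)) ∧
      ∫ z, ν.real (Prod.mk z ⁻¹' K) = ((volume : Measure ℝ).prod ν).real K := by
  have hi : Integrable (K.indicator (1 : ℝ × V → ℝ)) ((volume : Measure ℝ).prod ν) :=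
    (integrable_indicator_iff hKc.measurableSet).2 (by
      exact integrableOn_const hKc.measure_lt_top.ne)
  have e : ∀ z, ∫ v, K.indicator (1 : ℝ × V → ℝ) (z, v) ∂ν = ν.real (Prod.mk z ⁻¹' K) := by
    intro z
    have : (fun v => K.indicator (1 : ℝ × V → ℝ) (z, v)) =
        (Prod.mk z ⁻¹' K).indicator (1 : V → ℝ) := by
      ext v
      by_cases hv : (z, v) ∈ K
      · rw [indicator_of_mem hv, indicator_of_mem (show v ∈ Prod.mk z ⁻¹' K from hv)]; rfl
      · rw [indicator_of_notMem hv, indicator_of_notMem (show v ∉ Prod.mk z ⁻¹' K from hv)]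
    rw [this, integral_indicator_one (measurable_prodMk_left hKc.measurableSet)]
  constructor
  · have := hi.integral_prod_left
    simpa only [e] using this
  · have := integral_prod _ hi
    rw [integral_indicator_one hKc.measurableSet] at this
    rw [this]
    simp only [e]

/-- Dominated convergence: for a fixed v, membership of (y, v) in K is constant for y near z unless
v is on the frontier of the section at z, and the frontier of a convex set is null. -/
theorem continuousOn_sections {K : Set (ℝ × V)} (hK : Convex ℝ K) (hKc : IsCompact K) {α β : ℝ}
    (hI : Ioo α β ⊆ Prod.fst '' interior K) :
    ContinuousOn (fun z => ν.real (Prod.mk z ⁻¹' K)) (Ioo α β) := by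
  intro z hz
  apply ContinuousAt.continuousWithinAt
  have hs : ∀ z, MeasurableSet (Prod.mk z ⁻¹' K) := fun z =>
    measurable_prodMk_left hKc.measurableSet
  have e : (fun z => ν.real (Prod.mk z ⁻¹' K)) =
      fun z => ∫ v, (Prod.mk z ⁻¹' K).indicator (1 : V → ℝ) v ∂ν := by
    ext z
    rw [integral_indicator_one (hs z)]
  rw [e]
  have hsnd : IsCompact (Prod.snd '' K) := hKc.image continuous_snd
  refine continuousAt_of_dominated (bound := (Prod.snd '' K).indicator 1) ?_ ?_ ?_ ?_
  · exact Eventually.of_forall fun z =>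
      (measurable_one.indicator (hs z)).aestronglyMeasurable
  · refine Eventually.of_forall fun z => Eventually.of_forall fun v => ?_
    by_cases hv : v ∈ Prod.mk z ⁻¹' K
    · rw [indicator_of_mem hv, indicator_of_mem (show v ∈ Prod.snd '' K from ⟨_, hv, rfl⟩)]
      simp
    · rw [indicator_of_notMem hv, norm_zero]
      exact indicator_nonneg (fun _ _ => zero_le_one) _
  · exact (integrable_indicator_iff hsnd.measurableSet).2 (integrableOn_const hsnd.measure_lt_top.ne)
  · have hconv : Convex ℝ (Prod.mk z ⁻¹' K) := by
      intro x hx y hy a b ha hb hab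
      have := hK hx hy ha hb hab
      simpa [Prod.smul_mk, ← add_mul, hab] using this
    have hfr := hconv.addHaar_frontier ν
    filter_upwards [compl_mem_ae_iff.2 hfr] with v hv
    have hclosed : IsClosed (Prod.mk z ⁻¹' K) := hKc.isClosed.preimage (by fun_prop)
    have hcont : ContinuousAt (fun z => (z, v)) z := by fun_prop
    by_cases hvK : v ∈ Prod.mk z ⁻¹' K
    · have hvi : v ∈ interior (Prod.mk z ⁻¹' K) := by
        by_contra hni
        exact hv (by rw [hclosed.frontier_eq]; exact ⟨hvK, hni⟩)
      have hint := mem_interior_of_mem_interior_section hK (hI hz) hvi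
      refine (continuousAt_const (y := (1 : ℝ))).congr ?_
      filter_upwards [hcont.eventually (mem_interior_iff_mem_nhds.1 hint)] with y hy
      rw [indicator_of_mem (show v ∈ Prod.mk y ⁻¹' K from hy)]
      rfl
    · refine (continuousAt_const (y := (0 : ℝ))).congr ?_
      filter_upwards [hcont.eventually (hKc.isClosed.isOpen_compl.mem_nhds hvK)] with y hy
      rw [indicator_of_notMem (show v ∉ Prod.mk y ⁻¹' K from hy)]

theorem integral_Ioo_sections {K : Set (ℝ × V)} (hKc : IsCompact K) {α β : ℝ}
    (himg : Prod.fst '' K = Icc α β) :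
    ∫ z in Ioo α β, ν.real (Prod.mk z ⁻¹' K) = ((volume : Measure ℝ).prod ν).real K := by
  rw [← (integrable_sections ν hKc).2, ← integral_Icc_eq_integral_Ioo]
  refine setIntegral_eq_integral_of_forall_compl_eq_zero fun z hz => ?_
  have : Prod.mk z ⁻¹' K = ∅ := by
    ext v
    simp only [mem_preimage, mem_empty_iff_false, iff_false]
    intro hv
    exact hz (himg ▸ ⟨_, hv, rfl⟩)
  rw [this, measureReal_empty]

/-- The multiplicative Brunn–Minkowski inequality for midpoints of convex bodies holds for `ν`. -/
def SatisfiesBrunnMinkowski {W : Type*} [NormedAddCommGroup W] [NormedSpace ℝ W]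
    [MeasurableSpace W] (μ : Measure W) : Prop :=
  ∀ A B : Set W, Convex ℝ A → IsCompact A → (interior A).Nonempty → Convex ℝ B → IsCompact B →
    (interior B).Nonempty → √(μ.real A * μ.real B) ≤ μ.real ((1 / 2 : ℝ) • (A + B))

theorem isCompact_midpoints {W : Type*} [NormedAddCommGroup W] [NormedSpace ℝ W] {A B : Set W}
    (hA : IsCompact A) (hB : IsCompact B) : IsCompact ((1 / 2 : ℝ) • (A + B)) := (hA.add hB).smul _

variable {ν}

/-- Midpoints of the sections at x and y lie in the section of the midpoint body at (x + y) / 2, so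
the inequality one dimension lower supplies the hypothesis of `sqrt_mul_integral_le`. -/
theorem section_mid (hBM : SatisfiesBrunnMinkowski ν) {A B : Set (ℝ × V)} (hA : Convex ℝ A)
    (hAc : IsCompact A) (hB : Convex ℝ B) (hBc : IsCompact B) {x y : ℝ}
    (hx : x ∈ Prod.fst '' interior A) (hy : y ∈ Prod.fst '' interior B) :
    √(ν.real (Prod.mk x ⁻¹' A) * ν.real (Prod.mk y ⁻¹' B)) ≤
      ν.real (Prod.mk ((x + y) / 2) ⁻¹' ((1 / 2 : ℝ) • (A + B))) := by
  refine (hBM _ _ (convex_section hA x) (isCompact_section hAc x) (section_interior_nonempty hx)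
    (convex_section hB y) (isCompact_section hBc y) (section_interior_nonempty hy)).trans ?_
  refine measureReal_mono ?_ (isCompact_section (isCompact_midpoints hAc hBc) _).measure_lt_top.ne
  rintro _ ⟨_, ⟨v, hv, w, hw, rfl⟩, rfl⟩
  refine ⟨(x, v) + (y, w), add_mem_add hv hw, ?_⟩
  ext
  · simp; ring
  · simp

/-- By Fubini the volumes are integrals of section volumes, to which the one-dimensional inequality
applies. -/
theorem SatisfiesBrunnMinkowski.prod (hBM : SatisfiesBrunnMinkowski ν) :
    SatisfiesBrunnMinkowski ((volume : Measure ℝ).prod ν) := by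
  intro A B hA hAc hAne hB hBc hBne
  obtain ⟨α, β, hαβ, hAi, hAI⟩ := exists_fst_image_eq hA hAc hAne
  obtain ⟨γ, δ, hγδ, hBi, hBI⟩ := exists_fst_image_eq hB hBc hBne
  have hM := isCompact_midpoints hAc hBc
  rw [← integral_Ioo_sections ν hAc hAi, ← integral_Ioo_sections ν hBc hBi,
    ← (integrable_sections ν hM).2]
  refine (sqrt_mul_integral_le hαβ hγδ (continuousOn_sections ν hA hAc hAI) (fun x hx => ?_)
    (integrable_sections ν hAc).1.integrableOn (continuousOn_sections ν hB hBc hBI) (fun x hx => ?_)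
    (integrable_sections ν hBc).1.integrableOn (integrable_sections ν hM).1
    (fun _ => measureReal_nonneg) (fun x hx y hy => ?_)).1
  · exact real_pos_of_interior (isCompact_section hAc x) (section_interior_nonempty (hAI hx))
  · exact real_pos_of_interior (isCompact_section hBc x) (section_interior_nonempty (hBI hx))
  · exact section_mid hBM hA hAc hB hBc (hAI hx) (hBI hy)

/-- If the difference body of `K` is not larger than `K`, then the barycenter of `K` lies halfway
between the extreme values of the first coordinate. -/
theorem setIntegral_fst_eq (hBM : SatisfiesBrunnMinkowski ν) {K : Set (ℝ × V)} (hK : Convex ℝ K)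
    (hKc : IsCompact K) (hne : (interior K).Nonempty)
    (hle : ((volume : Measure ℝ).prod ν).real ((1 / 2 : ℝ) • (K + -K)) ≤
      ((volume : Measure ℝ).prod ν).real K) {α β : ℝ} (himg : Prod.fst '' K = Icc α β) :
    2 * ∫ p in K, p.1 ∂((volume : Measure ℝ).prod ν) =
      (α + β) * ((volume : Measure ℝ).prod ν).real K := by
  obtain ⟨α', β', hαβ, hi, hI⟩ := exists_fst_image_eq hK hKc hne
  have hend : α' = α ∧ β' = β := by
    have := hi.symm.trans himg
    have h2 := Icc_eq_Icc_iff hαβ.le |>.1 this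
    exact h2
  obtain ⟨rfl, rfl⟩ := hend
  set f : ℝ → ℝ := fun z => ν.real (Prod.mk z ⁻¹' K) with hf
  have hneg : ∀ z, ν.real (Prod.mk z ⁻¹' (-K)) = f (-z) := by
    intro z
    have : Prod.mk z ⁻¹' (-K) = -(Prod.mk (-z) ⁻¹' K) := by
      ext v; simp
    rw [this, measureReal_def, Measure.measure_neg]
    rfl
  have hKn : IsCompact (-K) := hKc.neg
  have hKnc : Convex ℝ (-K) := hK.neg
  have hIn : Ioo (-β') (-α') ⊆ Prod.fst '' interior (-K) := by
    intro z hz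
    obtain ⟨⟨z', w⟩, hw, hzz⟩ := hI (show -z ∈ Ioo α' β' from ⟨by linarith [hz.2], by linarith [hz.1]⟩)
    refine ⟨-(z', w), ?_, ?_⟩
    · exact ((Homeomorph.neg (ℝ × V)).preimage_interior K).subset (by simpa using hw)
    · simp only at hzz; simp [hzz]
  have hin : Prod.fst '' (-K) = Icc (-β') (-α') := by
    ext z
    constructor
    · rintro ⟨⟨z', w⟩, hw, rfl⟩
      have : -z' ∈ Icc α' β' := himg ▸ ⟨-(z', w), hw, rfl⟩
      exact ⟨by linarith [this.2], by linarith [this.1]⟩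
    · intro hz
      have : -z ∈ Prod.fst '' K := himg ▸ ⟨by linarith [hz.2], by linarith [hz.1]⟩
      obtain ⟨⟨z', w⟩, hw, hzz⟩ := this
      exact ⟨-(z', w), by simpa using hw, by simp only at hzz; simp [hzz]⟩
  have hM := isCompact_midpoints hKc hKn
  have hvolneg : ((volume : Measure ℝ).prod ν).real (-K) = ((volume : Measure ℝ).prod ν).real K := by
    rw [measureReal_def, measureReal_def, Measure.measure_neg]
  have hpos : ∀ x ∈ Ioo α' β', 0 < f x := fun x hx =>
    real_pos_of_interior (isCompact_section hKc x) (section_interior_nonempty (hI hx))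
  have hmain := (sqrt_mul_integral_le hαβ (neg_lt_neg hαβ) (continuousOn_sections ν hK hKc hI) hpos
    (integrable_sections ν hKc).1.integrableOn (continuousOn_sections ν hKnc hKn hIn) (fun x hx =>
      real_pos_of_interior (isCompact_section hKn x) (section_interior_nonempty (hIn hx)))
    (integrable_sections ν hKn).1.integrableOn (integrable_sections ν hM).1
    (fun _ => measureReal_nonneg)
    (fun x hx y hy => section_mid hBM hK hKc hKnc hKn (hI hx) (hIn hy))).2
  rw [integral_Ioo_sections ν hKc hi, integral_Ioo_sections ν hKn hin,
    (integrable_sections ν hM).2, hvolneg] at hmain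
  -- The section volumes of -K are those of K read backwards. The equality case says that they are
  -- also a translate, so f is symmetric about the midpoint of its interval.
  obtain ⟨κ, hκ1, hκ2⟩ := hmain rfl hle
  have hκ : κ = -(α' + β') := by
    rw [image_add_const_Ioo] at hκ1
    have := congrArg sInf hκ1
    rw [csInf_Ioo (neg_lt_neg hαβ), csInf_Ioo (by linarith)] at this
    linarith
  have hsymm : ∀ x ∈ Ioo α' β', f x = f (α' + β' - x) := by
    intro x hx
    have := hκ2 x hx
    rw [hneg, hκ] at this
    rw [show α' + β' - x = -(x + -(α' + β')) by ring]
    exact this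
  have hzero : ∀ x ∉ Icc α' β', f x = 0 := by
    intro z hz
    have : Prod.mk z ⁻¹' K = ∅ := by
      ext v
      simp only [mem_preimage, mem_empty_iff_false, iff_false]
      intro hv
      exact hz (himg ▸ ⟨_, hv, rfl⟩)
    rw [hf]; simp only
    rw [this, measureReal_empty]
  have hae : ∀ᵐ x : ℝ, f x = f (α' + β' - x) := by
    have h1 : ∀ᵐ x : ℝ, x ≠ α' := by simp [ae_iff]
    have h2 : ∀ᵐ x : ℝ, x ≠ β' := by simp [ae_iff]
    filter_upwards [h1, h2] with x hx1 hx2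
    by_cases hx : x ∈ Ioo α' β'
    · exact hsymm x hx
    · have hx' : x ∉ Icc α' β' := fun h => hx ⟨lt_of_le_of_ne h.1 hx1.symm, lt_of_le_of_ne h.2 hx2⟩
      rw [hzero x hx', hzero _ (fun h => hx' ⟨by linarith [h.2], by linarith [h.1]⟩)]
  -- the first moment as an integral over sections
  have hfst : Integrable (K.indicator (Prod.fst : ℝ × V → ℝ)) ((volume : Measure ℝ).prod ν) :=
    (integrable_indicator_iff hKc.measurableSet).2
      (continuous_fst.continuousOn.integrableOn_compact hKc)
  have esec : ∀ z, ∫ v, K.indicator (Prod.fst : ℝ × V → ℝ) (z, v) ∂ν = z * f z := by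
    intro z
    have : (fun v => K.indicator (Prod.fst : ℝ × V → ℝ) (z, v)) =
        (Prod.mk z ⁻¹' K).indicator (fun _ : V => z) := by
      ext v
      by_cases hv : (z, v) ∈ K
      · rw [indicator_of_mem hv, indicator_of_mem (show v ∈ Prod.mk z ⁻¹' K from hv)]
      · rw [indicator_of_notMem hv, indicator_of_notMem (show v ∉ Prod.mk z ⁻¹' K from hv)]
    rw [this, integral_indicator (measurable_prodMk_left hKc.measurableSet), setIntegral_const,
      smul_eq_mul, mul_comm]
  have hmom : ∫ p in K, p.1 ∂((volume : Measure ℝ).prod ν) = ∫ z, z * f z := by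
    rw [← integral_indicator hKc.measurableSet, integral_prod _ hfst]
    simp only [esec]
  have hzi : Integrable (fun z => z * f z) := by
    have := hfst.integral_prod_left
    simpa only [esec] using this
  have hrefl : ∫ z, z * f z = ∫ z, ((α' + β') * f z - z * f z) := by
    rw [← integral_sub_left_eq_self (fun z => z * f z) volume (α' + β')]
    refine integral_congr_ae ?_
    filter_upwards [hae] with x hx
    rw [← hx]; ring
  rw [integral_sub ((integrable_sections ν hKc).1.const_mul _) hzi, integral_const_mul,
    (integrable_sections ν hKc).2] at hrefl
  rw [hmom]
  linarith

end Sections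

end BrunnMinkowski

/-! ### Brunn–Minkowski in every dimension, and central symmetry from a volume bound. -/

section BrunnMinkowski

open Topology Filter MeasureTheory Set

section Transfer

variable {E : Type*} [NormedAddCommGroup E] [NormedSpace ℝ E] [MeasurableSpace E] [BorelSpace E]
  [FiniteDimensional ℝ E]

theorem exists_map_eq_smul {F : Type*} [NormedAddCommGroup F] [NormedSpace ℝ F] [MeasurableSpace F]
    [BorelSpace F] [FiniteDimensional ℝ F] (Φ : E ≃L[ℝ] F) (μ : Measure E) [μ.IsAddHaarMeasure]
    (μ' : Measure F) [μ'.IsAddHaarMeasure] :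
    ∃ k : ℝ, 0 < k ∧ μ.map Φ = ENNReal.ofReal k • μ' ∧
      ∀ S : Set E, μ.real S = k * μ'.real (Φ '' S) := by
  have hH : (μ.map Φ).IsAddHaarMeasure := Φ.isAddHaarMeasure_map μ
  have heq := Measure.isAddLeftInvariant_eq_smul (μ.map Φ) μ'
  set c := Measure.addHaarScalarFactor (μ.map Φ) μ' with hc
  have hc0 : 0 < c := Measure.addHaarScalarFactor_pos_of_isAddHaarMeasure _ _
  refine ⟨c, by exact_mod_cast hc0, by rw [ENNReal.ofReal_coe_nnreal]; exact heq, fun S => ?_⟩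
  have h1 : μ.map Φ (Φ '' S) = μ S := by
    have : μ.map Φ = μ.map Φ.toHomeomorph.toMeasurableEquiv := rfl
    rw [this, MeasurableEquiv.map_apply]
    congr 1
    exact preimage_image_eq S Φ.injective
  rw [measureReal_def, ← h1, heq, measureReal_def, Measure.smul_apply]
  simp

/-- Haar measures agree up to a positive factor, and both sides of the inequality are homogeneous of
degree one in the measure. -/
theorem SatisfiesBrunnMinkowski.of_equiv {F : Type*} [NormedAddCommGroup F] [NormedSpace ℝ F]
    [MeasurableSpace F] [BorelSpace F] [FiniteDimensional ℝ F] (Φ : E ≃L[ℝ] F) {μ : Measure E}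
    [μ.IsAddHaarMeasure] {μ' : Measure F} [μ'.IsAddHaarMeasure] (h : SatisfiesBrunnMinkowski μ') :
    SatisfiesBrunnMinkowski μ := by
  obtain ⟨k, hk, -, hS⟩ := exists_map_eq_smul Φ μ μ'
  intro A B hA hAc hAne hB hBc hBne
  have hint : ∀ S : Set E, (interior S).Nonempty → (interior (Φ '' S)).Nonempty := by
    intro S hne
    exact (Φ.toHomeomorph.image_interior S) ▸ hne.image _
  have key := h (Φ '' A) (Φ '' B) (hA.is_linear_image Φ.toLinearMap.isLinear)
    (hAc.image Φ.continuous) (hint A hAne) (hB.is_linear_image Φ.toLinearMap.isLinear)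
    (hBc.image Φ.continuous) (hint B hBne)
  have himg : Φ '' ((1 / 2 : ℝ) • (A + B)) = (1 / 2 : ℝ) • (Φ '' A + Φ '' B) := by
    rw [image_smul_set, image_add]
  rw [hS, hS, hS, himg]
  rw [show k * μ'.real (Φ '' A) * (k * μ'.real (Φ '' B)) =
    k ^ 2 * (μ'.real (Φ '' A) * μ'.real (Φ '' B)) by ring, Real.sqrt_mul (by positivity),
    Real.sqrt_sq hk.le]
  exact mul_le_mul_of_nonneg_left key hk.le

/-- Coordinates in which a given functional is the first coordinate. -/
theorem exists_equiv_prod_ker {E : Type*} [NormedAddCommGroup E] [NormedSpace ℝ E]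
    {u : E →L[ℝ] ℝ} (hu : u ≠ 0) :
    ∃ Φ : E ≃L[ℝ] ℝ × LinearMap.ker (u : E →ₗ[ℝ] ℝ), ∀ x, (Φ x).1 = u x := by
  obtain ⟨v, hv⟩ : ∃ v, u v ≠ 0 := by
    by_contra! hc
    exact hu (ContinuousLinearMap.ext hc)
  set e := (u v)⁻¹ • v with he
  have hue : u e = 1 := by simp [he, hv]
  let p : E →L[ℝ] LinearMap.ker (u : E →ₗ[ℝ] ℝ) :=
    (ContinuousLinearMap.id ℝ E - u.smulRight e).codRestrict _ fun x => by simp [hue]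
  have hp : ∀ x, (p x : E) = x - u x • e := fun x => by simp [p]
  refine ⟨ContinuousLinearEquiv.equivOfInverse (u.prod p)
    ((ContinuousLinearMap.toSpanSingleton ℝ e).coprod (Submodule.subtypeL _)) (fun x => ?_)
    (fun y => ?_), fun x => rfl⟩
  · simp [hp]
  · have hy : u (y.2 : E) = 0 := y.2.2
    ext
    · simp [hue, hy]
    · simp [hp, hue, hy]

end Transfer

/-- Induction on the dimension: a nonzero functional splits the space as ℝ times its kernel. -/
theorem satisfiesBrunnMinkowski {E : Type*} [NormedAddCommGroup E] [NormedSpace ℝ E]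
    [MeasurableSpace E] [BorelSpace E] [FiniteDimensional ℝ E] (μ : Measure E)
    [μ.IsAddHaarMeasure] : SatisfiesBrunnMinkowski μ := by
  induction hd : Module.finrank ℝ E generalizing E with
  | zero =>
    have : Subsingleton E := Module.finrank_zero_iff.1 hd
    intro A B _ _ hA _ _ hB
    have huniv : ∀ S : Set E, S.Nonempty → S = univ := fun S hS => by
      obtain ⟨x, hx⟩ := hS
      exact eq_univ_of_forall fun y => Subsingleton.elim x y ▸ hx
    have hA' := hA.mono interior_subset
    have hB' := hB.mono interior_subset
    rw [huniv A hA', huniv B hB', huniv _ ((univ_nonempty.add univ_nonempty).smul_set),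
      Real.sqrt_mul_self measureReal_nonneg]
  | succ n ih =>
    have : Nontrivial E := Module.nontrivial_of_finrank_pos (R := ℝ) (by omega)
    obtain ⟨x, hx⟩ := exists_ne (0 : E)
    obtain ⟨u, -, hux⟩ := exists_dual_vector ℝ x (norm_ne_zero_iff.2 hx)
    have hu : u ≠ 0 := by
      rintro rfl
      simp at hux
      exact hx (norm_eq_zero.1 hux.symm)
    obtain ⟨Φ, hΦ⟩ := exists_equiv_prod_ker hu
    have hdim : Module.finrank ℝ (LinearMap.ker (u : E →ₗ[ℝ] ℝ)) = n := by
      have := Φ.toLinearEquiv.finrank_eq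
      rw [Module.finrank_prod, hd, Module.finrank_self] at this
      omega
    exact SatisfiesBrunnMinkowski.of_equiv Φ
      (ih (Measure.addHaar : Measure (LinearMap.ker (u : E →ₗ[ℝ] ℝ))) hdim).prod

/-- A convex body that is at least as large as its (halved) difference body is centrally
symmetric. -/
theorem exists_center_of_volume_le {E : Type*} [NormedAddCommGroup E] [NormedSpace ℝ E]
    [MeasurableSpace E] [BorelSpace E] [FiniteDimensional ℝ E] (μ : Measure E)
    [μ.IsAddHaarMeasure] {K : Set E} (hK : Convex ℝ K) (hKc : IsCompact K)
    (hne : (interior K).Nonempty) (hle : μ.real ((1 / 2 : ℝ) • (K + -K)) ≤ μ.real K) :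
    ∃ c : E, c ∈ interior K ∧ ∀ x ∈ K, (2 : ℝ) • c - x ∈ K := by
  have hpos : 0 < μ.real K := real_pos_of_interior hKc hne
  -- The centre is the barycentre. Every nonzero functional takes at c the mean of its extreme
  -- values on K, so K and its reflection in c have the same supporting half-spaces.
  set c : E := (μ.real K)⁻¹ • ∫ x in K, x ∂μ with hc
  have hcomplete : CompleteSpace E := FiniteDimensional.complete ℝ E
  have hid : IntegrableOn (fun x : E => x) K μ := continuous_id.continuousOn.integrableOn_compact hKc
  have hmain : ∀ u : E →L[ℝ] ℝ, u ≠ 0 → ∀ α β, u '' K = Icc α β → 2 * u c = α + β := by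
    intro u hu α β himg
    obtain ⟨Φ, hΦ⟩ := exists_equiv_prod_ker hu
    set ν : Measure (LinearMap.ker (u : E →ₗ[ℝ] ℝ)) := Measure.addHaar with hν
    obtain ⟨k, hk, hmap, hS⟩ := exists_map_eq_smul Φ μ ((volume : Measure ℝ).prod ν)
    have himg2 : Prod.fst '' (Φ '' K) = Icc α β := by
      rw [image_image, ← himg]
      exact image_congr fun x _ => hΦ x
    have himg3 : Φ '' ((1 / 2 : ℝ) • (K + -K)) = (1 / 2 : ℝ) • (Φ '' K + -(Φ '' K)) := by
      rw [image_smul_set, image_add, image_neg]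
    have hint : (interior (Φ '' K)).Nonempty := by
      exact (Φ.toHomeomorph.image_interior K) ▸ hne.image _
    have h1 : 2 * ∫ p in Φ '' K, p.1 ∂((volume : Measure ℝ).prod ν) =
        (α + β) * ((volume : Measure ℝ).prod ν).real (Φ '' K) := setIntegral_fst_eq (satisfiesBrunnMinkowski ν)
      (hK.is_linear_image Φ.toLinearMap.isLinear) (hKc.image Φ.continuous) hint (by
        rw [hS, hS, himg3] at hle
        exact le_of_mul_le_mul_left hle hk) himg2
    have h2 : ∫ x in K, u x ∂μ = k * ∫ p in Φ '' K, p.1 ∂((volume : Measure ℝ).prod ν) := by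
      have e1 : ∫ p in Φ '' K, p.1 ∂(μ.map Φ) = ∫ x in K, u x ∂μ := by
        have hem : MeasurableEmbedding Φ := Φ.toHomeomorph.measurableEmbedding
        rw [hem.setIntegral_map, preimage_image_eq K Φ.injective]
        simp only [hΦ]
      rw [← e1, hmap, Measure.restrict_smul, integral_smul_measure, ENNReal.toReal_ofReal hk.le,
        smul_eq_mul]
    have h3 : u c = (μ.real K)⁻¹ * ∫ x in K, u x ∂μ := by
      rw [hc, map_smul, smul_eq_mul, ← u.integral_comp_comm hid]
    rw [h3, h2]
    have h4 := hS K
    have h5 : ((volume : Measure ℝ).prod ν).real (Φ '' K) = μ.real K / k := by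
      rw [h4]; field_simp
    rw [h5] at h1
    have h6 : ∫ p in Φ '' K, p.1 ∂((volume : Measure ℝ).prod ν) = (α + β) * (μ.real K / k) / 2 := by
      linarith
    rw [h6]
    field_simp
  have himage : ∀ u : E →L[ℝ] ℝ, u '' K = Icc (sInf (u '' K)) (sSup (u '' K)) := fun u =>
    eq_Icc_of_connected_compact ⟨(hne.mono interior_subset).image _,
      hK.isPreconnected.image _ u.continuous.continuousOn⟩ (hKc.image u.continuous)
  refine ⟨c, ?_, fun x hx => ?_⟩
  -- A functional separating c from the interior would have its supremum on K at most u c, which is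
  -- the mean of the infimum and the supremum; it would then be constant on K.
  · by_contra hcon
    obtain ⟨u, hu⟩ := geometric_hahn_banach_open_point hK.interior isOpen_interior hcon
    obtain ⟨x₀, hx₀⟩ := hne
    have hu0 : u ≠ 0 := by
      rintro rfl
      simpa using hu x₀ hx₀
    have h1 := hmain u hu0 _ _ (himage u)
    have h2 : sSup (u '' K) ≤ u c := by
      refine csSup_le ⟨_, mem_image_of_mem u (interior_subset hx₀)⟩ ?_
      rintro _ ⟨y, hy, rfl⟩
      have : y ∈ closure (interior K) := by
        rw [hK.closure_interior_eq_closure_of_nonempty_interior ⟨x₀, hx₀⟩]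
        exact subset_closure hy
      exact le_on_closure (fun z hz => (hu z hz).le) u.continuous.continuousOn
        continuousOn_const this
    have h3 : u x₀ ∈ Icc (sInf (u '' K)) (sSup (u '' K)) :=
      himage u ▸ mem_image_of_mem u (interior_subset hx₀)
    have h4 := hu x₀ hx₀
    linarith [h3.1]
  -- If u separates 2c - x from K, then u x = 2 u c - u (2c - x) lies below the infimum of u on K.
  · by_contra hcon
    obtain ⟨u, s, hs, hsx⟩ := geometric_hahn_banach_closed_point hK hKc.isClosed hcon
    have hu0 : u ≠ 0 := by
      rintro rfl
      have := hs x hx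
      simp at this hsx
      linarith
    have h1 := hmain u hu0 _ _ (himage u)
    have h2 : sSup (u '' K) ≤ s := by
      refine csSup_le ⟨_, mem_image_of_mem u hx⟩ ?_
      rintro _ ⟨y, hy, rfl⟩
      exact (hs y hy).le
    have h3 : u x ∈ Icc (sInf (u '' K)) (sSup (u '' K)) := himage u ▸ mem_image_of_mem u hx
    rw [map_sub, map_smul, smul_eq_mul] at hsx
    linarith [h3.1]

end BrunnMinkowski

/-! ### Convex tiles, their neighbours and facet vectors, without assuming symmetry. -/

section Tilings

open Topology Filter

variable {E : Type*} [NormedAddCommGroup E] [NormedSpace ℝ E]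

/-- The translates of `P` by `T` tile the space face-to-face. -/
structure IsTranslateTiling (P T : Set E) : Prop where
  cover : ∀ x, ∃ s ∈ T, x - s ∈ P
  disjoint : ∀ s ∈ T, ∀ s' ∈ T, s ≠ s' → ∀ x, x - s ∈ interior P → x - s' ∉ interior P
  exposed : ∀ s ∈ T, ∀ s' ∈ T, IsExposed ℝ P {x ∈ P | x - (s' - s) ∈ P}

/-- The translates of `cutBody N` by the group `L` tile the space face-to-face, and the translate by
`t n` is adjacent along the facet with normal `n`. -/
structure IsLatticeTiling (N : Set (E →L[ℝ] ℝ)) (t : (E →L[ℝ] ℝ) → E) (L : AddSubgroup E) : Prop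
    extends IsIrredundant N where
  bounded : Bornology.IsBounded (cutBody N)
  adjacent : ∀ n ∈ N, ∀ x ∈ cutBody N, x - t n ∈ cutBody N ↔ n x = 1
  t_mem : ∀ n ∈ N, t n ∈ L
  cover : ∀ x, ∃ v ∈ L, x - v ∈ cutBody N
  disjoint : ∀ v ∈ L, v ≠ 0 → ∀ x, (∀ n ∈ N, n x < 1) → ¬ ∀ n ∈ N, n (x - v) < 1
  exposed : ∀ v ∈ L, IsExposed ℝ (cutBody N) {x ∈ cutBody N | x - v ∈ cutBody N}
  opposite : ∀ n ∈ N, ∃ m ∈ N, ∃ κ < (0 : ℝ), m = κ • n ∧ t m = -t n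

/-- The points p + k d would leave every bounded set. This is the tool for uniqueness of facet
vectors, uniqueness of the centre, and trivial intersection of the two spans. -/
theorem eq_zero_of_forall_add_mem {S : Set E} (hS : Bornology.IsBounded S) {p d : E} (hp : p ∈ S)
    (h : ∀ x ∈ S, x + d ∈ S) : d = 0 := by
  by_contra hd
  have hk : ∀ k : ℕ, p + (k : ℝ) • d ∈ S := by
    intro k
    induction k with
    | zero => simpa using hp
    | succ k ih =>
      have := h _ ih
      rw [add_assoc] at this
      convert this using 2
      push_cast
      module
  obtain ⟨R, hR⟩ := hS.exists_norm_le
  obtain ⟨k, hk'⟩ := exists_nat_gt ((R + ‖p‖) / ‖d‖)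
  have hdpos : 0 < ‖d‖ := norm_pos_iff.2 hd
  rw [div_lt_iff₀ hdpos] at hk'
  have h1 := hR _ (hk k)
  have h2 : ‖(k : ℝ) • d‖ ≤ ‖p + (k : ℝ) • d‖ + ‖p‖ := by
    have := norm_sub_le (p + (k : ℝ) • d) p
    simpa using this
  rw [norm_smul, Real.norm_natCast] at h2
  linarith

variable {N : Set (E →L[ℝ] ℝ)}

theorem IsIrredundant.ne_zero (hN : IsIrredundant N) {n : E →L[ℝ] ℝ} (hn : n ∈ N) : n ≠ 0 := by
  rintro rfl
  obtain ⟨p, hp, -⟩ := hN.witness _ hn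
  simp at hp

theorem IsIrredundant.mem_interior_iff (hN : IsIrredundant N) {x : E} :
    x ∈ interior (cutBody N) ↔ ∀ n ∈ N, n x < 1 := by
  constructor
  · intro hx n hn
    obtain ⟨p, hp, -⟩ := hN.witness n hn
    have ht : Tendsto (fun ε : ℝ => x + ε • p) (𝓝[>] 0) (𝓝 x) := by
      have : Tendsto (fun ε : ℝ => x + ε • p) (𝓝 0) (𝓝 (x + (0 : ℝ) • p)) :=
        Continuous.tendsto (by fun_prop) 0
      simpa using this.mono_left nhdsWithin_le_nhds
    obtain ⟨ε, hε, hε0⟩ := ((ht.eventually (mem_interior_iff_mem_nhds.1 hx)).and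
      self_mem_nhdsWithin).exists
    have hε0 : 0 < ε := hε0
    have := hε n hn
    rw [map_add, map_smul, hp, smul_eq_mul] at this
    linarith
  · intro h
    rw [mem_interior_iff_mem_nhds]
    filter_upwards [hN.eventually_lt x] with z hz n hn
    exact (hz n hn (h n hn)).le

theorem eq_smul_of_ker {n l : E →L[ℝ] ℝ} {p : E} (hp : n p = 1) (h : ∀ v, n v = 0 → l v = 0) :
    l = l p • n := by
  ext x
  have := h (x - n x • p) (by simp [hp])
  simp only [map_sub, map_smul, smul_eq_mul] at this
  simp only [smul_apply, smul_eq_mul]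
  linarith

theorem mem_cutBody_of_witness {n : E →L[ℝ] ℝ} {p : E} (hp : n p = 1)
    (hlt : ∀ m ∈ N, m ≠ n → m p < 1) : p ∈ cutBody N := fun m hm => by
  by_cases hmn : m = n
  · rw [hmn, hp]
  · exact (hlt m hm hmn).le

/-- The points of the facet near a point of its relative interior. -/
theorem IsIrredundant.exists_pos_facet (hN : IsIrredundant N) {n : E →L[ℝ] ℝ} {p v : E}
    (hp : n p = 1) (hlt : ∀ m ∈ N, m ≠ n → m p < 1) (hv : n v = 0) :
    ∃ ε > (0 : ℝ), (p + ε • v ∈ cutBody N ∧ n (p + ε • v) = 1) ∧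
      (p - ε • v ∈ cutBody N ∧ n (p - ε • v) = 1) := by
  obtain ⟨ε, hε, h⟩ := hN.exists_pos_small p v
  refine ⟨ε, hε, ⟨mem_cutBody_of_witness (by simp [hp, hv]) fun m hm hne =>
    (h m hm (hlt m hm hne)).1, by simp [hp, hv]⟩, ⟨mem_cutBody_of_witness (by simp [hp, hv])
    fun m hm hne => (h m hm (hlt m hm hne)).2, by simp [hp, hv]⟩⟩

/-- An exposed subset containing a relative interior point of a facet is the facet or the whole
body. -/
theorem IsIrredundant.exposed_of_mem (hN : IsIrredundant N) {n : E →L[ℝ] ℝ} {p : E}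
    (hp : n p = 1) (hlt : ∀ m ∈ N, m ≠ n → m p < 1) {B : Set E}
    (hn : n ∈ N) (hB : IsExposed ℝ (cutBody N) B) (hpB : p ∈ B) :
    B = cutBody N ∨ B = {x ∈ cutBody N | n x = 1} := by
  obtain ⟨l, hl⟩ := hB ⟨p, hpB⟩
  have hpmax : ∀ y ∈ cutBody N, l y ≤ l p := by
    rw [hl] at hpB
    exact hpB.2
  have hker : ∀ v, n v = 0 → l v = 0 := by
    intro v hv
    obtain ⟨ε, hε, ⟨h1, -⟩, ⟨h2, -⟩⟩ := hN.exists_pos_facet hp hlt hv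
    have a := hpmax _ h1
    have b := hpmax _ h2
    rw [map_add, map_smul, smul_eq_mul] at a
    rw [map_sub, map_smul, smul_eq_mul] at b
    have : ε * l v = 0 := by linarith
    exact (mul_eq_zero.1 this).resolve_left hε.ne'
  have hln := eq_smul_of_ker hp hker
  have hlx : ∀ x, l x = l p * n x := fun x => by
    conv_lhs => rw [hln]
    simp
  have h0 : 0 ≤ l p := by
    have := hpmax 0 (fun m _ => by simp)
    simpa using this
  rcases h0.eq_or_lt with h0 | h0
  · left
    have hz : ∀ x, l x = 0 := fun x => by rw [hlx, ← h0, zero_mul]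
    rw [hl]
    ext x
    simp [hz]
  · right
    rw [hl]
    ext x
    simp only [Set.mem_ofPred_eq, and_congr_right_iff]
    intro hx
    constructor
    · intro h
      have := h p (mem_cutBody_of_witness hp hlt)
      rw [hlx x] at this
      have h3 := hx n hn
      nlinarith
    · intro h y hy
      rw [hlx x, h, hlx y]
      have h3 := hy n hn
      nlinarith

/-- `d` translates the facet opposite to `n` onto the facet with normal `n`. -/
structure IsNeighbor (N : Set (E →L[ℝ] ℝ)) (n : E →L[ℝ] ℝ) (d : E) : Prop where
  iff_eq : ∀ x ∈ cutBody N, x - d ∈ cutBody N ↔ n x = 1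
  exposed : IsExposed ℝ (cutBody N) {x ∈ cutBody N | x + d ∈ cutBody N}

/-- The face {x | x + d ∈ body} is the facet of n moved by -d, so its exposing functional is a
multiple of n. For a zero multiple the whole body, for a positive one the facet, would be mapped
into itself by translation by d. The multiple is therefore negative, and the face is where n is
minimal. -/
theorem IsNeighbor.opposite (hN : IsIrredundant N) (hb : Bornology.IsBounded (cutBody N))
    {n : E →L[ℝ] ℝ} (hn : n ∈ N) {d : E} (h : IsNeighbor N n d) :
    1 < n d ∧ (∀ x ∈ cutBody N, 1 - n d ≤ n x) ∧
      ∀ x ∈ cutBody N, x + d ∈ cutBody N ↔ n x = 1 - n d := by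
  obtain ⟨p, hp, hlt⟩ := hN.witness n hn
  have hpb := mem_cutBody_of_witness hp hlt
  have h0b : (0 : E) ∈ cutBody N := fun m _ => by simp
  have hqb : p - d ∈ cutBody N := (h.iff_eq p hpb).2 hp
  have hd0 : d ≠ 0 := by
    rintro rfl
    have := (h.iff_eq 0 h0b).1 (by simpa using h0b)
    simp at this
  have hqB : p - d ∈ {x ∈ cutBody N | x + d ∈ cutBody N} := ⟨hqb, by simpa using hpb⟩
  obtain ⟨l, hl⟩ := h.exposed ⟨_, hqB⟩
  have hmem : ∀ x, x ∈ cutBody N → (x + d ∈ cutBody N ↔ ∀ y ∈ cutBody N, l y ≤ l x) := by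
    intro x hx
    have := Set.ext_iff.1 hl x
    simpa [hx] using this
  have hqmax := (hmem _ hqb).1 hqB.2
  have hker : ∀ v, n v = 0 → l v = 0 := by
    intro v hv
    obtain ⟨ε, hε, ⟨h1, h1'⟩, ⟨h2, h2'⟩⟩ := hN.exists_pos_facet hp hlt hv
    have a := hqmax _ ((h.iff_eq _ h1).2 h1')
    have b := hqmax _ ((h.iff_eq _ h2).2 h2')
    simp only [map_add, map_sub, map_smul, smul_eq_mul] at a b
    have : ε * l v = 0 := by linarith
    exact (mul_eq_zero.1 this).resolve_left hε.ne'
  have hln := eq_smul_of_ker hp hker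
  have hlx : ∀ x, l x = l p * n x := fun x => by
    conv_lhs => rw [hln]
    simp
  have hneg : l p < 0 := by
    by_contra! hge
    rcases hge.eq_or_lt with h0 | h0
    · have hz : ∀ x, l x = 0 := fun x => by rw [hlx, ← h0, zero_mul]
      refine hd0 (eq_zero_of_forall_add_mem hb h0b fun x hx => (hmem x hx).2 fun y _ => ?_)
      rw [hz, hz]
    · have hface : ∀ x ∈ cutBody N, n x = 1 → x + d ∈ cutBody N := by
        intro x hx hx1
        refine (hmem x hx).2 fun y hy => ?_
        rw [hlx y, hlx x, hx1]
        have := hy n hn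
        nlinarith
      have hq1 : n (p - d) = 1 := by
        have := hqmax p hpb
        rw [hlx (p - d)] at this
        have := hqb n hn
        nlinarith
      have hnd : n d = 0 := by
        rw [map_sub, hp] at hq1; linarith
      refine hd0 (eq_zero_of_forall_add_mem (S := {x ∈ cutBody N | n x = 1})
        (hb.subset (Set.sep_subset _ _)) (p := p) ⟨hpb, hp⟩ fun x hx => ⟨hface x hx.1 hx.2, ?_⟩)
      rw [map_add, hnd, hx.2, add_zero]
  have hmin : ∀ x ∈ cutBody N, 1 - n d ≤ n x := by
    intro x hx
    have := hqmax x hx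
    rw [hlx x, hlx (p - d), map_sub, hp] at this
    nlinarith
  refine ⟨?_, hmin, fun x hx => ?_⟩
  · obtain ⟨ε, hε, hs⟩ := hN.exists_pos_small 0 p
    have : (0 : E) - ε • p ∈ cutBody N := fun m hm => (hs m hm (by simp)).2.le
    have h2 := hmin _ this
    rw [zero_sub, map_neg, map_smul, hp, smul_eq_mul] at h2
    linarith
  · rw [hmem x hx]
    constructor
    · intro h3
      have := h3 _ hqb
      rw [hlx x, hlx (p - d), map_sub, hp] at this
      have h4 := hmin x hx
      nlinarith
    · intro h3 y hy
      rw [hlx x, hlx y, h3]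
      have h4 := hmin y hy
      nlinarith

/-- Both vectors carry the face where n is minimal onto the facet of n, so their difference
translates that facet into itself. -/
theorem IsNeighbor.unique (hN : IsIrredundant N) (hb : Bornology.IsBounded (cutBody N))
    {n : E →L[ℝ] ℝ} (hn : n ∈ N) {d d' : E} (h : IsNeighbor N n d) (h' : IsNeighbor N n d') :
    d' = d := by
  obtain ⟨p, hp, hlt⟩ := hN.witness n hn
  have hpb := mem_cutBody_of_witness hp hlt
  obtain ⟨-, hmin, hiff⟩ := h.opposite hN hb hn
  obtain ⟨-, hmin', hiff'⟩ := h'.opposite hN hb hn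
  have hq := (h.iff_eq p hpb).2 hp
  have hq' := (h'.iff_eq p hpb).2 hp
  have e : n d = n d' := by
    have a := hmin _ hq'
    have b := hmin' _ hq
    rw [map_sub, hp] at a b
    linarith
  have : d' - d = 0 := by
    refine eq_zero_of_forall_add_mem (S := {x ∈ cutBody N | n x = 1})
        (hb.subset (Set.sep_subset _ _)) (p := p) ⟨hpb, hp⟩ fun x hx => ?_
    have h1 := (h.iff_eq x hx.1).2 hx.2
    have h2 := (hiff' _ h1).2 (by rw [map_sub, hx.2, e])
    have e2 : x - d + d' = x + (d' - d) := by abel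
    rw [e2] at h2
    refine ⟨h2, ?_⟩
    rw [map_add, map_sub, hx.2, e]; simp
  exact sub_eq_zero.1 this

/-- The normals active at a point of the facet opposite to `n`. -/
theorem IsNeighbor.active_opposite (hN : IsIrredundant N) (hb : Bornology.IsBounded (cutBody N))
    {n : E →L[ℝ] ℝ} (hn : n ∈ N) {d : E} (h : IsNeighbor N n d) {y : E} (hy : n y = 1)
    (hlt : ∀ m ∈ N, m ≠ n → m y < 1) {k : E →L[ℝ] ℝ} (hk1 : k (y - d) = 1)
    (hk : k ∈ N) : ∃ κ < (0 : ℝ), k = κ • n := by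
  have hyb := mem_cutBody_of_witness hy hlt
  have hnd := (h.opposite hN hb hn).1
  have hker : ∀ v, n v = 0 → k v = 0 := by
    intro v hv
    obtain ⟨ε, hε, ⟨h1, h1'⟩, ⟨h2, h2'⟩⟩ := hN.exists_pos_facet hy hlt hv
    have a := (h.iff_eq _ h1).2 h1' k hk
    have b := (h.iff_eq _ h2).2 h2' k hk
    simp only [map_add, map_sub, map_smul, smul_eq_mul] at a b hk1
    have a' : ε * k v ≤ 0 := by linarith
    have b' : 0 ≤ ε * k v := by linarith
    exact (mul_eq_zero.1 (le_antisymm a' b')).resolve_left hε.ne'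
  have hkn := eq_smul_of_ker hy hker
  refine ⟨_, ?_, hkn⟩
  have : k (y - d) = k y * (1 - n d) := by
    conv_lhs => rw [hkn]
    simp [hy]
  rw [hk1] at this
  nlinarith

/-- Some inequality is active at p - d, for otherwise n could be lowered further there; by
`active_opposite` its normal is a negative multiple of n. Without symmetry the factor need not be
-1. -/
theorem IsNeighbor.exists_opposite (hN : IsIrredundant N) (hb : Bornology.IsBounded (cutBody N))
    {n : E →L[ℝ] ℝ} (hn : n ∈ N) {d : E} (h : IsNeighbor N n d)
    (hexp : IsExposed ℝ (cutBody N) {x ∈ cutBody N | x - d ∈ cutBody N}) :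
    ∃ m ∈ N, ∃ κ < (0 : ℝ), m = κ • n ∧ IsNeighbor N m (-d) := by
  obtain ⟨p, hp, hlt⟩ := hN.witness n hn
  have hpb := mem_cutBody_of_witness hp hlt
  have hqb := (h.iff_eq p hpb).2 hp
  obtain ⟨hnd, hmin, hiff⟩ := h.opposite hN hb hn
  obtain ⟨m, hm, hm1⟩ : ∃ m ∈ N, m (p - d) = 1 := by
    by_contra! hc
    obtain ⟨ε, hε, hs⟩ := hN.exists_pos_small (p - d) p
    have h1 := hmin (p - d - ε • p) fun m hm => (hs m hm (lt_of_le_of_ne (hqb m hm) (hc m hm))).2.le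
    simp only [map_sub, map_smul, hp, smul_eq_mul] at h1
    linarith
  obtain ⟨κ, hκ, hmn⟩ := h.active_opposite hN hb hn hp hlt hm1 hm
  refine ⟨m, hm, κ, hκ, hmn, fun x hx => ?_, by simpa [sub_eq_add_neg] using hexp⟩
  have e : κ * (1 - n d) = 1 := by
    rw [hmn] at hm1
    simpa [hp] using hm1
  rw [sub_neg_eq_add, hiff x hx, hmn, smul_apply, smul_eq_mul]
  exact ⟨fun h' => by rw [h', e], fun h' => mul_left_cancel₀ hκ.ne (h'.trans e.symm)⟩

namespace IsTranslateTiling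

variable {P T : Set E}

theorem finite_of_bounded [ProperSpace E] (h : IsTranslateTiling P T) (h0 : (0 : E) ∈ interior P)
    {B : Set E} (hB : Bornology.IsBounded B) : {s ∈ B | s ∈ T}.Finite := by
  obtain ⟨r, hr, hlt⟩ := Metric.isOpen_iff.1 isOpen_interior (0 : E) h0
  refine finite_of_separated hr ?_ (hB.subset (Set.sep_subset _ _))
  rintro x ⟨-, hx⟩ y ⟨-, hy⟩ hne
  by_contra! hd
  refine h.disjoint x hx y hy hne x (by simpa using h0) (hlt ?_)
  rwa [mem_ball_zero_iff, ← dist_eq_norm]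

/-- The finite system comes from the tiling: separate the tile from each of the nearby tiles. A
point outside P can be pulled towards 0 to a point still outside P but near it, hence covered by one
of those tiles, whose inequality the original point violates. -/
theorem exists_cutBody_eq [ProperSpace E] (h : IsTranslateTiling P T) (hP : Convex ℝ P)
    (hPc : IsCompact P) (h0 : (0 : E) ∈ interior P) :
    ∃ N : Set (E →L[ℝ] ℝ), N.Finite ∧ cutBody N = P := by
  obtain ⟨s₀, hs₀, -⟩ := h.cover 0
  obtain ⟨R, hR⟩ := hPc.isBounded.exists_norm_le
  set M := {s ∈ Metric.closedBall s₀ (2 * R + 1) | s ∈ T} with hM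
  have hMf : M.Finite := h.finite_of_bounded h0 Metric.isBounded_closedBall
  have hsep : ∀ s ∈ T, s ≠ s₀ → ∃ n : E →L[ℝ] ℝ, (∀ x ∈ P, n x ≤ 1) ∧
      ∀ x, x - (s - s₀) ∈ P → 1 ≤ n x := by
    intro s hs hne
    have hdisj : Disjoint (interior P) (interior {x | x - (s - s₀) ∈ P}) := by
      rw [Set.disjoint_left]
      intro x hx hx2
      refine h.disjoint s₀ hs₀ s hs hne.symm (x + s₀) (by simpa using hx) ?_
      have : x + s₀ - s = x - (s - s₀) := by abel
      rw [this]
      have hpre := (Homeomorph.subRight (s - s₀)).preimage_interior P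
      exact hpre.symm.subset hx2
    have hconv : Convex ℝ {x | x - (s - s₀) ∈ P} := by
      have : {x | x - (s - s₀) ∈ P} = (fun x => x - (s - s₀)) ⁻¹' P := rfl
      rw [this]
      simp only [sub_eq_add_neg]
      exact hP.translate_preimage_left _
    have hne' : (interior {x | x - (s - s₀) ∈ P}).Nonempty := by
      refine ⟨s - s₀, ?_⟩
      have hpre := (Homeomorph.subRight (s - s₀)).preimage_interior P
      exact hpre.subset (by simpa using h0)
    obtain ⟨f, u, hf1, hf2⟩ := geometric_hahn_banach_open hP.interior isOpen_interior hconv.interior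
      hdisj
    have hu : 0 < u := by simpa using hf1 0 h0
    refine ⟨u⁻¹ • f, fun x hx => ?_, fun x hx => ?_⟩
    · have : x ∈ closure (interior P) := by
        rw [hP.closure_interior_eq_closure_of_nonempty_interior ⟨0, h0⟩]
        exact subset_closure hx
      have := le_on_closure (fun z hz => (hf1 z hz).le) f.continuous.continuousOn
        continuousOn_const this
      rw [smul_apply, smul_eq_mul, inv_mul_le_iff₀ hu]; linarith
    · have : x ∈ closure (interior {x | x - (s - s₀) ∈ P}) := by
        rw [hconv.closure_interior_eq_closure_of_nonempty_interior hne']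
        exact subset_closure hx
      have := le_on_closure (fun z hz => hf2 z hz) continuousOn_const f.continuous.continuousOn
        this
      rw [smul_apply, smul_eq_mul, le_inv_mul_iff₀ hu]; linarith
  choose! n hn1 hn2 using hsep
  refine ⟨n '' {s ∈ M | s ≠ s₀}, (hMf.subset (Set.sep_subset _ _)).image n, ?_⟩
  apply Set.Subset.antisymm
  · intro x hx
    by_contra hxP
    have hR0 : 0 ≤ R := (norm_nonneg _).trans (hR 0 (interior_subset h0))
    -- Strictness of σ < 1 turns n (σ • x) ≥ 1 into n x > 1. The bound R + 1 confines the covering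
    -- tile to the finite set M.
    obtain ⟨σ, hσ0, hσ1, hσP, hσR⟩ : ∃ σ : ℝ, 0 ≤ σ ∧ σ < 1 ∧ σ • x ∉ P ∧ ‖σ • x‖ ≤ R + 1 := by
      rcases le_or_gt ‖x‖ (R + 1) with hx1 | hx1
      · have ht : Tendsto (fun σ : ℝ => σ • x) (𝓝[<] 1) (𝓝 x) := by
          have : Tendsto (fun σ : ℝ => σ • x) (𝓝 1) (𝓝 ((1 : ℝ) • x)) :=
            Continuous.tendsto (by fun_prop) 1
          rw [one_smul] at this
          exact this.mono_left nhdsWithin_le_nhds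
        obtain ⟨σ, h1, h2⟩ := ((ht.eventually (hPc.isClosed.isOpen_compl.mem_nhds hxP)).and
          (Ioo_mem_nhdsLT (zero_lt_one' ℝ))).exists
        refine ⟨σ, h2.1.le, h2.2, h1, ?_⟩
        rw [norm_smul, Real.norm_of_nonneg h2.1.le]
        nlinarith [h2.1, h2.2, norm_nonneg x]
      · have hpos : 0 < ‖x‖ := by linarith
        have e : ‖((R + 1) / ‖x‖) • x‖ = R + 1 := by
          rw [norm_smul, Real.norm_of_nonneg (by positivity)]; field_simp
        refine ⟨(R + 1) / ‖x‖, by positivity, (div_lt_one hpos).2 hx1, fun hc => ?_, e.le⟩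
        have := hR _ hc
        linarith
    obtain ⟨s, hs, hsP⟩ := h.cover (σ • x + s₀)
    have hne : s ≠ s₀ := by
      rintro rfl
      exact hσP (by simpa using hsP)
    have e : σ • x + s₀ - s = σ • x - (s - s₀) := by abel
    rw [e] at hsP
    have hsM : s ∈ M := by
      refine ⟨?_, hs⟩
      rw [mem_closedBall_iff_norm]
      have h1 := hR _ hsP
      have h2 := norm_sub_le (σ • x) (σ • x - (s - s₀))
      rw [sub_sub_cancel] at h2
      linarith
    have h1 := hx (n s) ⟨s, ⟨hsM, hne⟩, rfl⟩
    have h2 := hn2 s hs hne _ hsP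
    rw [map_smul, smul_eq_mul] at h2
    nlinarith
  · rintro x hx _ ⟨s, ⟨hs, hne⟩, rfl⟩
    exact hn1 s hs.2 hne x hx

/-- Take a minimal subsystem cutting out the same body. Dropping n admits a point z with n z > 1,
and z scaled down to n = 1 is a witness. -/
theorem _root_.exists_irredundant {N : Set (E →L[ℝ] ℝ)} (hN : N.Finite) :
    ∃ N' : Set (E →L[ℝ] ℝ), IsIrredundant N' ∧ cutBody N' = cutBody N := by
  have hfin : {S : Set (E →L[ℝ] ℝ) | S ⊆ N ∧ cutBody S = cutBody N}.Finite :=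
    hN.finite_subsets.subset fun S hS => hS.1
  obtain ⟨N', hmin⟩ := hfin.exists_minimal ⟨N, subset_rfl, rfl⟩
  obtain ⟨⟨hsub, heq⟩, hm⟩ := hmin
  refine ⟨N', ⟨hN.subset hsub, fun n hn => ?_⟩, heq⟩
  have hnot : cutBody (N' \ {n}) ≠ cutBody N := by
    intro hc
    have := hm (y := N' \ {n}) ⟨Set.sdiff_subset.trans hsub, hc⟩ Set.sdiff_subset hn
    exact this.2 rfl
  obtain ⟨z, hz, hzn⟩ : ∃ z ∈ cutBody (N' \ {n}), 1 < n z := by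
    by_contra! hc
    apply hnot
    rw [← heq]
    apply Set.Subset.antisymm
    · intro z hz m hm'
      by_cases hmn : m = n
      · rw [hmn]; exact hc z hz
      · exact hz m ⟨hm', hmn⟩
    · exact fun z hz m hm' => hz m hm'.1
  have hpos : 0 < n z := by linarith
  refine ⟨(n z)⁻¹ • z, by simp [hpos.ne'], fun m hm' hne => ?_⟩
  have := hz m ⟨hm', hne⟩
  rw [map_smul, smul_eq_mul, inv_mul_lt_iff₀ hpos]
  linarith

/-- Points just beyond p across the facet are covered by tiles other than s, and local finiteness
gives one containing p itself. By the face-to-face condition its intersection with the tile s is the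
facet or the whole tile, and the latter would be an overlap. -/
theorem exists_neighbor [ProperSpace E] (h : IsTranslateTiling (cutBody N) T)
    (hN : IsIrredundant N) (hb : Bornology.IsBounded (cutBody N)) {n : E →L[ℝ] ℝ} (hn : n ∈ N)
    {s : E} (hs : s ∈ T) : ∃ s' ∈ T, IsNeighbor N n (s' - s) := by
  obtain ⟨p, hp, hlt⟩ := hN.witness n hn
  have hpb := mem_cutBody_of_witness hp hlt
  have h0 : (0 : E) ∈ interior (cutBody N) := hN.mem_interior_iff.2 fun m _ => by simp
  obtain ⟨R, hR⟩ := hb.exists_norm_le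
  obtain ⟨s', hs', hne, hps⟩ : ∃ s' ∈ T, s' ≠ s ∧ p - (s' - s) ∈ cutBody N := by
    by_contra! hc
    set M := {r ∈ Metric.closedBall s (‖p‖ + 1 + R) | r ∈ T} with hM
    have hMf : M.Finite := h.finite_of_bounded h0 Metric.isBounded_closedBall
    have hev : ∀ᶠ z in 𝓝 p, ∀ r ∈ M, r ≠ s → z - (r - s) ∉ cutBody N := by
      rw [eventually_all_finite hMf]
      intro r hr
      by_cases hrs : r = s
      · exact Eventually.of_forall fun z h' => absurd hrs h'
      have hcl : IsClosed {z | z - (r - s) ∈ cutBody N} :=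
        isClosed_cutBody.preimage (f := fun z => z - (r - s)) (by fun_prop)
      filter_upwards [hcl.isOpen_compl.mem_nhds (hc r hr.2 hrs)] with z hz _
      exact hz
    have ht : Tendsto (fun ε : ℝ => p + ε • p) (𝓝[>] 0) (𝓝 p) := by
      have : Tendsto (fun ε : ℝ => p + ε • p) (𝓝 0) (𝓝 (p + (0 : ℝ) • p)) :=
        Continuous.tendsto (by fun_prop) 0
      simpa using this.mono_left nhdsWithin_le_nhds
    obtain ⟨ε, ⟨hε1, hε2⟩, hε⟩ := (((ht.eventually hev).and (ht.eventually
      (Metric.ball_mem_nhds p one_pos))).and self_mem_nhdsWithin).exists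
    have hε : 0 < ε := hε
    obtain ⟨r, hr, hrP⟩ := h.cover (p + ε • p + s)
    have e : p + ε • p + s - r = p + ε • p - (r - s) := by abel
    rw [e] at hrP
    have hrs : r ≠ s := by
      rintro rfl
      have := hrP n hn
      simp only [sub_self, sub_zero, map_add, map_smul, hp, smul_eq_mul] at this
      linarith
    refine hε1 r ⟨?_, hr⟩ hrs hrP
    rw [mem_closedBall_iff_norm]
    have h1 := hR _ hrP
    have h2 := norm_sub_le (p + ε • p) (p + ε • p - (r - s))
    rw [sub_sub_cancel] at h2
    have h3 : ‖p + ε • p‖ ≤ ‖p‖ + 1 := by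
      rw [dist_eq_norm] at hε2
      have := norm_add_le p (p + ε • p - p)
      rw [add_sub_cancel] at this
      linarith
    linarith
  refine ⟨s', hs', fun x hx => ?_, ?_⟩
  · have hB := h.exposed s hs s' hs'
    rcases hN.exposed_of_mem hp hlt hn hB ⟨hpb, hps⟩ with hall | hfac
    · exfalso
      have hsub : interior (cutBody N) ⊆ {x | x - (s' - s) ∈ interior (cutBody N)} := by
        have hpre := (Homeomorph.subRight (s' - s)).preimage_interior (cutBody N)
        have : {x | x - (s' - s) ∈ interior (cutBody N)} =
          interior {x | x - (s' - s) ∈ cutBody N} := hpre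
        rw [this]
        refine interior_mono fun x hx => ?_
        rw [← hall] at hx
        exact hx.2
      have h1 := hsub h0
      refine h.disjoint s hs s' hs' hne.symm s (by simpa using h0) ?_
      simpa using h1
    · have := Set.ext_iff.1 hfac x
      simpa [hx] using this
  · have := h.exposed s' hs' s hs
    convert this using 5
    abel

end IsTranslateTiling

end Tilings

/-! ### The facet vectors generate a lattice that tiles. -/

section LatticeTilings

open Topology Filter

variable {E : Type*} [NormedAddCommGroup E] [NormedSpace ℝ E] {N : Set (E →L[ℝ] ℝ)}
  {t : (E →L[ℝ] ℝ) → E} {L : AddSubgroup E}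

theorem IsIrredundant.exists_separation (hN : IsIrredundant N)
    (hdisj : ∀ v ∈ L, v ≠ 0 → ∀ x, (∀ n ∈ N, n x < 1) → ¬ ∀ n ∈ N, n (x - v) < 1) :
    ∃ r > (0 : ℝ), ∀ v ∈ L, ∀ w ∈ L, v ≠ w → r ≤ dist v w := by
  obtain ⟨r, hr, h⟩ := IsSymmTiling.strictInterior_nhds_zero hN
  refine ⟨r, hr, fun v hv w hw hne => ?_⟩
  by_contra! hd
  refine hdisj (v - w) (L.sub_mem hv hw) (sub_ne_zero.2 hne) 0 (fun m _ => by simp) (h _ ?_)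
  rwa [zero_sub, norm_neg, ← dist_eq_norm]

theorem countable_of_separated {E : Type*} [NormedAddCommGroup E] [ProperSpace E] {S : Set E} {r : ℝ} (hr : 0 < r)
    (hS : ∀ v ∈ S, ∀ w ∈ S, v ≠ w → r ≤ dist v w) : S.Countable := by
  have : S ⊆ ⋃ k : ℕ, S ∩ Metric.closedBall 0 k := fun x hx => by
    obtain ⟨k, hk⟩ := exists_nat_ge ‖x‖
    exact Set.mem_iUnion.2 ⟨k, hx, by simpa using hk⟩
  refine Set.Countable.mono this (Set.countable_iUnion fun k => Set.Finite.countable ?_)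
  exact finite_of_separated hr (fun x hx y hy => hS x hx.1 y hy.1)
    (Metric.isBounded_closedBall.subset Set.inter_subset_right)

/-- The inequalities of the second tile active at y are negative multiples of n, so they hold
wherever n z > 1. -/
theorem IsNeighbor.eventually_mem (hN : IsIrredundant N) (hb : Bornology.IsBounded (cutBody N))
    {n : E →L[ℝ] ℝ} (hn : n ∈ N) {d : E} (h : IsNeighbor N n d) {y : E} (hy : n y = 1)
    (hlt : ∀ m ∈ N, m ≠ n → m y < 1) :
    ∀ᶠ z in 𝓝 y, z ∈ cutBody N ∨ z - d ∈ cutBody N := by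
  have hc : Tendsto (fun z : E => z - d) (𝓝 y) (𝓝 (y - d)) := Continuous.tendsto (by fun_prop) y
  have hyb := mem_cutBody_of_witness hy hlt
  have hyd := (h.iff_eq y hyb).2 hy
  filter_upwards [hN.eventually_lt y, hc.eventually (hN.eventually_lt (y - d))] with z h1 h2
  rcases le_or_gt (n z) 1 with hz | hz
  · left
    intro m hm
    by_cases hmn : m = n
    · rwa [hmn]
    · exact (h1 m hm (hlt m hm hmn)).le
  · right
    intro m hm
    rcases (hyd m hm).lt_or_eq with hlt' | heq
    · exact (h2 m hm hlt').le
    · obtain ⟨κ, hκ, rfl⟩ := h.active_opposite hN hb hn hy hlt heq hm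
      simp only [smul_apply, smul_eq_mul, map_sub, hy] at heq ⊢
      nlinarith

/-- If the translates of a body by a group are adjacent across all facets, they cover the space. -/
theorem IsIrredundant.cover_of_isNeighbor [FiniteDimensional ℝ E] (hN : IsIrredundant N)
    (hb : Bornology.IsBounded (cutBody N))
    (hdisj : ∀ v ∈ L, v ≠ 0 → ∀ x, (∀ n ∈ N, n x < 1) → ¬ ∀ n ∈ N, n (x - v) < 1)
    (ht : ∀ n ∈ N, t n ∈ L) (hnb : ∀ n ∈ N, IsNeighbor N n (t n)) (x : E) :
    ∃ v ∈ L, x - v ∈ cutBody N := by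
  have : ProperSpace E := FiniteDimensional.proper ℝ E
  have : CompleteSpace E := FiniteDimensional.complete ℝ E
  obtain ⟨r, hr, hsep⟩ := hN.exists_separation hdisj
  have hcount := countable_of_separated hr hsep
  have hLc : IsClosed (L : Set E) := Metric.isClosed_of_pairwise_le_dist hr
    fun v hv w hw hne => hsep v hv w hw hne
  have hBc : IsCompact (cutBody N) := Metric.isCompact_of_isClosed_isBounded isClosed_cutBody hb
  set U : Set E := (L : Set E) + cutBody N with hU
  have hUmem : ∀ x, x ∈ U ↔ ∃ v ∈ L, x - v ∈ cutBody N := by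
    intro x
    constructor
    · rintro ⟨v, hv, y, hy, rfl⟩
      exact ⟨v, hv, by simpa using hy⟩
    · rintro ⟨v, hv, h⟩
      exact ⟨v, hv, _, h, by simp⟩
  have hUc : IsClosed U := hLc.add_right_of_isCompact hBc
  -- If n and m are both active at σ • x - v, then σ * n x = 1 + n v and σ * m x = 1 + m v, so this
  -- combination vanishes at x. Avoiding these hyperplanes makes the segment from 0 to x cross tile
  -- boundaries only inside facets.
  set S : Set (E →L[ℝ] ℝ) := {l | l ≠ 0 ∧ (l ∈ N ∨ ∃ n ∈ N, ∃ m ∈ N, ∃ v ∈ L,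
    l = (1 + m v) • n - (1 + n v) • m)} with hS
  have hScount : S.Countable := by
    have h1 : S ⊆ N ∪ ⋃ n ∈ N, ⋃ m ∈ N, (fun v : E => (1 + m v) • n - (1 + n v) • m) '' L := by
      rintro l ⟨-, hl | ⟨n, hn, m, hm, v, hv, rfl⟩⟩
      · exact Or.inl hl
      · refine Or.inr ?_
        simp only [Set.mem_iUnion]
        exact ⟨n, hn, m, hm, v, hv, rfl⟩
    refine Set.Countable.mono h1 (hN.finite.countable.union ?_)
    exact hN.finite.countable.biUnion fun n _ => hN.finite.countable.biUnion fun m _ =>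
      hcount.image _
  have hdense := dense_ne_zero_of_countable hScount fun l hl => hl.1
  have hgen : ∀ x, (∀ l ∈ S, l x ≠ 0) → x ∈ U := by
    intro x hx
    have hcl : IsClosed ((fun σ : ℝ => σ • x) ⁻¹' U ∩ Set.Icc 0 1) :=
      (hUc.preimage (by fun_prop)).inter isClosed_Icc
    have h0 : (0 : E) ∈ U := (hUmem 0).2 ⟨0, L.zero_mem, fun m _ => by simp⟩
    have key : ∀ σ : ℝ, 0 ≤ σ → σ • x ∈ U → U ∈ 𝓝 (σ • x) := by
      intro σ hσ hσU
      rcases hσ.eq_or_lt with h | hσ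
      · rw [← h, zero_smul]
        have : cutBody N ∈ 𝓝 (0 : E) :=
          mem_interior_iff_mem_nhds.1 (hN.mem_interior_iff.2 fun m _ => by simp)
        filter_upwards [this] with z hz
        exact (hUmem z).2 ⟨0, L.zero_mem, by simpa using hz⟩
      obtain ⟨v, hv, hvB⟩ := (hUmem _).1 hσU
      have hc : Tendsto (fun z : E => z - v) (𝓝 (σ • x)) (𝓝 (σ • x - v)) :=
        Continuous.tendsto (by fun_prop) _
      by_cases hact : ∃ n ∈ N, n (σ • x - v) = 1
      · obtain ⟨n, hn, hn1⟩ := hact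
        have huniq : ∀ m ∈ N, m ≠ n → m (σ • x - v) < 1 := by
          intro m hm hne
          refine lt_of_le_of_ne (hvB m hm) fun hm1 => hne ?_
          simp only [map_sub, map_smul, smul_eq_mul] at hn1 hm1
          have hnx : n x ≠ 0 := hx n ⟨hN.ne_zero hn, Or.inl hn⟩
          have hl0 : (1 + m v) • n - (1 + n v) • m = 0 := by
            by_contra hl0
            refine hx _ ⟨hl0, Or.inr ⟨n, hn, m, hm, v, hv, rfl⟩⟩ ?_
            simp only [sub_apply, smul_apply, smul_eq_mul]
            have e1 : 1 + m v = σ * m x := by linarith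
            have e2 : 1 + n v = σ * n x := by linarith
            rw [e1, e2]; ring
          have h2 := congrArg (fun l : E →L[ℝ] ℝ => l (σ • x - v)) hl0
          simp only [sub_apply, smul_apply, smul_eq_mul, map_sub, map_smul, zero_apply] at h2
          have e2 : 1 + n v = σ * n x := by linarith
          have e3 : 1 + m v = 1 + n v := by
            linear_combination h2 - (1 + m v) * hn1 + (1 + n v) * hm1
          have e4 : 1 + n v ≠ 0 := by rw [e2]; exact mul_ne_zero hσ.ne' hnx
          rw [e3] at hl0
          exact (smul_right_injective _ e4 (sub_eq_zero.1 hl0)).symm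
        filter_upwards [hc.eventually ((hnb n hn).eventually_mem hN hb hn hn1 huniq)] with z hz
        rcases hz with hz | hz
        · exact (hUmem z).2 ⟨v, hv, hz⟩
        · exact (hUmem z).2 ⟨v + t n, L.add_mem hv (ht n hn), by rwa [← sub_sub]⟩
      · push Not at hact
        filter_upwards [hc.eventually (hN.eventually_lt _)] with z hz
        exact (hUmem z).2 ⟨v, hv, fun m hm =>
          (hz m hm (lt_of_le_of_ne (hvB m hm) (hact m hm))).le⟩
    -- The parameters with σ • x covered form a closed set that is also open in [0, 1], as the
    -- neighbour takes over at each facet.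
    have := hcl.Icc_subset_of_forall_mem_nhdsWithin (by simpa using h0) (by
      rintro σ ⟨hσU, hσ⟩
      have hc : Continuous fun σ : ℝ => σ • x := by fun_prop
      exact mem_nhdsWithin_of_mem_nhds (hc.continuousAt.preimage_mem_nhds (key σ hσ.1 hσU)))
    have h1 := this (Set.right_mem_Icc.2 zero_le_one)
    simpa using h1
  have hall : U = Set.univ := by
    rw [← hUc.closure_eq]
    exact (hdense.mono hgen).closure_eq
  exact (hUmem x).1 (hall ▸ Set.mem_univ x)

/-- The tiles adjacent to one tile generate a lattice of translations that tiles the space. -/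
theorem IsTranslateTiling.exists_isLatticeTiling [FiniteDimensional ℝ E] {T : Set E}
    (h : IsTranslateTiling (cutBody N) T) (hN : IsIrredundant N)
    (hb : Bornology.IsBounded (cutBody N)) :
    ∃ t : (E →L[ℝ] ℝ) → E, IsLatticeTiling N t (AddSubgroup.closure (t '' N)) := by
  have : ProperSpace E := FiniteDimensional.proper ℝ E
  obtain ⟨s₀, hs₀, -⟩ := h.cover 0
  choose! t' ht' hnb using fun n (hn : n ∈ N) => h.exists_neighbor hN hb hn hs₀
  set t : (E →L[ℝ] ℝ) → E := fun n => t' n - s₀ with ht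
  -- Neighbours are unique, so the vector across the facet of n is the same for every tile; hence T
  -- is stable under the group generated by the facet vectors.
  have hadd : ∀ n ∈ N, ∀ s ∈ T, s + t n ∈ T := by
    intro n hn s hs
    obtain ⟨s', hs', hs'n⟩ := h.exists_neighbor hN hb hn hs
    have := (hnb n hn).unique hN hb hn hs'n
    have e : s + t n = s' := by
      rw [ht]; dsimp only; rw [← this]; abel
    rwa [e]
  have hopp : ∀ n ∈ N, ∃ m ∈ N, ∃ κ < (0 : ℝ), m = κ • n ∧ t m = -t n := by
    intro n hn
    obtain ⟨m, hm, κ, hκ, hmn, hm'⟩ := (hnb n hn).exists_opposite hN hb hn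
      (h.exposed s₀ hs₀ _ (ht' n hn))
    exact ⟨m, hm, κ, hκ, hmn, (hm'.unique hN hb hm (hnb m hm))⟩
  have hclos : ∀ v ∈ AddSubgroup.closure (t '' N), ∀ s ∈ T, s + v ∈ T ∧ s - v ∈ T := by
    intro v hv
    induction hv using AddSubgroup.closure_induction with
    | mem v hv =>
      obtain ⟨n, hn, rfl⟩ := hv
      intro s hs
      obtain ⟨m, hm, -, -, -, e⟩ := hopp n hn
      refine ⟨hadd n hn s hs, ?_⟩
      have := hadd m hm s hs
      rwa [e, ← sub_eq_add_neg] at this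
    | zero => intro s hs; simpa using hs
    | add v w _ _ hv hw =>
      intro s hs
      refine ⟨?_, ?_⟩
      · rw [← add_assoc]; exact (hw _ (hv s hs).1).1
      · rw [← sub_sub]; exact (hw _ (hv s hs).2).2
    | neg v _ hv =>
      intro s hs
      refine ⟨?_, ?_⟩
      · rw [← sub_eq_add_neg]; exact (hv s hs).2
      · rw [sub_neg_eq_add]; exact (hv s hs).1
  have htm : ∀ n ∈ N, t n ∈ AddSubgroup.closure (t '' N) := fun n hn =>
    AddSubgroup.subset_closure ⟨n, hn, rfl⟩
  have hdisj : ∀ v ∈ AddSubgroup.closure (t '' N), v ≠ 0 → ∀ x, (∀ n ∈ N, n x < 1) →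
      ¬ ∀ n ∈ N, n (x - v) < 1 := by
    intro v hv hv0 x hx hx'
    refine h.disjoint s₀ hs₀ (s₀ + v) (hclos v hv s₀ hs₀).1 (by simpa using hv0) (x + s₀) ?_ ?_
    · rw [hN.mem_interior_iff]; simpa using hx
    · rw [hN.mem_interior_iff]
      have e : x + s₀ - (s₀ + v) = x - v := by abel
      rwa [e]
  exact ⟨t, hN, hb, fun n hn => (hnb n hn).iff_eq, htm,
    hN.cover_of_isNeighbor hb hdisj htm hnb, hdisj, fun v hv => by
      simpa using h.exposed s₀ hs₀ _ (hclos v hv s₀ hs₀).1, hopp⟩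

end LatticeTilings

/-! ### Central symmetry of a lattice tile. -/

section CentralSymmetry

open Topology Filter

variable {E : Type*} [NormedAddCommGroup E] [NormedSpace ℝ E] {N : Set (E →L[ℝ] ℝ)}
  {t : (E →L[ℝ] ℝ) → E} {L : AddSubgroup E}

theorem IsExposed.vadd_set {A B : Set E} (h : IsExposed ℝ A B) (v : E) :
    IsExposed ℝ (v +ᵥ A) (v +ᵥ B) := by
  rintro ⟨_, ⟨b, hb, rfl⟩⟩
  obtain ⟨l, hl⟩ := h ⟨b, hb⟩
  refine ⟨l, ?_⟩
  ext x
  rw [Set.mem_vadd_set_iff_neg_vadd_mem, hl]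
  simp only [Set.mem_ofPred_eq, Set.mem_vadd_set_iff_neg_vadd_mem, vadd_eq_add]
  refine and_congr_right fun _ => ⟨fun h' y hy => ?_, fun h' y hy => ?_⟩
  · have := h' _ hy
    simp only [map_add] at this
    linarith
  · have := h' (v + y) (by simpa using hy)
    simp only [map_add, map_neg] at this ⊢
    linarith

theorem IsFaceToFaceTiling.isTranslateTiling {P T : Set E}
    (h : IsFaceToFaceTiling Set.univ P T) (c : E) : IsTranslateTiling (-c +ᵥ P) T where
  cover x := by
    have hx : x + c ∈ ⋃ s ∈ T, (s +ᵥ P) := by rw [h.cover]; trivial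
    simp only [Set.mem_iUnion, Set.mem_vadd_set_iff_neg_vadd_mem, vadd_eq_add] at hx
    obtain ⟨s, hs, hx⟩ := hx
    refine ⟨s, hs, ?_⟩
    rw [Set.mem_vadd_set_iff_neg_vadd_mem, vadd_eq_add]
    convert hx using 1
    abel
  disjoint s hs s' hs' hne x hx hx' := by
    have key : ∀ r : E, x - r ∈ interior (-c +ᵥ P) → x + c ∈ intrinsicInterior ℝ (r +ᵥ P) := by
      intro r hr
      refine interior_subset_intrinsicInterior ?_
      rw [interior_vadd, Set.mem_vadd_set_iff_neg_vadd_mem, vadd_eq_add] at hr ⊢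
      convert hr using 1
      abel
    exact Set.disjoint_left.1 (h.disjoint s hs s' hs' hne) (key s hx) (key s' hx')
  exposed s hs s' hs' := by
    have := (h.faceToFace s hs s' hs').vadd_set (-c - s)
    convert this using 1
    · rw [vadd_vadd]; congr 1; abel
    · ext x
      simp only [Set.mem_ofPred_eq, Set.mem_vadd_set_iff_neg_vadd_mem, vadd_eq_add,
        Set.mem_inter_iff]
      refine and_congr ?_ ?_
      · apply iff_of_eq; congr 1; abel
      · apply iff_of_eq; congr 1; abel

namespace IsLatticeTiling

/-- Minkowski's exchange: if (a - b)/2 - v = (a' - b')/2, then (a + b')/2 - v = (b + a')/2, so an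
overlap of translates of the halved difference body gives one of tiles. -/
theorem eq_zero_of_mem_interior (h : IsLatticeTiling N t L) {v x : E} (hv : v ∈ L)
    (hx : x ∈ interior ((1 / 2 : ℝ) • (cutBody N + -cutBody N)))
    (hx' : x - v ∈ interior ((1 / 2 : ℝ) • (cutBody N + -cutBody N))) : v = 0 := by
  by_contra hv0
  set D := (1 / 2 : ℝ) • (cutBody N + -cutBody N) with hD
  have hmem : ∀ z ∈ D, ∃ a ∈ cutBody N, ∃ b ∈ cutBody N, z = (1 / 2 : ℝ) • (a - b) := by
    rintro _ ⟨_, ⟨a, ha, b, hb, rfl⟩, rfl⟩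
    exact ⟨a, ha, -b, hb, by simp⟩
  have ht : ∀ z : E, Tendsto (fun s : ℝ => s • z) (𝓝[>] 1) (𝓝 z) := fun z => by
    have : Tendsto (fun s : ℝ => s • z) (𝓝 1) (𝓝 ((1 : ℝ) • z)) :=
      Continuous.tendsto (by fun_prop) 1
    rw [one_smul] at this
    exact this.mono_left nhdsWithin_le_nhds
  -- Interior points can be scaled up by some s > 1 within the body. Scaling back afterwards makes
  -- the inequalities strict.
  obtain ⟨s, ⟨h1, h2⟩, hs⟩ := ((((ht x).eventually (mem_interior_iff_mem_nhds.1 hx)).and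
    ((ht (x - v)).eventually (mem_interior_iff_mem_nhds.1 hx'))).and self_mem_nhdsWithin).exists
  have hs : 1 < s := hs
  obtain ⟨a, ha, b, hb, e1⟩ := hmem _ h1
  obtain ⟨a', ha', b', hb', e2⟩ := hmem _ h2
  have hs0 : s ≠ 0 := by positivity
  have hlt : ∀ w ∈ cutBody N, ∀ w' ∈ cutBody N, ∀ n ∈ N, n (s⁻¹ • (1 / 2 : ℝ) • (w + w')) < 1 := by
    intro w hw w' hw' n hn
    have hw := hw n hn
    have hw' := hw' n hn
    simp only [map_smul, map_add, smul_eq_mul]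
    rw [inv_mul_lt_iff₀ (by positivity)]
    linarith
  refine h.disjoint v hv hv0 _ (hlt a ha b' hb') ?_
  have e3 : s • v = (1 / 2 : ℝ) • (a - b) - (1 / 2 : ℝ) • (a' - b') := by
    rw [← e1, ← e2]; module
  have e4 : v = s⁻¹ • ((1 / 2 : ℝ) • (a - b) - (1 / 2 : ℝ) • (a' - b')) := by
    rw [← e3, inv_smul_smul₀ hs0]
  have e5 : s⁻¹ • (1 / 2 : ℝ) • (a + b') - v = s⁻¹ • (1 / 2 : ℝ) • (b + a') := by
    rw [e4]; module
  rw [e5]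
  exact hlt b hb a' ha'

open MeasureTheory in
/-- A body whose translates by a lattice tile the space is centrally symmetric. -/
theorem exists_center [FiniteDimensional ℝ E] (h : IsLatticeTiling N t L) :
    ∃ c ∈ interior (cutBody N), ∀ x ∈ cutBody N, (2 : ℝ) • c - x ∈ cutBody N := by
  borelize E
  have : ProperSpace E := FiniteDimensional.proper ℝ E
  set μ : Measure E := Measure.addHaar with hμ
  have hKc : IsCompact (cutBody N) :=
    Metric.isCompact_of_isClosed_isBounded isClosed_cutBody h.bounded
  have h0 : (0 : E) ∈ interior (cutBody N) :=
    h.toIsIrredundant.mem_interior_iff.2 fun m _ => by simp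
  obtain ⟨r, hr, hsep⟩ := h.toIsIrredundant.exists_separation h.disjoint
  have : Countable L := (countable_of_separated hr hsep).to_subtype
  have hfd : IsAddFundamentalDomain L (cutBody N) μ := by
    refine ⟨isClosed_cutBody.nullMeasurableSet, Eventually.of_forall fun x => ?_, ?_⟩
    · obtain ⟨v, hv, hx⟩ := h.cover x
      exact ⟨⟨-v, L.neg_mem hv⟩, by simpa [AddSubgroup.vadd_def, sub_eq_neg_add] using hx⟩
    · intro v w hne
      have hnull : ∀ v : L, μ ((v +ᵥ cutBody N) \ (v +ᵥ interior (cutBody N))) = 0 := by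
        intro v
        rw [← Set.vadd_set_sdiff, measure_vadd]
        rw [← isClosed_cutBody.frontier_eq]
        exact convex_cutBody.addHaar_frontier μ
      refine measure_mono_null (t := ((v +ᵥ cutBody N) \ (v +ᵥ interior (cutBody N))) ∪
        ((w +ᵥ cutBody N) \ (w +ᵥ interior (cutBody N)))) ?_
        (measure_union_null (hnull v) (hnull w))
      rintro x ⟨hx, hx'⟩
      by_cases hxi : x ∈ v +ᵥ interior (cutBody N)
      · refine Or.inr ⟨hx', fun hxi' => ?_⟩
        rw [Set.mem_vadd_set_iff_neg_vadd_mem, h.toIsIrredundant.mem_interior_iff] at hxi hxi'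
        refine h.disjoint (w - v) (L.sub_mem w.2 v.2) ?_ _ hxi ?_
        · rw [sub_ne_zero]
          exact fun e => hne (Subtype.ext e.symm)
        · convert hxi' using 4
          simp only [AddSubgroup.vadd_def, vadd_eq_add, AddSubgroup.coe_neg]
          abel
      · exact Or.inl ⟨hx, hxi⟩
  set D := (1 / 2 : ℝ) • (cutBody N + -cutBody N) with hD
  have hDconv : Convex ℝ D := (convex_cutBody.add convex_cutBody.neg).smul _
  -- The tile is a fundamental domain, so an open set of larger volume would meet one of its own
  -- lattice translates.
  have hle : μ (interior D) ≤ μ (cutBody N) := by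
    by_contra! hlt
    obtain ⟨v, w, hne, hnd⟩ := exists_pair_mem_lattice_not_disjoint_vadd hfd
      isOpen_interior.nullMeasurableSet hlt
    obtain ⟨x, hx, hx'⟩ := Set.not_disjoint_iff.1 hnd
    rw [Set.mem_vadd_set_iff_neg_vadd_mem] at hx hx'
    refine hne (Subtype.ext (sub_eq_zero.1 ?_).symm)
    refine h.eq_zero_of_mem_interior (L.sub_mem w.2 v.2) hx ?_
    convert hx' using 1
    simp only [AddSubgroup.vadd_def, vadd_eq_add, AddSubgroup.coe_neg]
    abel
  rw [measure_interior_of_null_frontier (hDconv.addHaar_frontier μ)] at hle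
  have := exists_center_of_volume_le μ convex_cutBody hKc ⟨0, h0⟩
    (ENNReal.toReal_mono hKc.measure_lt_top.ne hle)
  exact this

/-- A lattice tiling by a body symmetric about the origin. -/
theorem isSymmTiling (h : IsLatticeTiling N t L)
    (hneg : ∀ x ∈ cutBody N, -x ∈ cutBody N) : IsSymmTiling N t L := by
  have hopp : ∀ n ∈ N, -n ∈ N ∧ t (-n) = -t n := by
    intro n hn
    obtain ⟨m, hm, κ, hκ, hmn, htm⟩ := h.opposite n hn
    obtain ⟨p, hp, hlt⟩ := h.witness n hn
    obtain ⟨q, hq, hlt'⟩ := h.witness m hm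
    have h1 := hneg _ (mem_cutBody_of_witness hp hlt) m hm
    have h2 := hneg _ (mem_cutBody_of_witness hq hlt') n hn
    rw [hmn] at h1 hq
    simp only [smul_apply, map_neg, smul_eq_mul, hp] at h1 h2 hq
    -- Symmetry at a witness of n gives κ ≥ -1, and at a witness of m it gives κ ≤ -1.
    have e : κ = -1 := by nlinarith
    have hmn : m = -n := by ext x; rw [hmn, e]; simp
    rw [← hmn]
    exact ⟨hm, htm⟩
  refine ⟨h.toIsIrredundant, fun n hn => (hopp n hn).1, fun n hn => ?_, fun n hn x hx hx1 => ?_,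
    fun n hn => (hopp n hn).2, h.t_mem, h.disjoint, h.bounded⟩
  · obtain ⟨p, hp, hlt⟩ := h.witness n hn
    have hpb := mem_cutBody_of_witness hp hlt
    have h1 := (h.adjacent n hn p hpb).2 hp
    have h2 := (h.adjacent (-n) (hopp n hn).1 _ h1).1 (by
      rw [(hopp n hn).2]; simpa using hpb)
    simp only [neg_apply, map_sub, hp] at h2
    linarith
  · have := hneg _ ((h.adjacent n hn x hx).2 hx1)
    rwa [neg_sub] at this

end IsLatticeTiling

theorem IsPolytope.isCompact {P : Set E} (h : IsPolytope P) : IsCompact P := by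
  obtain ⟨s, hs, -, rfl⟩ := h
  exact hs.isCompact_convexHull ℝ

theorem IsPolytope.convex {P : Set E} (h : IsPolytope P) : Convex ℝ P := by
  obtain ⟨s, -, -, rfl⟩ := h
  exact convex_convexHull ℝ s

theorem IsFaceToFaceTiling.exists_isLatticeTiling [FiniteDimensional ℝ E] {P T : Set E}
    (h : IsFaceToFaceTiling Set.univ P T) (hP : Convex ℝ P) (hPc : IsCompact P) {c : E}
    (hc : c ∈ interior P) :
    ∃ (N : Set (E →L[ℝ] ℝ)) (t : (E →L[ℝ] ℝ) → E), (∀ x, x ∈ P ↔ x - c ∈ cutBody N) ∧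
      IsLatticeTiling N t (AddSubgroup.closure (t '' N)) := by
  have : ProperSpace E := FiniteDimensional.proper ℝ E
  have htil := h.isTranslateTiling c
  have hQc : IsCompact (-c +ᵥ P) := hPc.vadd _
  obtain ⟨N₀, hN₀, e₀⟩ := htil.exists_cutBody_eq (hP.vadd _) hQc
    (by rw [interior_vadd, Set.mem_vadd_set_iff_neg_vadd_mem]; simpa using hc)
  obtain ⟨N, hN, e⟩ := exists_irredundant hN₀
  rw [e₀] at e
  rw [← e] at htil hQc
  obtain ⟨t, ht⟩ := htil.exists_isLatticeTiling hN hQc.isBounded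
  refine ⟨N, t, fun x => ?_, ht⟩
  rw [e, Set.mem_vadd_set_iff_neg_vadd_mem]
  simp

/-- A full-dimensional parallelohedron is centrally symmetric, and it tiles the space by the lattice
generated by its facet vectors. -/
theorem IsParallelohedron.exists_isSymmTiling [FiniteDimensional ℝ E] {P : Set E}
    (hP : IsParallelohedron P) (hdim : affineSpan ℝ P = ⊤) :
    ∃ (c : E) (N : Set (E →L[ℝ] ℝ)) (t : (E →L[ℝ] ℝ) → E), (∀ x, x ∈ P ↔ x - c ∈ cutBody N) ∧
      IsLatticeTiling N t (AddSubgroup.closure (t '' N)) ∧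
      IsSymmTiling N t (AddSubgroup.closure (t '' N)) := by
  obtain ⟨hpoly, T, hT⟩ := hP
  rw [hdim, AffineSubspace.top_coe] at hT
  obtain ⟨c₀, hc₀⟩ := hpoly.convex.interior_nonempty_iff_affineSpan_eq_top.2 hdim
  -- The construction runs twice: first about an arbitrary interior point, only to locate the
  -- centre, then about the centre.
  obtain ⟨N₀, t₀, hmem₀, h₀⟩ := hT.exists_isLatticeTiling hpoly.convex hpoly.isCompact hc₀
  obtain ⟨c₁, hc₁, hsymm⟩ := h₀.exists_center
  have hPeq : P = c₀ +ᵥ cutBody N₀ := by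
    ext x
    rw [hmem₀, Set.mem_vadd_set_iff_neg_vadd_mem, vadd_eq_add, sub_eq_neg_add]
  have hc : c₀ + c₁ ∈ interior P := by
    rw [hPeq, interior_vadd, Set.mem_vadd_set_iff_neg_vadd_mem]
    simpa using hc₁
  obtain ⟨N, t, hmem, h⟩ := hT.exists_isLatticeTiling hpoly.convex hpoly.isCompact hc
  refine ⟨c₀ + c₁, N, t, hmem, h, h.isSymmTiling fun x hx => ?_⟩
  have h1 : x + (c₀ + c₁) ∈ P := (hmem _).2 (by simpa using hx)
  have h2 := hsymm _ ((hmem₀ _).1 h1)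
  have h3 : -x + (c₀ + c₁) ∈ P := (hmem₀ _).2 (by
    convert h2 using 1
    module)
  simpa using (hmem _).1 h3

end CentralSymmetry

/-! ### Consequences of the orthogonality relation: convexity, projection, direct sum. -/

section Splitting

open Topology Filter

variable {E : Type*} [NormedAddCommGroup E] [NormedSpace ℝ E]

theorem affineSpan_addSubgroup_closure (S : Set E) :
    affineSpan ℝ (AddSubgroup.closure S : Set E) = (Submodule.span ℝ S).toAffineSubspace := by
  apply le_antisymm
  · rw [affineSpan_le]
    have : AddSubgroup.closure S ≤ (Submodule.span ℝ S).toAddSubgroup :=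
      (AddSubgroup.closure_le _).2 Submodule.subset_span
    exact this
  · have h0 : (0 : E) ∈ affineSpan ℝ (AddSubgroup.closure S : Set E) :=
      subset_affineSpan ℝ _ (AddSubgroup.zero_mem _)
    have hle : Submodule.span ℝ S ≤ (affineSpan ℝ (AddSubgroup.closure S : Set E)).direction := by
      rw [Submodule.span_le]
      intro x hx
      have hx' := subset_affineSpan ℝ (AddSubgroup.closure S : Set E)
        (AddSubgroup.subset_closure hx)
      simpa using AffineSubspace.vsub_mem_direction hx' h0
    intro x hx
    simpa using AffineSubspace.vadd_mem_of_mem_direction (hle hx) h0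

/-- The facet normals split into two classes such that the normals in each class vanish on the facet
vectors of the other. -/
structure IsSplitting (N : Set (E →L[ℝ] ℝ)) (t : (E →L[ℝ] ℝ) → E) (C₁ C₂ : Set (E →L[ℝ] ℝ)) :
    Prop where
  union_eq : C₁ ∪ C₂ = N
  apply₁ : ∀ n ∈ C₁, ∀ k ∈ C₂, n (t k) = 0
  apply₂ : ∀ n ∈ C₂, ∀ k ∈ C₁, n (t k) = 0

variable {N C₁ C₂ : Set (E →L[ℝ] ℝ)} {t : (E →L[ℝ] ℝ) → E}

namespace IsSplitting

theorem symm (hs : IsSplitting N t C₁ C₂) : IsSplitting N t C₂ C₁ :=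
  ⟨by rw [Set.union_comm, hs.union_eq], hs.apply₂, hs.apply₁⟩

theorem apply_span (hs : IsSplitting N t C₁ C₂) {n : E →L[ℝ] ℝ} (hn : n ∈ C₂) {x : E}
    (hx : x ∈ Submodule.span ℝ (t '' C₁)) : n x = 0 := by
  have : Submodule.span ℝ (t '' C₁) ≤ LinearMap.ker (n : E →ₗ[ℝ] ℝ) := by
    rw [Submodule.span_le]
    rintro _ ⟨k, hk, rfl⟩
    exact hs.apply₂ n hn k hk
  exact this hx

theorem closure_le_span (S : Set E) {x : E} (hx : x ∈ AddSubgroup.closure S) :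
    x ∈ Submodule.span ℝ S := by
  have : AddSubgroup.closure S ≤ (Submodule.span ℝ S).toAddSubgroup :=
    (AddSubgroup.closure_le _).2 Submodule.subset_span
  exact this hx

theorem exists_add (hs : IsSplitting N t C₁ C₂) {v : E} (hv : v ∈ AddSubgroup.closure (t '' N)) :
    ∃ v₁ ∈ AddSubgroup.closure (t '' C₁), ∃ v₂ ∈ AddSubgroup.closure (t '' C₂), v₁ + v₂ = v := by
  rwa [← hs.union_eq, Set.image_union, AddSubgroup.closure_union, AddSubgroup.mem_sup] at hv

theorem closure_le (hs : IsSplitting N t C₁ C₂) :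
    AddSubgroup.closure (t '' C₂) ≤ AddSubgroup.closure (t '' N) :=
  AddSubgroup.closure_mono (Set.image_mono (hs.union_eq ▸ Set.subset_union_right))

/-- A vector in both spans is killed by all normals, so it translates the bounded body into itself.
A functional vanishing on both spans vanishes on the lattice, whose tiles cover the space, so it
would be bounded everywhere. -/
theorem isCompl [FiniteDimensional ℝ E] (hs : IsSplitting N t C₁ C₂)
    (h : IsLatticeTiling N t (AddSubgroup.closure (t '' N))) :
    IsCompl (Submodule.span ℝ (t '' C₂)) (Submodule.span ℝ (t '' C₁)) := by
  constructor
  · rw [Submodule.disjoint_def]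
    intro x hx₂ hx₁
    refine eq_zero_of_forall_add_mem h.bounded (p := 0) (fun n _ => by simp) fun y hy n hn => ?_
    rw [← hs.union_eq] at hn
    have : n x = 0 := by
      rcases hn with hn | hn
      · exact hs.symm.apply_span hn hx₂
      · exact hs.apply_span hn hx₁
    rw [map_add, this, add_zero]
    exact hy n (hs.union_eq ▸ hn)
  · rw [codisjoint_iff]
    by_contra hne
    obtain ⟨f, hf0, hf⟩ := Submodule.exists_le_ker_of_lt_top _ (lt_top_iff_ne_top.2 hne)
    obtain ⟨x, hx⟩ : ∃ x, f x ≠ 0 := by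
      by_contra! hc
      exact hf0 (LinearMap.ext hc)
    obtain ⟨R, hR⟩ := (h.bounded.isCompact_closure.image
      f.continuous_of_finiteDimensional).isBounded.exists_norm_le
    obtain ⟨v, hv, hQ⟩ := h.cover (((R + 1) / f x) • x)
    obtain ⟨v₁, hv₁, v₂, hv₂, rfl⟩ := hs.exists_add hv
    have hfv : f (v₁ + v₂) = 0 := hf (Submodule.add_mem _
      (Submodule.mem_sup_right (closure_le_span _ hv₁))
      (Submodule.mem_sup_left (closure_le_span _ hv₂)))
    have := hR _ ⟨_, subset_closure hQ, rfl⟩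
    rw [map_sub, hfv, map_smul, smul_eq_mul, sub_zero, div_mul_cancel₀ _ hx, Real.norm_eq_abs] at this
    linarith [le_abs_self (R + 1)]

theorem mem_cutBody_of_span (hs : IsSplitting N t C₁ C₂) {z : E}
    (hz : z ∈ Submodule.span ℝ (t '' C₂)) (h : ∀ n ∈ C₂, n z ≤ 1) : z ∈ cutBody N := by
  intro n hn
  rw [← hs.union_eq] at hn
  rcases hn with hn | hn
  · rw [hs.symm.apply_span hn hz]; exact zero_le_one
  · exact h n hn

theorem cutBody_subset (hs : IsSplitting N t C₁ C₂) : cutBody N ⊆ cutBody C₂ :=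
  fun _ hx n hn => hx n (hs.union_eq ▸ Or.inr hn)

variable (hc : IsCompl (Submodule.span ℝ (t '' C₂)) (Submodule.span ℝ (t '' C₁)))

theorem apply_projection (hs : IsSplitting N t C₁ C₂) {n : E →L[ℝ] ℝ} (hn : n ∈ C₂) (x : E) :
    n (Submodule.projection _ _ hc x) = n x := by
  have := hs.apply_span hn (Submodule.sub_projection_mem hc x)
  rw [map_sub] at this
  linarith

/-- Only the C₂ inequalities survive adding the lattice of C₁. Conversely, cover the component of x
along the first span by a tile v₁ + v₂; subtracting v₁ from x then fixes the C₁ inequalities and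
leaves those of C₂ unchanged. -/
theorem cutBody_add_closure (hs : IsSplitting N t C₁ C₂)
    (hc : IsCompl (Submodule.span ℝ (t '' C₂)) (Submodule.span ℝ (t '' C₁)))
    (h : IsLatticeTiling N t (AddSubgroup.closure (t '' N))) :
    cutBody N + (AddSubgroup.closure (t '' C₁) : Set E) = cutBody C₂ := by
  apply Set.Subset.antisymm
  · rintro _ ⟨x, hx, v, hv, rfl⟩ n hn
    simp only [map_add]
    rw [hs.apply_span hn (closure_le_span _ hv), add_zero]
    exact hs.cutBody_subset hx n hn
  · intro x hx
    obtain ⟨v, hv, hQ⟩ := h.cover (x - Submodule.projection _ _ hc x)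
    obtain ⟨v₁, hv₁, v₂, hv₂, rfl⟩ := hs.exists_add hv
    refine ⟨x - v₁, fun n hn => ?_, v₁, hv₁, by simp⟩
    have h1 := hQ n hn
    rw [← hs.union_eq] at hn
    rcases hn with hn | hn
    · simp only [map_sub, map_add, hs.symm.apply_span hn (closure_le_span _ hv₂),
        hs.symm.apply_span hn (Submodule.projection_apply_mem hc x)] at h1 ⊢
      linarith
    · rw [map_sub, hs.apply_span hn (closure_le_span _ hv₁), sub_zero]
      exact hx n hn

variable {P : Set E} {c : E}

/-- Projection and slice agree: y lifts to c + (y - π c) in the slice through the centre, where the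
C₁ inequalities hold trivially. -/
theorem mem_image_projection (hs : IsSplitting N t C₁ C₂) (hP : ∀ x, x ∈ P ↔ x - c ∈ cutBody N)
    {y : E} : y ∈ Submodule.projection _ _ hc '' P ↔
      y ∈ Submodule.span ℝ (t '' C₂) ∧ y - Submodule.projection _ _ hc c ∈ cutBody C₂ := by
  constructor
  · rintro ⟨x, hx, rfl⟩
    refine ⟨Submodule.projection_apply_mem hc x, fun n hn => ?_⟩
    rw [← map_sub, hs.apply_projection hc hn]
    exact hs.cutBody_subset ((hP x).1 hx) n hn
  · rintro ⟨hy, h⟩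
    have hy' : y - Submodule.projection _ _ hc c ∈ Submodule.span ℝ (t '' C₂) :=
      Submodule.sub_mem _ hy (Submodule.projection_apply_mem hc c)
    refine ⟨c + (y - Submodule.projection _ _ hc c), (hP _).2 ?_, ?_⟩
    · rw [add_sub_cancel_left]
      exact hs.mem_cutBody_of_span hy' h
    · rw [map_add, (Submodule.projection_eq_self_iff hc _).2 hy']
      abel

theorem mem_add_closure (hs : IsSplitting N t C₁ C₂) (hP : ∀ x, x ∈ P ↔ x - c ∈ cutBody N)
    (hc : IsCompl (Submodule.span ℝ (t '' C₂)) (Submodule.span ℝ (t '' C₁)))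
    (h : IsLatticeTiling N t (AddSubgroup.closure (t '' N))) {x : E} :
    x ∈ P + (AddSubgroup.closure (t '' C₁) : Set E) ↔ x - c ∈ cutBody C₂ := by
  rw [← hs.cutBody_add_closure hc h]
  constructor
  · rintro ⟨p, hp, v, hv, rfl⟩
    refine ⟨p - c, (hP p).1 hp, v, hv, ?_⟩
    simp only; abel
  · rintro ⟨p, hp, v, hv, e⟩
    refine ⟨p + c, (hP _).2 (by simpa using hp), v, hv, ?_⟩
    simp only at e ⊢
    rw [add_right_comm, e, sub_add_cancel]

theorem convex_add_closure (hs : IsSplitting N t C₁ C₂) (hP : ∀ x, x ∈ P ↔ x - c ∈ cutBody N)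
    (hc : IsCompl (Submodule.span ℝ (t '' C₂)) (Submodule.span ℝ (t '' C₁)))
    (h : IsLatticeTiling N t (AddSubgroup.closure (t '' N))) :
    Convex ℝ (P + (AddSubgroup.closure (t '' C₁) : Set E)) := by
  have : P + (AddSubgroup.closure (t '' C₁) : Set E) = c +ᵥ cutBody C₂ := by
    ext x
    rw [hs.mem_add_closure hP hc h, Set.mem_vadd_set_iff_neg_vadd_mem, vadd_eq_add, sub_eq_neg_add]
  rw [this]
  exact convex_cutBody.vadd c

theorem add_closure_eq_span_add (hs : IsSplitting N t C₁ C₂)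
    (hP : ∀ x, x ∈ P ↔ x - c ∈ cutBody N)
    (h : IsLatticeTiling N t (AddSubgroup.closure (t '' N))) :
    P + (AddSubgroup.closure (t '' C₁) : Set E) =
      (Submodule.span ℝ (t '' C₁) : Set E) + Submodule.projection _ _ hc '' P := by
  ext x
  rw [hs.mem_add_closure hP hc h]
  constructor
  · intro hx
    refine ⟨x - Submodule.projection _ _ hc x, Submodule.sub_projection_mem hc x,
      Submodule.projection _ _ hc x, ?_, by simp⟩
    rw [hs.mem_image_projection hc hP]
    refine ⟨Submodule.projection_apply_mem hc x, fun n hn => ?_⟩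
    rw [← map_sub, hs.apply_projection hc hn]
    exact hx n hn
  · rintro ⟨l, hl, _, ⟨p, hp, rfl⟩, rfl⟩ n hn
    simp only [map_sub, map_add, hs.apply_span hn hl, hs.apply_projection hc hn]
    have := (hP p).1 hp n (hs.union_eq ▸ Or.inr hn)
    rw [map_sub] at this
    linarith

theorem affineSpan_image_projection (hdim : affineSpan ℝ P = ⊤) :
    affineSpan ℝ (Submodule.projection _ _ hc '' P) =
      (Submodule.span ℝ (t '' C₂)).toAffineSubspace := by
  have := AffineSubspace.map_span (Submodule.projection _ _ hc).toAffineMap P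
  rw [hdim] at this
  rw [← LinearMap.coe_toAffineMap, ← this]
  ext x
  simp only [AffineSubspace.mem_map, AffineSubspace.mem_top, true_and, LinearMap.coe_toAffineMap,
    Submodule.mem_toAffineSubspace]
  rw [← LinearMap.mem_range, Submodule.range_projection]

/-- A relative interior point can be pushed a little along the projection of a witness of n, on
which n equals 1 for n in C₂; the normals of C₁ vanish at the point. Disjointness of relative
interiors thus reduces to that of the full tiles. -/
theorem lt_one_of_mem_intrinsicInterior (hs : IsSplitting N t C₁ C₂) (hN : IsIrredundant N)
    (hP : ∀ x, x ∈ P ↔ x - c ∈ cutBody N) (hdim : affineSpan ℝ P = ⊤)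
    {s x : E} (hsm : s ∈ Submodule.span ℝ (t '' C₂))
    (hx : x ∈ intrinsicInterior ℝ (s +ᵥ Submodule.projection _ _ hc '' P)) :
    x - s - Submodule.projection _ _ hc c ∈ Submodule.span ℝ (t '' C₂) ∧
      ∀ n ∈ N, n (x - s - Submodule.projection _ _ hc c) < 1 := by
  set P₂ := Submodule.projection _ _ hc '' P with hP₂
  have hmem : ∀ y, y ∈ P₂ ↔ y ∈ Submodule.span ℝ (t '' C₂) ∧
    y - Submodule.projection _ _ hc c ∈ cutBody C₂ := fun y => hs.mem_image_projection hc hP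
  have haff : ∀ y, y ∈ affineSpan ℝ (s +ᵥ P₂) ↔ y ∈ Submodule.span ℝ (t '' C₂) := by
    intro y
    rw [← AffineSubspace.pointwise_vadd_span, affineSpan_image_projection hc hdim]
    have e : y = s +ᵥ (y - s) := by simp
    rw [e, AffineSubspace.vadd_mem_pointwise_vadd_iff, Submodule.mem_toAffineSubspace, ← e]
    exact Submodule.sub_mem_iff_left _ hsm
  obtain ⟨y, hy, rfl⟩ := mem_intrinsicInterior.1 hx
  have hy₀ : y ∈ Subtype.val ⁻¹' (s +ᵥ P₂) := interior_subset hy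
  have hyP' : (y : E) ∈ s +ᵥ P₂ := hy₀
  rw [Set.mem_vadd_set_iff_neg_vadd_mem, vadd_eq_add, neg_add_eq_sub, hmem] at hyP'
  have hzL : (y : E) - s - Submodule.projection _ _ hc c ∈ Submodule.span ℝ (t '' C₂) :=
    Submodule.sub_mem _ hyP'.1 (Submodule.projection_apply_mem hc c)
  refine ⟨hzL, fun n hn => ?_⟩
  obtain ⟨p, hp, -⟩ := hN.witness n hn
  rw [← hs.union_eq] at hn
  rcases hn with hn | hn
  · rw [hs.symm.apply_span hn hzL]; exact zero_lt_one
  set q := Submodule.projection _ _ hc p with hq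
  have hqL : q ∈ Submodule.span ℝ (t '' C₂) := Submodule.projection_apply_mem hc p
  have hnq : n q = 1 := by rw [hq, hs.apply_projection hc hn, hp]
  let g : ℝ → affineSpan ℝ (s +ᵥ P₂) := fun ε => ⟨y + ε • q, (haff _).2
    (Submodule.add_mem _ ((haff _).1 y.2) (Submodule.smul_mem _ _ hqL))⟩
  have hg : Continuous g := by
    refine Continuous.subtype_mk ?_ _
    fun_prop
  have hg0 : g 0 = y := Subtype.ext (by simp [g])
  have ht : Tendsto g (𝓝[>] 0) (𝓝 y) := by
    have := hg.tendsto 0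
    rw [hg0] at this
    exact this.mono_left nhdsWithin_le_nhds
  obtain ⟨ε, h1, hε⟩ := ((ht.eventually (mem_interior_iff_mem_nhds.1 hy)).and
    self_mem_nhdsWithin).exists
  have hε : 0 < ε := hε
  have h2 : (y : E) + ε • q ∈ s +ᵥ P₂ := h1
  rw [Set.mem_vadd_set_iff_neg_vadd_mem, vadd_eq_add, hmem] at h2
  have h3 := h2.2 n hn
  simp only [map_sub, map_add, map_neg, map_smul, smul_eq_mul, hnq] at h3 ⊢
  linarith

theorem isFaceToFaceTiling_image (hs : IsSplitting N t C₁ C₂)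
    (h : IsLatticeTiling N t (AddSubgroup.closure (t '' N)))
    (hP : ∀ x, x ∈ P ↔ x - c ∈ cutBody N) (hdim : affineSpan ℝ P = ⊤) :
    IsFaceToFaceTiling (Submodule.span ℝ (t '' C₂) : Set E)
      (Submodule.projection _ _ hc '' P) (AddSubgroup.closure (t '' C₂) : Set E) := by
  set P₂ := Submodule.projection _ _ hc '' P with hP₂
  have hmem : ∀ y, y ∈ P₂ ↔ y ∈ Submodule.span ℝ (t '' C₂) ∧
    y - Submodule.projection _ _ hc c ∈ cutBody C₂ := fun y => hs.mem_image_projection hc hP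
  set c₂ := Submodule.projection _ _ hc c with hc₂
  have hc₂L : c₂ ∈ Submodule.span ℝ (t '' C₂) := Submodule.projection_apply_mem hc c
  refine ⟨?_, ?_, ?_⟩
  · ext y
    simp only [Set.mem_iUnion, Set.mem_vadd_set_iff_neg_vadd_mem, vadd_eq_add, hmem]
    constructor
    · rintro ⟨v, hv, hy, -⟩
      have := Submodule.add_mem _ (closure_le_span _ hv) hy
      simpa using this
    · intro hy
      obtain ⟨v, hv, hQ⟩ := h.cover (y - c₂)
      obtain ⟨v₁, hv₁, v₂, hv₂, rfl⟩ := hs.exists_add hv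
      refine ⟨v₂, hv₂, Submodule.add_mem _ (Submodule.neg_mem _ (closure_le_span _ hv₂)) hy,
        fun n hn => ?_⟩
      have h1 := hs.cutBody_subset hQ n hn
      simp only [map_sub, map_add, map_neg, hs.apply_span hn (closure_le_span _ hv₁)] at h1 ⊢
      linarith
  · intro s hsm s' hsm' hne
    rw [Set.disjoint_left]
    intro x hx hx'
    obtain ⟨hL, h1⟩ := hs.lt_one_of_mem_intrinsicInterior hc h.toIsIrredundant hP hdim
      (closure_le_span _ hsm) hx
    obtain ⟨-, h2⟩ := hs.lt_one_of_mem_intrinsicInterior hc h.toIsIrredundant hP hdim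
      (closure_le_span _ hsm') hx'
    refine h.disjoint (s' - s) (hs.closure_le (AddSubgroup.sub_mem _ hsm' hsm))
      (sub_ne_zero.2 hne.symm) _ h1 ?_
    convert h2 using 4
    abel
  · intro s hsm s' hsm'
    have hv : s' - s ∈ AddSubgroup.closure (t '' C₂) := AddSubgroup.sub_mem _ hsm' hsm
    set v := s' - s with hvdef
    have key : IsExposed ℝ P₂ {y ∈ P₂ | y - v ∈ P₂} := by
      have hQ : ∀ y, y ∈ P₂ → y - c₂ ∈ cutBody N := fun y hy =>
        hs.mem_cutBody_of_span (Submodule.sub_mem _ ((hmem y).1 hy).1 hc₂L) ((hmem y).1 hy).2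
      have hmem' : ∀ y, y ∈ Submodule.span ℝ (t '' C₂) → y - c₂ ∈ cutBody N → y ∈ P₂ :=
        fun y hy hyQ => (hmem y).2 ⟨hy, hs.cutBody_subset hyQ⟩
      have hvv : ∀ y, y - v - c₂ = y - c₂ - v := fun y => by abel
      rintro ⟨y₀, hy₀, hy₀v⟩
      have hz₀ : y₀ - c₂ ∈ {x ∈ cutBody N | x - v ∈ cutBody N} :=
        ⟨hQ _ hy₀, by rw [← hvv]; exact hQ _ hy₀v⟩
      -- The functional exposing the common face of the full tiles serves for the slice too: the
      -- maximum over the body is already attained in the slice, at y₀ - c₂.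
      obtain ⟨l, hl⟩ := h.exposed v (hs.closure_le hv) ⟨_, hz₀⟩
      have hl' : ∀ x ∈ cutBody N, x - v ∈ cutBody N ↔ ∀ z ∈ cutBody N, l z ≤ l x := by
        intro x hx
        have := Set.ext_iff.1 hl x
        simpa [hx] using this
      refine ⟨l, ?_⟩
      ext y
      simp only [Set.mem_ofPred_eq]
      refine and_congr_right fun hy => ⟨fun hyv y' hy' => ?_, fun hmax => ?_⟩
      · have := (hl' _ (hQ y hy)).1 (by rw [← hvv]; exact hQ _ hyv) _ (hQ y' hy')
        simp only [map_sub] at this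
        linarith
      · refine hmem' _ (Submodule.sub_mem _ ((hmem y).1 hy).1 (closure_le_span _ hv)) ?_
        rw [hvv]
        refine (hl' _ (hQ y hy)).2 fun z hz => ?_
        have h1 := (hl' _ hz₀.1).1 hz₀.2 z hz
        have h2 := hmax y₀ hy₀
        rw [map_sub] at h1 ⊢
        linarith
    have := key.vadd_set s
    convert this using 1
    ext x
    simp only [Set.mem_ofPred_eq, Set.mem_vadd_set_iff_neg_vadd_mem, vadd_eq_add,
      Set.mem_inter_iff]
    refine and_congr_right fun _ => ?_
    apply iff_of_eq; congr 1; rw [hvdef]; abel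

theorem isParallelohedron_image (hs : IsSplitting N t C₁ C₂)
    (h : IsLatticeTiling N t (AddSubgroup.closure (t '' N)))
    (hP : ∀ x, x ∈ P ↔ x - c ∈ cutBody N) (hdim : affineSpan ℝ P = ⊤) (hpoly : IsPolytope P) :
    IsParallelohedron (Submodule.projection _ _ hc '' P) := by
  refine ⟨?_, (AddSubgroup.closure (t '' C₂) : Set E), ?_⟩
  · obtain ⟨S, hS, hne, rfl⟩ := hpoly
    exact ⟨_, hS.image _, hne.image _, LinearMap.image_convexHull _ _⟩
  · rw [affineSpan_image_projection hc hdim]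
    exact hs.isFaceToFaceTiling_image hc h hP hdim

end IsSplitting

end Splitting

/-! ### Facets, ridges and belts in terms of normals. -/

section Facets

open Topology Filter

variable {E : Type*} [NormedAddCommGroup E] [NormedSpace ℝ E]

/-- The part of `P` on which the inequality `n (x - c) ≤ 1` is an equality. -/
def facetSet (P : Set E) (c : E) (n : E →L[ℝ] ℝ) : Set E := {x ∈ P | n (x - c) = 1}

/-- `P` is the translate by `c` of the body `cutBody N`. -/
structure IsCutBody (P : Set E) (c : E) (N : Set (E →L[ℝ] ℝ)) : Prop extends IsIrredundant N where
  mem_iff : ∀ x, x ∈ P ↔ x - c ∈ cutBody N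

variable {P : Set E} {c : E} {N : Set (E →L[ℝ] ℝ)} {t : (E →L[ℝ] ℝ) → E} {L : AddSubgroup E}

namespace IsCutBody

theorem add_mem (h : IsCutBody P c N) {q : E} (hq : q ∈ cutBody N) : c + q ∈ P :=
  (h.mem_iff _).2 (by simpa using hq)

theorem add_mem_facetSet (h : IsCutBody P c N) {n : E →L[ℝ] ℝ} {q : E} (hq : q ∈ cutBody N)
    (hn : n q = 1) : c + q ∈ facetSet P c n := ⟨h.add_mem hq, by simpa using hn⟩

theorem apply_le (h : IsCutBody P c N) {n : E →L[ℝ] ℝ} (hn : n ∈ N) {x : E} (hx : x ∈ P) :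
    n (x - c) ≤ 1 := (h.mem_iff x).1 hx n hn

theorem convex (h : IsCutBody P c N) : Convex ℝ P := by
  have : P = c +ᵥ cutBody N := by
    ext x
    rw [h.mem_iff, Set.mem_vadd_set_iff_neg_vadd_mem, vadd_eq_add, sub_eq_neg_add]
  rw [this]
  exact convex_cutBody.vadd c

theorem vectorSpan_facetSet (h : IsCutBody P c N) {n : E →L[ℝ] ℝ} (hn : n ∈ N) :
    vectorSpan ℝ (facetSet P c n) = LinearMap.ker (n : E →ₗ[ℝ] ℝ) := by
  apply le_antisymm
  · rw [vectorSpan_def, Submodule.span_le]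
    rintro _ ⟨x, hx, y, hy, rfl⟩
    have h1 := hx.2
    have h2 := hy.2
    simp only [map_sub] at h1 h2
    simp only [SetLike.mem_coe, LinearMap.mem_ker, ContinuousLinearMap.coe_coe, vsub_eq_sub, map_sub]
    linarith
  · intro v hv
    obtain ⟨p, hp, hlt⟩ := h.witness n hn
    obtain ⟨ε, hε, ⟨h1, h1'⟩, -⟩ := h.toIsIrredundant.exists_pos_facet hp hlt hv
    have := vsub_mem_vectorSpan ℝ (h.add_mem_facetSet h1 h1')
      (h.add_mem_facetSet (mem_cutBody_of_witness hp hlt) hp)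
    rw [vsub_eq_sub, show c + (p + ε • v) - (c + p) = ε • v by abel] at this
    exact (Submodule.smul_mem_iff _ hε.ne').1 this

theorem facetSet_injOn (h : IsCutBody P c N) : Set.InjOn (facetSet P c) N := by
  intro n hn m hm e
  obtain ⟨p, hp, hlt⟩ := h.witness n hn
  have h1 := h.add_mem_facetSet (mem_cutBody_of_witness hp hlt) hp
  rw [e] at h1
  by_contra hne
  have h2 := hlt m hm (Ne.symm hne)
  have h3 := h1.2
  rw [add_sub_cancel_left] at h3
  linarith

theorem finrank_ker [FiniteDimensional ℝ E] (h : IsCutBody P c N) {n : E →L[ℝ] ℝ} (hn : n ∈ N) :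
    Module.finrank ℝ (LinearMap.ker (n : E →ₗ[ℝ] ℝ)) + 1 = Module.finrank ℝ E := by
  refine Module.Dual.finrank_ker_add_one_of_ne_zero (f := (n : E →ₗ[ℝ] ℝ)) ?_
  intro h0
  exact h.toIsIrredundant.ne_zero hn (ContinuousLinearMap.coe_injective h0)

theorem isFacet_facetSet [FiniteDimensional ℝ E] (h : IsCutBody P c N)
    (hdim : affineSpan ℝ P = ⊤) {n : E →L[ℝ] ℝ} (hn : n ∈ N) : IsFacet P (facetSet P c n) := by
  obtain ⟨p, hp, hlt⟩ := h.witness n hn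
  have hpF := h.add_mem_facetSet (mem_cutBody_of_witness hp hlt) hp
  refine ⟨fun _ => ⟨n, ?_⟩, ⟨_, hpF⟩, ?_⟩
  · ext x
    refine and_congr_right fun hx => ⟨fun h1 y hy => ?_, fun hmax => ?_⟩
    · have := h.apply_le hn hy
      rw [map_sub] at h1 this
      linarith
    · have h1 := hmax _ hpF.1
      have h2 := h.apply_le hn hx
      rw [map_add, hp] at h1
      rw [map_sub] at h2 ⊢
      linarith
  · rw [h.vectorSpan_facetSet hn, h.finrank_ker hn,
      AffineSubspace.vectorSpan_eq_top_of_affineSpan_eq_top ℝ E E hdim, finrank_top]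

/-- Averaging points of F that are strict for one normal at a time yields a point strict for all. -/
theorem exists_lt_one (h : IsCutBody P c N) {F : Set E} (hF : Convex ℝ F) (hFP : F ⊆ P)
    (hne : F.Nonempty) (hlt : ∀ n ∈ N, ∃ x ∈ F, n (x - c) < 1) :
    ∃ x ∈ F, ∀ n ∈ N, n (x - c) < 1 := by
  have key : ∀ S : Set (E →L[ℝ] ℝ), S.Finite → S ⊆ N → ∃ x ∈ F, ∀ n ∈ S, n (x - c) < 1 := by
    intro S hS
    induction S, hS using Set.Finite.induction_on with
    | empty => exact fun _ => ⟨hne.some, hne.some_mem, by simp⟩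
    | @insert n S _ _ ih =>
      intro hsub
      obtain ⟨x, hx, hxS⟩ := ih ((Set.subset_insert _ _).trans hsub)
      obtain ⟨y, hy, hyn⟩ := hlt n (hsub (Set.mem_insert _ _))
      refine ⟨(1 / 2 : ℝ) • x + (1 / 2 : ℝ) • y,
        hF hx hy (by norm_num) (by norm_num) (by norm_num), ?_⟩
      have e : ∀ m : E →L[ℝ] ℝ, m ((1 / 2 : ℝ) • x + (1 / 2 : ℝ) • y - c) =
          1 / 2 * m (x - c) + 1 / 2 * m (y - c) := by
        intro m
        simp only [map_sub, map_add, map_smul, smul_eq_mul]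
        ring
      rintro m (rfl | hm)
      · rw [e]
        have := h.apply_le (hsub (Set.mem_insert _ _)) (hFP hx)
        linarith
      · rw [e]
        have := h.apply_le (hsub (Set.mem_insert_of_mem _ hm)) (hFP hy)
        have := hxS m hm
        linarith
  exact key N h.finite subset_rfl

/-- If F lay in none of the bounding hyperplanes it would contain an interior point, where the
exposing functional would have to vanish identically. So F lies in some facet of a normal n, and
equality of dimensions makes the exposing functional a positive multiple of n. -/
theorem exists_eq_facetSet [FiniteDimensional ℝ E] (h : IsCutBody P c N) {F : Set E}
    (hF : IsFacet P F) (hdim : affineSpan ℝ P = ⊤) : ∃ n ∈ N, F = facetSet P c n := by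
  obtain ⟨hexp, hne, hfin⟩ := hF
  have hFP : F ≠ P := by
    rintro rfl
    omega
  have hsub : F ⊆ P := hexp.subset
  obtain ⟨l, hl⟩ := hexp hne
  have hmem : ∀ x ∈ P, x ∈ F ↔ ∀ y ∈ P, l y ≤ l x := by
    intro x hx
    have := Set.ext_iff.1 hl x
    simpa [hx] using this
  have hl0 : ¬ ∀ x, l x = 0 := fun h0 => hFP (hsub.antisymm fun x hx =>
    (hmem x hx).2 fun y _ => by rw [h0, h0])
  obtain ⟨n, hn, hFn⟩ : ∃ n ∈ N, F ⊆ facetSet P c n := by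
    by_contra! hc
    obtain ⟨x, hx, hlt⟩ := h.exists_lt_one (hexp.convex h.convex) hsub hne (by
      intro n hn
      obtain ⟨x, hx, hxn⟩ := Set.not_subset.1 (hc n hn)
      exact ⟨x, hx, lt_of_le_of_ne (h.apply_le hn (hsub hx)) fun e => hxn ⟨hsub hx, e⟩⟩)
    refine hl0 fun u => ?_
    obtain ⟨ε, hε, hs⟩ := h.toIsIrredundant.exists_pos_small (x - c) u
    have hmax := (hmem x (hsub hx)).1 hx
    have h1 := hmax _ (h.add_mem fun m hm => (hs m hm (hlt m hm)).1.le)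
    have h2 := hmax _ (h.add_mem fun m hm => (hs m hm (hlt m hm)).2.le)
    simp only [map_add, map_sub, map_smul, smul_eq_mul] at h1 h2
    have : ε * l u = 0 := by linarith
    exact (mul_eq_zero.1 this).resolve_left hε.ne'
  have hspan : vectorSpan ℝ F = LinearMap.ker (n : E →ₗ[ℝ] ℝ) := by
    refine Submodule.eq_of_le_of_finrank_eq ?_ ?_
    · rw [← h.vectorSpan_facetSet hn]
      exact vectorSpan_mono ℝ hFn
    · have h1 := h.finrank_ker hn
      rw [AffineSubspace.vectorSpan_eq_top_of_affineSpan_eq_top ℝ E E hdim, finrank_top] at hfin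
      omega
  have hker : ∀ v, n v = 0 → l v = 0 := by
    have : vectorSpan ℝ F ≤ LinearMap.ker (l : E →ₗ[ℝ] ℝ) := by
      rw [vectorSpan_def, Submodule.span_le]
      rintro _ ⟨x, hx, y, hy, rfl⟩
      have h1 := (hmem x (hsub hx)).1 hx y (hsub hy)
      have h2 := (hmem y (hsub hy)).1 hy x (hsub hx)
      simp only [SetLike.mem_coe, LinearMap.mem_ker, ContinuousLinearMap.coe_coe, vsub_eq_sub,
        map_sub]
      linarith
    intro v hv
    refine this ?_
    rw [hspan]
    exact hv
  obtain ⟨p, hp, hlt⟩ := h.witness n hn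
  have hln := eq_smul_of_ker hp hker
  have hlx : ∀ x, l x = l p * n x := fun x => by
    conv_lhs => rw [hln]
    simp
  have hpos : 0 < l p := by
    refine lt_of_le_of_ne ?_ fun h0 => hl0 fun x => by rw [hlx, ← h0, zero_mul]
    obtain ⟨x, hx⟩ := hne
    have hc := h.add_mem (q := 0) fun m _ => by simp
    have h1 := (hmem x (hsub hx)).1 hx _ hc
    have h2 := (hFn hx).2
    have h3 := hlx (x - c)
    rw [h2, map_sub] at h3
    rw [add_zero] at h1
    linarith
  refine ⟨n, hn, hFn.antisymm fun x hx => (hmem x hx.1).2 fun y hy => ?_⟩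
  have h1 := h.apply_le hn hy
  have h2 := hlx (x - c)
  have h3 := hlx (y - c)
  rw [hx.2, map_sub] at h2
  rw [map_sub] at h3
  nlinarith

theorem vectorSpan_inter (h : IsCutBody P c N) {n₁ n₂ : E →L[ℝ] ℝ} {y : E}
    (hy : IsRidgePoint N n₁ n₂ y) :
    vectorSpan ℝ (facetSet P c n₁ ∩ facetSet P c n₂) =
      LinearMap.ker (n₁ : E →ₗ[ℝ] ℝ) ⊓ LinearMap.ker (n₂ : E →ₗ[ℝ] ℝ) := by
  apply le_antisymm
  · rw [← h.vectorSpan_facetSet hy.mem₁, ← h.vectorSpan_facetSet hy.mem₂]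
    exact le_inf (vectorSpan_mono ℝ Set.inter_subset_left) (vectorSpan_mono ℝ Set.inter_subset_right)
  · rintro v ⟨h1, h2⟩
    have h1 : n₁ v = 0 := h1
    have h2 : n₂ v = 0 := h2
    obtain ⟨ε, hε, hs⟩ := h.toIsIrredundant.exists_pos_small y v
    have hb : y + ε • v ∈ cutBody N := by
      intro m hm
      by_cases e1 : m = n₁
      · simp [e1, h1, hy.eq₁]
      by_cases e2 : m = n₂
      · simp [e2, h2, hy.eq₂]
      exact (hs m hm (hy.lt m hm e1 e2)).1.le
    have := vsub_mem_vectorSpan ℝ (s := facetSet P c n₁ ∩ facetSet P c n₂)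
      ⟨h.add_mem_facetSet hb (by simp [h1, hy.eq₁]), h.add_mem_facetSet hb (by simp [h2, hy.eq₂])⟩
      ⟨h.add_mem_facetSet hy.mem_cutBody hy.eq₁, h.add_mem_facetSet hy.mem_cutBody hy.eq₂⟩
    rw [vsub_eq_sub, show c + (y + ε • v) - (c + y) = ε • v by abel] at this
    exact (Submodule.smul_mem_iff _ hε.ne').1 this

theorem isRidge_inter [FiniteDimensional ℝ E] (h : IsCutBody P c N) (hdim : affineSpan ℝ P = ⊤)
    {n₁ n₂ : E →L[ℝ] ℝ} {y : E} (hy : IsRidgePoint N n₁ n₂ y) :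
    IsRidge P (facetSet P c n₁ ∩ facetSet P c n₂) := by
  have hyb := h.add_mem hy.mem_cutBody
  refine ⟨fun _ => ⟨n₁ + n₂, ?_⟩, ⟨_, h.add_mem_facetSet hy.mem_cutBody hy.eq₁,
    h.add_mem_facetSet hy.mem_cutBody hy.eq₂⟩, ?_⟩
  · ext x
    simp only [facetSet, Set.mem_inter_iff, Set.mem_ofPred_eq, add_apply]
    constructor
    · rintro ⟨⟨hx, h1⟩, -, h2⟩
      refine ⟨hx, fun z hz => ?_⟩
      have h3 := h.apply_le hy.mem₁ hz
      have h4 := h.apply_le hy.mem₂ hz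
      rw [map_sub] at h1 h2 h3 h4
      linarith
    · rintro ⟨hx, hmax⟩
      have h1 := hmax _ hyb
      rw [map_add, map_add, hy.eq₁, hy.eq₂] at h1
      have h3 := h.apply_le hy.mem₁ hx
      have h4 := h.apply_le hy.mem₂ hx
      rw [map_sub] at h3 h4
      refine ⟨⟨hx, ?_⟩, hx, ?_⟩ <;> rw [map_sub] <;> linarith
  · rw [h.vectorSpan_inter hy, AffineSubspace.vectorSpan_eq_top_of_affineSpan_eq_top ℝ E E hdim,
      finrank_top, ← LinearMap.ker_prod]
    have hsurj : LinearMap.range ((n₁ : E →ₗ[ℝ] ℝ).prod (n₂ : E →ₗ[ℝ] ℝ)) = ⊤ := by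
      rw [LinearMap.range_eq_top]
      rintro ⟨a, b⟩
      obtain ⟨e, he1, he2⟩ := exists_dual_pair hy.ne hy.eq₁ hy.eq₂
      obtain ⟨e', he1', he2'⟩ := exists_dual_pair hy.ne.symm hy.eq₂ hy.eq₁
      exact ⟨a • e + b • e', by simp [he1, he2, he1', he2']⟩
    have := LinearMap.finrank_range_add_finrank_ker
      ((n₁ : E →ₗ[ℝ] ℝ).prod (n₂ : E →ₗ[ℝ] ℝ))
    rw [hsurj, finrank_top, Module.finrank_prod, Module.finrank_self] at this
    omega

/-- Turns belts into sets of normals vanishing on a common kernel, which is the form counted by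
`ncard_hexagon`. -/
theorem belt_inter [FiniteDimensional ℝ E] (h : IsCutBody P c N) (hdim : affineSpan ℝ P = ⊤)
    {n₁ n₂ : E →L[ℝ] ℝ} {y : E} (hy : IsRidgePoint N n₁ n₂ y) :
    belt P (facetSet P c n₁ ∩ facetSet P c n₂) =
      facetSet P c '' {n | n ∈ N ∧ ∀ v, n₁ v = 0 → n₂ v = 0 → n v = 0} := by
  have key : ∀ n ∈ N, vectorSpan ℝ (facetSet P c n₁ ∩ facetSet P c n₂) ≤
      vectorSpan ℝ (facetSet P c n) ↔ ∀ v, n₁ v = 0 → n₂ v = 0 → n v = 0 := by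
    intro n hn
    rw [h.vectorSpan_inter hy, h.vectorSpan_facetSet hn]
    exact ⟨fun hle v h1 h2 => hle ⟨h1, h2⟩, fun hk v hv => hk v hv.1 hv.2⟩
  ext F
  constructor
  · rintro ⟨hF, hle⟩
    obtain ⟨n, hn, rfl⟩ := h.exists_eq_facetSet hF hdim
    exact ⟨n, ⟨hn, (key n hn).1 hle⟩, rfl⟩
  · rintro ⟨n, ⟨hn, hk⟩, rfl⟩
    exact ⟨h.isFacet_facetSet hdim hn, (key n hn).2 hk⟩

end IsCutBody

end Facets

/-! ### From the Venkov graph to a splitting of the normals. -/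

section VenkovGraph

open Topology Filter

variable {E : Type*} [NormedAddCommGroup E] [NormedSpace ℝ E]

/-- `P` is a full-dimensional parallelohedron with centre `c`, whose facet with normal `n` has facet
vector `t n`. -/
structure IsCenteredTile (P : Set E) (c : E) (N : Set (E →L[ℝ] ℝ)) (t : (E →L[ℝ] ℝ) → E) :
    Prop extends IsCutBody P c N where
  dim : affineSpan ℝ P = ⊤
  lattice : IsLatticeTiling N t (AddSubgroup.closure (t '' N))
  symm : IsSymmTiling N t (AddSubgroup.closure (t '' N))

/-- The normals of the facets occurring in a set of pairs of antipodal facets. -/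
def normalsOf (P : Set E) (c : E) (N : Set (E →L[ℝ] ℝ)) (A : Set (VenkovVertex P)) :
    Set (E →L[ℝ] ℝ) := {n ∈ N | ∃ v ∈ A, facetSet P c n ∈ v.1}

variable {P : Set E} {c : E} {N : Set (E →L[ℝ] ℝ)} {t : (E →L[ℝ] ℝ) → E}

namespace IsCenteredTile

/-- By central symmetry the opposite face is exposed by -n, so any facet vector is an `IsNeighbor`
vector, and these are unique. -/
theorem isFacetVector_iff [FiniteDimensional ℝ E] (h : IsCenteredTile P c N t) {n : E →L[ℝ] ℝ}
    (hn : n ∈ N) {τ : E} : IsFacetVector P (facetSet P c n) τ ↔ τ = t n := by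
  have hexp : IsExposed ℝ (cutBody N) {x ∈ cutBody N | -n x = 1} := by
    rintro ⟨p, hp, hp1⟩
    refine ⟨-n, ?_⟩
    ext x
    refine and_congr_right fun hx => ⟨fun h1 y hy => ?_, fun hmax => ?_⟩
    · have := hy (-n) (h.symm.neg_mem n hn)
      rw [neg_apply] at this ⊢
      rw [neg_apply, h1]
      exact this
    · have h1 := hmax p hp
      have h2 := hx (-n) (h.symm.neg_mem n hn)
      rw [neg_apply] at h1 h2
      rw [neg_apply] at h1
      linarith
  have key : ∀ d : E, (∀ x ∈ cutBody N, x - d ∈ cutBody N ↔ n x = 1) → IsNeighbor N n d := by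
    intro d hd
    refine ⟨hd, ?_⟩
    convert hexp using 3 with x
    refine and_congr_right fun hx => ?_
    have h1 := hd (-x) (h.symm.neg_mem_cutBody hx)
    rw [map_neg] at h1
    rw [← h1]
    have e : -x - d = -(x + d) := by abel
    rw [e]
    exact ⟨h.symm.neg_mem_cutBody, fun h2 => by simpa using h.symm.neg_mem_cutBody h2⟩
  have hmem : ∀ d x, x ∈ cutBody N → (c + x ∈ P ∩ (d +ᵥ P) ↔ x - d ∈ cutBody N) := by
    intro d x hx
    rw [Set.mem_inter_iff, Set.mem_vadd_set_iff_neg_vadd_mem, vadd_eq_add, h.mem_iff (-d + _)]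
    rw [show -d + (c + x) - c = x - d by abel]
    exact and_iff_right (h.add_mem hx)
  have hfac : ∀ x, x ∈ cutBody N → (c + x ∈ facetSet P c n ↔ n x = 1) := by
    intro x hx
    simp only [facetSet, Set.mem_ofPred_eq, add_sub_cancel_left]
    exact and_iff_right (h.add_mem hx)
  constructor
  · rintro ⟨-, hτ⟩
    refine (key _ (h.lattice.adjacent n hn)).unique h.toIsIrredundant h.lattice.bounded hn
      (key τ fun x hx => ?_)
    rw [← hmem τ x hx, hτ, hfac x hx]
  · rintro rfl
    refine ⟨h.isFacet_facetSet h.dim hn, ?_⟩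
    ext x
    constructor
    · intro hx
      have hb := (h.mem_iff x).1 hx.1
      have h1 := (hmem (t n) (x - c) hb).1 (by simpa using hx)
      have h2 := (hfac _ hb).2 ((h.lattice.adjacent n hn _ hb).1 h1)
      simpa using h2
    · intro hx
      have hb := (h.mem_iff x).1 hx.1
      have h1 := (hmem (t n) (x - c) hb).2 ((h.lattice.adjacent n hn _ hb).2 hx.2)
      simpa using h1

theorem pointReflection_image (h : IsCenteredTile P c N t) :
    Equiv.pointReflection c '' P = P := by
  have hsub : ∀ x ∈ P, Equiv.pointReflection c x ∈ P := by
    intro x hx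
    rw [Equiv.pointReflection_apply, vsub_eq_sub, vadd_eq_add, h.mem_iff, add_sub_cancel_right,
      ← neg_sub]
    exact h.symm.neg_mem_cutBody ((h.mem_iff x).1 hx)
  apply Set.Subset.antisymm
  · rintro _ ⟨x, hx, rfl⟩
    exact hsub x hx
  · intro x hx
    exact ⟨_, hsub x hx, Equiv.pointReflection_involutive c x⟩

theorem pointReflection_image_facetSet (h : IsCenteredTile P c N t) (n : E →L[ℝ] ℝ) :
    Equiv.pointReflection c '' facetSet P c n = facetSet P c (-n) := by
  have hsub : ∀ m : E →L[ℝ] ℝ, ∀ x ∈ facetSet P c m,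
      Equiv.pointReflection c x ∈ facetSet P c (-m) := by
    intro m x hx
    refine ⟨h.pointReflection_image ▸ Set.mem_image_of_mem _ hx.1, ?_⟩
    rw [Equiv.pointReflection_apply, vsub_eq_sub, vadd_eq_add, add_sub_cancel_right, neg_apply,
      ← map_neg, neg_sub]
    exact hx.2
  apply Set.Subset.antisymm
  · rintro _ ⟨x, hx, rfl⟩
    exact hsub n x hx
  · intro x hx
    have := hsub _ x hx
    rw [neg_neg] at this
    exact ⟨_, this, Equiv.pointReflection_involutive c x⟩

theorem isAntipodal [FiniteDimensional ℝ E] (h : IsCenteredTile P c N t) {n : E →L[ℝ] ℝ}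
    (hn : n ∈ N) : IsAntipodal P (facetSet P c n) (facetSet P c (-n)) :=
  ⟨h.isFacet_facetSet h.dim hn, h.isFacet_facetSet h.dim (h.symm.neg_mem n hn), c,
    h.pointReflection_image, h.pointReflection_image_facetSet n⟩

/-- Two point reflections compose to the translation by 2 (c' - c), which cannot preserve a bounded
body unless it is trivial. -/
theorem eq_center (h : IsCenteredTile P c N t) {c' : E}
    (hc' : Equiv.pointReflection c' '' P = P) : c' = c := by
  have h0 : (2 : ℝ) • (c' - c) = 0 := by
    refine eq_zero_of_forall_add_mem h.lattice.bounded (p := 0) (fun m _ => by simp)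
      fun x hx => ?_
    have h1 : Equiv.pointReflection c' (c + -x) ∈ P :=
      hc' ▸ Set.mem_image_of_mem _ (h.add_mem (h.symm.neg_mem_cutBody hx))
    rw [Equiv.pointReflection_apply, vsub_eq_sub, vadd_eq_add, h.mem_iff] at h1
    convert h1 using 1
    module
  exact sub_eq_zero.1 ((smul_eq_zero.1 h0).resolve_left two_ne_zero)

theorem eq_of_isAntipodal [FiniteDimensional ℝ E] (h : IsCenteredTile P c N t) {F F' : Set E}
    (hF : IsAntipodal P F F') : ∃ n ∈ N, F = facetSet P c n ∧ F' = facetSet P c (-n) := by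
  obtain ⟨h1, -, c', hc', rfl⟩ := hF
  obtain ⟨n, hn, rfl⟩ := h.exists_eq_facetSet h1 h.dim
  exact ⟨n, hn, rfl, by rw [h.eq_center hc', h.pointReflection_image_facetSet]⟩

theorem exists_vertex [FiniteDimensional ℝ E] (h : IsCenteredTile P c N t) {n : E →L[ℝ] ℝ}
    (hn : n ∈ N) : ∃ v : VenkovVertex P, facetSet P c n ∈ v.1 :=
  ⟨⟨s(facetSet P c n, facetSet P c (-n)), _, _, h.isAntipodal hn, rfl⟩, Sym2.mem_mk_left _ _⟩

theorem vertex_eq [FiniteDimensional ℝ E] (h : IsCenteredTile P c N t) {n : E →L[ℝ] ℝ}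
    (hn : n ∈ N) {v : VenkovVertex P} (hv : facetSet P c n ∈ v.1) :
    v.1 = s(facetSet P c n, facetSet P c (-n)) := by
  obtain ⟨F, F', hF, e⟩ := v.2
  obtain ⟨m, hm, rfl, rfl⟩ := h.eq_of_isAntipodal hF
  rw [e] at hv ⊢
  rcases Sym2.mem_iff.1 hv with h1 | h1
  · rw [h.facetSet_injOn hn hm h1]
  · rw [h.facetSet_injOn hn (h.symm.neg_mem m hm) h1, neg_neg, Sym2.eq_swap]

theorem vertex_unique [FiniteDimensional ℝ E] (h : IsCenteredTile P c N t) {n : E →L[ℝ] ℝ}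
    (hn : n ∈ N) {v w : VenkovVertex P} (hv : facetSet P c n ∈ v.1) (hw : facetSet P c n ∈ w.1) :
    v = w := Subtype.ext ((h.vertex_eq hn hv).trans (h.vertex_eq hn hw).symm)

theorem neg_mem_normalsOf [FiniteDimensional ℝ E] (h : IsCenteredTile P c N t)
    {A : Set (VenkovVertex P)} {n : E →L[ℝ] ℝ} (hn : n ∈ normalsOf P c N A) :
    -n ∈ normalsOf P c N A := by
  obtain ⟨hn, v, hv, hnv⟩ := hn
  refine ⟨h.symm.neg_mem n hn, v, hv, ?_⟩
  rw [h.vertex_eq hn hnv]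
  exact Sym2.mem_mk_right _ _

theorem facetLattice_eq [FiniteDimensional ℝ E] (h : IsCenteredTile P c N t)
    (A : Set (VenkovVertex P)) :
    facetLattice P A = AddSubgroup.closure (t '' normalsOf P c N A) := by
  unfold facetLattice
  congr 1
  ext τ
  constructor
  · rintro ⟨v, hv, F, hF, hτ⟩
    obtain ⟨n, hn, rfl⟩ := h.exists_eq_facetSet hτ.1 h.dim
    exact ⟨n, ⟨hn, v, hv, hF⟩, ((h.isFacetVector_iff hn).1 hτ).symm⟩
  · rintro ⟨n, ⟨hn, v, hv, hF⟩, rfl⟩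
    exact ⟨v, hv, _, hF, (h.isFacetVector_iff hn).2 rfl⟩

/-- The normals of the facets of a belt of six facets lie in one red component. -/
theorem mem_normalsOf_of_hexagon [FiniteDimensional ℝ E] (h : IsCenteredTile P c N t)
    {A : Set (VenkovVertex P)} (hA : ∀ v ∈ A, ∀ w, (redVenkovGraph P).Adj v w → w ∈ A)
    {n₁ n₂ m k : E →L[ℝ] ℝ} {y : E} (hy : IsHexagon N t n₁ n₂ m y)
    (hn₁ : n₁ ∈ normalsOf P c N A) (hk : k ∈ N) (hker : ∀ v, n₁ v = 0 → n₂ v = 0 → k v = 0) :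
    k ∈ normalsOf P c N A := by
  obtain ⟨w, hw⟩ := h.exists_vertex hk
  obtain ⟨hn₁N, v, hvA, hv⟩ := hn₁
  refine ⟨hk, w, ?_, hw⟩
  by_contra hwA
  refine hwA (hA v hvA w ⟨?_, _, h.isRidge_inter h.dim hy.ridge, ?_, ?_, ?_⟩)
  · rintro rfl
    exact hwA hvA
  · rw [h.belt_inter h.dim hy.ridge, Set.InjOn.ncard_image
      (h.facetSet_injOn.mono fun n hn => hn.1), h.symm.ncard_hexagon hy]
  all_goals
    intro F hF
    rw [h.belt_inter h.dim hy.ridge]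
  · rw [h.vertex_eq hn₁N hv] at hF
    rcases Sym2.mem_iff.1 hF with rfl | rfl
    · exact ⟨n₁, ⟨hn₁N, fun v h1 _ => h1⟩, rfl⟩
    · exact ⟨-n₁, ⟨h.symm.neg_mem _ hn₁N, fun v h1 _ => by simp [h1]⟩, rfl⟩
  · rw [h.vertex_eq hk hw] at hF
    rcases Sym2.mem_iff.1 hF with rfl | rfl
    · exact ⟨k, ⟨hk, hker⟩, rfl⟩
    · exact ⟨-k, ⟨h.symm.neg_mem _ hk, fun v h1 h2 => by simp [hker v h1 h2]⟩, rfl⟩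

/-- A set of vertices closed under red edges has normals closed under belts of six, and symmetric
under negation, so `apply_facetVector_eq_zero` applies to it. -/
theorem apply_eq_zero [FiniteDimensional ℝ E] (h : IsCenteredTile P c N t)
    {A B : Set (VenkovVertex P)} (hA : ∀ v ∈ A, ∀ w, (redVenkovGraph P).Adj v w → w ∈ A)
    (hAB : Disjoint A B) {n k : E →L[ℝ] ℝ} (hn : n ∈ normalsOf P c N A)
    (hk : k ∈ normalsOf P c N B) : n (t k) = 0 := by
  have : ProperSpace E := FiniteDimensional.proper ℝ E
  obtain ⟨r, hr, hsep⟩ := h.toIsIrredundant.exists_separation h.lattice.disjoint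
  have hdisj : ∀ m ∈ normalsOf P c N B, m ∉ normalsOf P c N A := by
    rintro m ⟨hm, v, hv, hmv⟩ ⟨-, w, hw, hmw⟩
    rw [h.vertex_unique hm hmv hmw] at hv
    exact Set.disjoint_left.1 hAB hw hv
  refine h.symm.apply_facetVector_eq_zero (C := normalsOf P c N A)
    (countable_of_separated hr hsep) (Set.sep_subset _ _) ?_ hn hk.1 (hdisj k hk)
    (hdisj _ (h.neg_mem_normalsOf hk))
  intro n₁ n₂ m y hy hn₁
  refine ⟨h.mem_normalsOf_of_hexagon hA hy hn₁ hy.ridge.mem₂ fun v _ h2 => h2,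
    h.mem_normalsOf_of_hexagon hA hy hn₁ hy.ridge₁.mem₂ fun v h1 h2 => ?_⟩
  obtain ⟨γ, δ, rfl, -⟩ := hy.comb
  simp [h1, h2]

theorem isSplitting [FiniteDimensional ℝ E] (h : IsCenteredTile P c N t)
    {A₁ A₂ : Set (VenkovVertex P)} (hA : A₁ ∪ A₂ = Set.univ) (hdisj : Disjoint A₁ A₂)
    (hred : ∀ v₁ ∈ A₁, ∀ v₂ ∈ A₂, ¬ (redVenkovGraph P).Adj v₁ v₂) :
    IsSplitting N t (normalsOf P c N A₁) (normalsOf P c N A₂) := by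
  have hor : ∀ w, w ∈ A₁ ∨ w ∈ A₂ := fun w => by
    have : w ∈ A₁ ∪ A₂ := hA ▸ Set.mem_univ w
    exact this
  refine ⟨?_, fun n hn k hk => h.apply_eq_zero (fun v hv w hvw => ?_) hdisj hn hk,
    fun n hn k hk => h.apply_eq_zero (fun v hv w hvw => ?_) hdisj.symm hn hk⟩
  · apply Set.Subset.antisymm
    · exact Set.union_subset (Set.sep_subset _ _) (Set.sep_subset _ _)
    · intro n hn
      obtain ⟨v, hv⟩ := h.exists_vertex hn
      exact (hor v).imp (fun h1 => ⟨hn, v, h1, hv⟩) fun h1 => ⟨hn, v, h1, hv⟩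
  · exact (hor w).resolve_right fun hw => hred v hv w hw hvw
  · exact (hor w).resolve_left fun hw => hred w hw v hv hvw.symm

end IsCenteredTile

theorem IsParallelohedron.exists_isCenteredTile [FiniteDimensional ℝ E] (hP : IsParallelohedron P)
    (hdim : affineSpan ℝ P = ⊤) :
    ∃ (c : E) (N : Set (E →L[ℝ] ℝ)) (t : (E →L[ℝ] ℝ) → E), IsCenteredTile P c N t := by
  obtain ⟨c, N, t, hmem, hlat, hsymm⟩ := hP.exists_isSymmTiling hdim
  exact ⟨c, N, t, ⟨⟨hlat.toIsIrredundant, hmem⟩, hdim, hlat, hsymm⟩⟩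

end VenkovGraph

theorem mainTheorem5 (d : ℕ) (P : Set (EuclideanSpace ℝ (Fin d)))
    (hP : IsParallelohedron P) (hdim : affineSpan ℝ P = ⊤)
    (A₁ A₂ : Set (VenkovVertex P)) (hA : A₁ ∪ A₂ = Set.univ) (hdisj : Disjoint A₁ A₂)
    (hred : ∀ v₁ ∈ A₁, ∀ v₂ ∈ A₂, ¬ (redVenkovGraph P).Adj v₁ v₂) :
    Convex ℝ (P + (facetLattice P A₁ : Set (EuclideanSpace ℝ (Fin d)))) ∧
    ∃ h : IsCompl (affLattice P A₂).direction (affLattice P A₁).direction,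
      ∃ P₂ : Set (EuclideanSpace ℝ (Fin d)),
        P₂ = Submodule.projection _ _ h '' P ∧
        P₂ ⊆ (affLattice P A₂ : Set (EuclideanSpace ℝ (Fin d))) ∧
        IsParallelohedron P₂ ∧
        affineSpan ℝ P₂ = affLattice P A₂ ∧
        IsDirectMinkowskiSum
          (P + (facetLattice P A₁ : Set (EuclideanSpace ℝ (Fin d))))
          (affLattice P A₁ : Set (EuclideanSpace ℝ (Fin d))) P₂ := by
  obtain ⟨c, N, t, h⟩ := hP.exists_isCenteredTile hdim
  have hs := h.isSplitting hA hdisj hred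
  have hc := hs.isCompl h.lattice
  have haff : ∀ A : Set (VenkovVertex P), affLattice P A =
      (Submodule.span ℝ (t '' normalsOf P c N A)).toAffineSubspace := fun A => by
    rw [affLattice, h.facetLattice_eq, affineSpan_addSubgroup_closure]
  simp only [haff, h.facetLattice_eq, Submodule.toAffineSubspace_direction]
  have hspan := IsSplitting.affineSpan_image_projection hc hdim
  refine ⟨hs.convex_add_closure h.mem_iff hc h.lattice, hc, _, rfl, ?_,
    hs.isParallelohedron_image hc h.lattice h.mem_iff hdim hP.1, hspan,
    hs.add_closure_eq_span_add hc h.mem_iff h.lattice, ?_⟩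
  · exact (subset_affineSpan ℝ _).trans (congrArg SetLike.coe hspan).subset
  · rw [← direction_affineSpan, ← direction_affineSpan, AffineSubspace.affineSpan_coe, hspan,
      Submodule.toAffineSubspace_direction, Submodule.toAffineSubspace_direction]
    exact hc.symm.disjoint
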